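/- **Problem.** $K\ge 1$ workers minimise $F(x)=\frac1K\sum_{k=1}^K f^{(k)}(x,y^*(x))$ over $x\in\mathbb R^{d_x}$, where $y^*(x)=\arg\min_{y\in\mathbb R^{d_y}}\frac1K\sum_{k} g^{(k)}(x,y)$, $f^{(k)}(x,y)=\mathbb E_{\xi\sim\mathcal D_f^{(k)}}f^{(k)}(x,y;\xi)$ and $g^{(k)}(x,y)=\mathbb E_{\zeta\sim\mathcal D_g^{(k)}}g^{(k)}(x,y;\zeta)$. $F$ is bounded below. **Assumptions**, with positive constants $\mu,\ell_{f_x},\ell_{f_y},c_{f_y},\ell_{g_y},\ell_{g_{xy}},\ell_{g_{yy}},c_{g_{xy}},\sigma$, for every worker, sample and point; all derivatives named here exist, and Lipschitz continuity is joint in $(x,y)$. (i) $g^{(k)}(x,\cdot)$ is $\mu$-strongly convex. (ii) $\nabla_1f^{(k)}(\cdot,\cdot;\xi)$ is $\ell_{f_x}$-Lipschitz, $\nabla_2f^{(k)}(\cdot,\cdot;\xi)$ is $\ell_{f_y}$-Lipschitz, $\|\nabla_2f^{(k)}(x,y;\xi)\|\le c_{f_y}$. (iii) $\nabla_2g^{(k)}(\cdot,\cdot;\zeta)$,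 $\nabla^2_{12}g^{(k)}(\cdot,\cdot;\zeta)$, $\nabla^2_{22}g^{(k)}(\cdot,\cdot;\zeta)$ are $\ell_{g_y}$-, $\ell_{g_{xy}}$-, $\ell_{g_{yy}}$-Lipschitz, $\|\nabla^2_{12}g^{(k)}(x,y;\zeta)\|\le c_{g_{xy}}$, $\mu I\preceq\nabla^2_{22}g^{(k)}(x,y;\zeta)\preceq\ell_{g_y}I$. (iv) The stochastic derivatives $\nabla_1f^{(k)},\nabla_2f^{(k)},\nabla_2g^{(k)},\nabla^2_{12}g^{(k)},\nabla^2_{22}g^{(k)}$ have variance at most $\sigma^2$ around the corresponding derivatives of the full functions $f^{(k)},g^{(k)}$. (v) The mixing matrix $E\in\mathbb R^{K\times K}$ is symmetric and doubly stochastic with eigenvalues $1=|\lambda_1|>|\lambda_2|\ge\dots\ge|\lambda_K|$; $\lambda:=|\lambda_2|$ ($\lambda:=0$ if $K=1$). **Algorithm (DSVRBGD-S).** All workers start from the same $x_0,y_0,z_0$ with $\|z_0\|\le c_{f_y}/\mu$. In iteration $t$ worker $k$ draws a batch of $B_0$ (if $t=0$) or $B$ (if $t\ge1$) samples $\xi\sim\mathcal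 D_f^{(k)}$, $\zeta\sim\mathcal D_g^{(k)}$, independent over iterations, workers and batch indices. With the batch averages $\delta^g_t(x,y)$, $\delta^h_t(x,y,z)$, $\delta^F_t(x,y,z)$ of $\nabla_2g^{(k)}(x,y;\zeta)$, of $\nabla^2_{22}g^{(k)}(x,y;\zeta)z-\nabla_2f^{(k)}(x,y;\xi)$ and of $\nabla_1f^{(k)}(x,y;\xi)-\nabla^2_{12}g^{(k)}(x,y;\zeta)z$, collected as columns over the workers, set $V_0=\delta^g_0(X_0,Y_0)$, $V_t=(1-\alpha_2\eta^2)(V_{t-1}-\delta^g_t(X_{t-1},Y_{t-1}))+\delta^g_t(X_t,Y_t)$ for $t\ge 1$, and likewise $W_t$ from $\delta^h_t(X,Y,Z)$ with $\alpha_3$ and $U_t$ from $\delta^F_t(X,Y,Z)$ with $\alpha_1$. With $P_{-1}=Q_{-1}=R_{-1}=U_{-1}=V_{-1}=W_{-1}=0$, $$Q_t=Q_{t-1}E+V_t-V_{t-1},\quad R_t=R_{t-1}E+W_t-W_{t-1},\quad P_t=P_{t-1}E+U_t-U_{t-1},$$ $$Y_{t+1}=Y_t+\eta(Y_tE-\beta_2Q_t-Y_t),\quad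 Z_{t+1}=Z_t+\eta(\mathcal P(Z_tE-\beta_3R_t)-Z_t),\quad X_{t+1}=X_t+\eta(X_tE-\beta_1P_t-X_t),$$ where $\mathcal P$ projects each column onto the ball of radius $c_{f_y}/\mu$. Let $\bar x_t=\frac1K\sum_kx_t^{(k)}$. **Claim.** There are constants $a_1,a_2,a_3,b_1,b_2,b_3,e,b_0,C>0$ that depend only on the constants in (i)--(iv) and on upper bounds for $F(x_0)-\inf F$ and $\|y_0-y^*(x_0)\|^2$ (not on $K,d_x,d_y,E,\varepsilon$ or the problem), such that the following holds for every batch size $B\ge1$ and all sufficiently small $\varepsilon>0$, namely whenever $K^2\varepsilon\le\varepsilon_0$, where $\varepsilon_0>0$ depends only on the same quantities and on an upper bound for $\frac1K\sum_k\big(\|\nabla_1 f^{(k)}-\frac1K\sum_j\nabla_1f^{(j)}\|^2+\|\nabla_2 g^{(k)}-\frac1K\sum_j\nabla_2g^{(j)}\|^2\big)$ at the single point $(x_0,y_0)$. With $$\alpha_i=\frac{a_i}{K},\quad\beta_1=b_1(1-\lambda)^4,\quad\beta_2=b_2(1-\lambda)^2,\quad\beta_3=b_3(1-\lambda)^4,\quad\eta=eK\varepsilon^{1/2},\quad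 B_0=\Big\lceil\frac{b_0}{\varepsilon^{1/2}}\Big\rceil,\quad T=\Big\lceil\frac{C}{K(1-\lambda)^4\varepsilon^{3/2}}\Big\rceil,$$ one has $\eta\le1$ and $\alpha_i\eta^2<1$, $F$ is differentiable, every $\|\nabla F(\bar x_t)\|^2$ is integrable, and $$\frac1T\sum_{t=0}^{T-1}\mathbb E\big[\|\nabla F(\bar x_t)\|^2\big]\le\varepsilon .$$ Each iteration has one communication round, in which a worker sends at most $4(d_x+d_y)$ real numbers to each neighbour. -/

import Mathlib

open MeasureTheory ProbabilityTheory
open scoped RealInnerProductSpace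

noncomputable section

namespace DBO

/-- Euclidean space `ℝⁿ`. -/
abbrev Vec (n : ℕ) : Type := EuclideanSpace ℝ (Fin n)

section Derivatives

variable {dx dy : ℕ}

/-- Gradient `∇₁ φ (x, y)` with respect to the first argument. -/
def grad₁ (φ : Vec dx → Vec dy → ℝ) (x : Vec dx) (y : Vec dy) : Vec dx :=
  gradient (fun x' => φ x' y) x

/-- Gradient `∇₂ φ (x, y)` with respect to the second argument. -/
def grad₂ (φ : Vec dx → Vec dy → ℝ) (x : Vec dx) (y : Vec dy) : Vec dy :=
  gradient (fun y' => φ x y') y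

/-- Hessian `∇²₂₂ φ (x, y)`, a linear map of `ℝ^{dy}`. -/
def hess₂₂ (φ : Vec dx → Vec dy → ℝ) (x : Vec dx) (y : Vec dy) : Vec dy →L[ℝ] Vec dy :=
  fderiv ℝ (fun y' => grad₂ φ x y') y

/-- Mixed second derivative `∇²₁₂ φ (x, y)`, the `dx × dy` matrix with entries
`∂²φ / ∂xᵢ∂yⱼ`, as a linear map `ℝ^{dy} → ℝ^{dx}`: the transpose of the Jacobian in `x`
of `∇₂ φ`. -/
def hess₁₂ (φ : Vec dx → Vec dy → ℝ) (x : Vec dx) (y : Vec dy) : Vec dy →L[ℝ] Vec dx :=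
  ContinuousLinearMap.adjoint (fderiv ℝ (fun x' => grad₂ φ x' y) x)

/-- `h` is `L`-Lipschitz on `ℝ^{dx} × ℝ^{dy}` with its Euclidean norm. -/
def JointLip {V : Type*} [NormedAddCommGroup V] (L : ℝ) (h : Vec dx → Vec dy → V) : Prop :=
  ∀ x y x' y', ‖h x y - h x' y'‖ ≤ L * √(‖x - x'‖ ^ 2 + ‖y - y'‖ ^ 2)

end Derivatives

/-- A random vector `h s`, `s ∼ D`, has mean square deviation at most `σ²` from `m`. -/
def VarLe {S V : Type*} [MeasurableSpace S] [NormedAddCommGroup V]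
    (D : Measure S) (h : S → V) (m : V) (σ : ℝ) : Prop :=
  ∫⁻ s, ‖h s - m‖ₑ ^ 2 ∂D ≤ ENNReal.ofReal (σ ^ 2)

/-- The data of a decentralized stochastic bilevel problem with `K` workers: the sample losses
`f k x y ξ` (upper level), `g k x y ζ` (lower level) and the data distributions of each worker. -/
structure Problem (K dx dy : ℕ) (Ξ Z : Type*) [MeasurableSpace Ξ] [MeasurableSpace Z] where
  f : Fin K → Vec dx → Vec dy → Ξ → ℝ
  g : Fin K → Vec dx → Vec dy → Z → ℝ
  Df : Fin K → Measure Ξ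
  Dg : Fin K → Measure Z

/-- The constants of the regularity assumptions. -/
structure Constants where
  (μ lfx lfy cfy lgy lgxy lgyy cgxy σ : ℝ)
  μ_pos : 0 < μ
  lfx_pos : 0 < lfx
  lfy_pos : 0 < lfy
  cfy_pos : 0 < cfy
  lgy_pos : 0 < lgy
  lgxy_pos : 0 < lgxy
  lgyy_pos : 0 < lgyy
  cgxy_pos : 0 < cgxy
  σ_pos : 0 < σ

namespace Problem

variable {K dx dy : ℕ} {Ξ Z : Type*} [MeasurableSpace Ξ] [MeasurableSpace Z]
  (P : Problem K dx dy Ξ Z)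

/-- Sample loss of the upper level as a function of `(x, y)`. -/
def fS (k : Fin K) (ξ : Ξ) : Vec dx → Vec dy → ℝ := fun x y => P.f k x y ξ

/-- Sample loss of the lower level as a function of `(x, y)`. -/
def gS (k : Fin K) (ζ : Z) : Vec dx → Vec dy → ℝ := fun x y => P.g k x y ζ

/-- `f⁽ᵏ⁾(x, y) = 𝔼 f⁽ᵏ⁾(x, y; ξ)`. -/
def fLoc (k : Fin K) : Vec dx → Vec dy → ℝ := fun x y => ∫ ξ, P.f k x y ξ ∂(P.Df k)

/-- `g⁽ᵏ⁾(x, y) = 𝔼 g⁽ᵏ⁾(x, y; ζ)`. -/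
def gLoc (k : Fin K) : Vec dx → Vec dy → ℝ := fun x y => ∫ ζ, P.g k x y ζ ∂(P.Dg k)

/-- `f(x, y) = (1/K) ∑ₖ f⁽ᵏ⁾(x, y)`. -/
def fAvg : Vec dx → Vec dy → ℝ := fun x y => (K : ℝ)⁻¹ * ∑ k, P.fLoc k x y

/-- `g(x, y) = (1/K) ∑ₖ g⁽ᵏ⁾(x, y)`. -/
def gAvg : Vec dx → Vec dy → ℝ := fun x y => (K : ℝ)⁻¹ * ∑ k, P.gLoc k x y

/-- `y*(x) = argmin_y g(x, y)` (unique under strong convexity). -/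
def yStar (x : Vec dx) : Vec dy :=
  Classical.epsilon fun y => ∀ y', P.gAvg x y ≤ P.gAvg x y'

/-- The objective `F(x) = (1/K) ∑ₖ f⁽ᵏ⁾(x, y*(x))`. -/
def F (x : Vec dx) : ℝ := P.fAvg x (P.yStar x)

/-- The standing regularity assumptions on the losses. -/
structure Regular (c : Constants) : Prop where
  prob_f : ∀ k, IsProbabilityMeasure (P.Df k)
  prob_g : ∀ k, IsProbabilityMeasure (P.Dg k)
  meas_f : ∀ k x y, Measurable (P.f k x y)
  meas_g : ∀ k x y, Measurable (P.g k x y)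
  int_f : ∀ k x y, Integrable (P.f k x y) (P.Df k)
  int_g : ∀ k x y, Integrable (P.g k x y) (P.Dg k)
  -- the derivatives named below exist
  diff_f₁ : ∀ k ξ y, Differentiable ℝ fun x => P.fS k ξ x y
  diff_f₂ : ∀ k ξ x, Differentiable ℝ fun y => P.fS k ξ x y
  diff_g₂ : ∀ k ζ x, Differentiable ℝ fun y => P.gS k ζ x y
  diff_g₁₂ : ∀ k ζ y, Differentiable ℝ fun x => grad₂ (P.gS k ζ) x y
  diff_g₂₂ : ∀ k ζ x, Differentiable ℝ fun y => grad₂ (P.gS k ζ) x y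
  -- strong convexity of the lower level
  strong : ∀ k x, StrongConvexOn Set.univ c.μ (P.gLoc k x)
  -- upper level
  lip_f₁ : ∀ k ξ, JointLip c.lfx (grad₁ (P.fS k ξ))
  lip_f₂ : ∀ k ξ, JointLip c.lfy (grad₂ (P.fS k ξ))
  bdd_f₂ : ∀ k ξ x y, ‖grad₂ (P.fS k ξ) x y‖ ≤ c.cfy
  -- lower level
  lip_g₂ : ∀ k ζ, JointLip c.lgy (grad₂ (P.gS k ζ))
  lip_g₁₂ : ∀ k ζ, JointLip c.lgxy (hess₁₂ (P.gS k ζ))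
  lip_g₂₂ : ∀ k ζ, JointLip c.lgyy (hess₂₂ (P.gS k ζ))
  bdd_g₁₂ : ∀ k ζ x y, ‖hess₁₂ (P.gS k ζ) x y‖ ≤ c.cgxy
  hess_lower : ∀ k ζ x y v, c.μ * ‖v‖ ^ 2 ≤ ⟪hess₂₂ (P.gS k ζ) x y v, v⟫
  hess_upper : ∀ k ζ x y v, ⟪hess₂₂ (P.gS k ζ) x y v, v⟫ ≤ c.lgy * ‖v‖ ^ 2
  -- bounded variance of all stochastic gradients
  var_f₁ : ∀ k x y, VarLe (P.Df k) (fun ξ => grad₁ (P.fS k ξ) x y) (grad₁ (P.fLoc k) x y) c.σ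
  var_f₂ : ∀ k x y, VarLe (P.Df k) (fun ξ => grad₂ (P.fS k ξ) x y) (grad₂ (P.fLoc k) x y) c.σ
  var_g₂ : ∀ k x y, VarLe (P.Dg k) (fun ζ => grad₂ (P.gS k ζ) x y) (grad₂ (P.gLoc k) x y) c.σ
  var_g₁₂ : ∀ k x y,
    VarLe (P.Dg k) (fun ζ => hess₁₂ (P.gS k ζ) x y) (hess₁₂ (P.gLoc k) x y) c.σ
  var_g₂₂ : ∀ k x y,
    VarLe (P.Dg k) (fun ζ => hess₂₂ (P.gS k ζ) x y) (hess₂₂ (P.gLoc k) x y) c.σ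

/-- Heterogeneity of the local gradients at one point `(x₀, y₀)`. -/
def hetAt (x₀ : Vec dx) (y₀ : Vec dy) : ℝ :=
  (K : ℝ)⁻¹ * ∑ k, (‖grad₁ (P.fLoc k) x₀ y₀ - grad₁ P.fAvg x₀ y₀‖ ^ 2 +
    ‖grad₂ (P.gLoc k) x₀ y₀ - grad₂ P.gAvg x₀ y₀‖ ^ 2)

end Problem

/-! The communication graph -/

/-- `λ = |λ₂|`: the second entry in the list of the absolute values of the eigenvalues (with
multiplicity, in decreasing order) of a symmetric matrix; `0` for a single worker. -/
def lam {K : ℕ} (E : Matrix (Fin K) (Fin K) ℝ) : ℝ :=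
  ((E.charpoly.roots.map fun a => |a|).sort (· ≥ ·)).getD 1 0

/-- The adjacency (mixing) matrix is symmetric and doubly stochastic, and `|λ₂| < 1`. -/
structure IsMixing {K : ℕ} (E : Matrix (Fin K) (Fin K) ℝ) : Prop where
  symm : E.IsSymm
  stoch : E ∈ doublyStochastic ℝ (Fin K)
  gap : lam E < 1

/-! The algorithm DSVRBGD-S -/

/-- The parameters of the algorithm: momentum parameters, step sizes, batch sizes of the first
and of the later iterations. -/
structure Params where
  (α₁ α₂ α₃ β₁ β₂ β₃ η : ℝ)
  (B₀ B : ℕ)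

/-- What one worker sends to its neighbours in one communication round: `x, p, y, q, z, r`. -/
abbrev Msg (dx dy : ℕ) : Type := Vec dx × Vec dx × Vec dy × Vec dy × Vec dy × Vec dy

/-- Communication cost of one round: the number of real scalars in a message. -/
def msgCost (dx dy : ℕ) : ℕ := Module.finrank ℝ (Msg dx dy)

/-- Memory of one worker at the beginning of iteration `t`: the variables `x, y, z` of iterations
`t` and `t - 1`, the gradient estimators `u, v, w` and the trackers `p, q, r` of iteration
`t - 1`. -/
structure Worker (dx dy : ℕ) where
  (x xOld u p : Vec dx)
  (y yOld v q : Vec dy)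
  (z zOld w r : Vec dy)

/-- Initialization; the estimators and trackers of iteration `-1` are zero. The variables of
iteration `-1` are never used. -/
def Worker.init {dx dy : ℕ} (x₀ : Vec dx) (y₀ z₀ : Vec dy) : Worker dx dy where
  x := x₀
  xOld := x₀
  u := 0
  p := 0
  y := y₀
  yOld := y₀
  v := 0
  q := 0
  z := z₀
  zOld := z₀
  w := 0
  r := 0

/-- The message of a worker. -/
def Worker.msg {dx dy : ℕ} (s : Worker dx dy) : Msg dx dy := (s.x, s.p, s.y, s.q, s.z, s.r)

/-- The received weighted average `∑ⱼ Eⱼₖ mⱼ`: column `k` of `M E`. -/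
def mix {K dx dy : ℕ} (E : Matrix (Fin K) (Fin K) ℝ) (m : Fin K → Msg dx dy) (k : Fin K) :
    Msg dx dy :=
  ∑ j, E j k • m j

/-- Metric projection onto the closed ball of radius `ρ` around `0`. -/
def projBall {n : ℕ} (ρ : ℝ) (z : Vec n) : Vec n :=
  if ‖z‖ ≤ ρ then z else (ρ / ‖z‖) • z

/-- Average of `h` over a batch of `n` samples. -/
def batchMean {V : Type*} [AddCommGroup V] [Module ℝ V] (n : ℕ) (h : ℕ → V) : V :=
  (n : ℝ)⁻¹ • ∑ i ∈ Finset.range n, h i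

/-- The variance-reduced estimator: the stochastic gradient `new` at `t = 0`, and afterwards
`(1 - θ) (prev - old) + new`, where `old` and `new` are the stochastic gradients at the previous
and at the current variables, for the same samples. -/
def storm {V : Type*} [AddCommGroup V] [Module ℝ V] (t : ℕ) (θ : ℝ) (prev old new : V) : V :=
  if t = 0 then new else (1 - θ) • (prev - old) + new

section Algorithm

variable {K dx dy : ℕ} {Ξ Z : Type*} [MeasurableSpace Ξ] [MeasurableSpace Z]

/-- Minibatch stochastic gradient of the lower-level loss. -/
def stochG (P : Problem K dx dy Ξ Z) (k : Fin K) (n : ℕ) (ζ : ℕ → Z)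
    (x : Vec dx) (y : Vec dy) : Vec dy :=
  batchMean n fun i => grad₂ (P.gS k (ζ i)) x y

/-- Minibatch stochastic gradient `∇²₂₂ g z - ∇₂ f` for the Hessian-inverse-vector product. -/
def stochH (P : Problem K dx dy Ξ Z) (k : Fin K) (n : ℕ) (ξ : ℕ → Ξ) (ζ : ℕ → Z)
    (x : Vec dx) (y z : Vec dy) : Vec dy :=
  batchMean n fun i => hess₂₂ (P.gS k (ζ i)) x y z - grad₂ (P.fS k (ξ i)) x y

/-- Minibatch stochastic hypergradient `∇₁ f - ∇²₁₂ g z`. -/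
def stochF (P : Problem K dx dy Ξ Z) (k : Fin K) (n : ℕ) (ξ : ℕ → Ξ) (ζ : ℕ → Z)
    (x : Vec dx) (y z : Vec dy) : Vec dx :=
  batchMean n fun i => grad₁ (P.fS k (ξ i)) x y - hess₁₂ (P.gS k (ζ i)) x y z

/-- Iteration `t` of worker `k`, from its memory `s`, the received average `m` of the messages of
its neighbours and its samples `ξ`, `ζ`; `ρ` is the radius of the ball that constrains `z`. -/
def localStep (P : Problem K dx dy Ξ Z) (ρ : ℝ) (a : Params) (t : ℕ) (k : Fin K)
    (ξ : ℕ → Ξ) (ζ : ℕ → Z) (s : Worker dx dy) (m : Msg dx dy) : Worker dx dy :=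
  let n := if t = 0 then a.B₀ else a.B
  let v := storm t (a.α₂ * a.η ^ 2) s.v
    (stochG P k n ζ s.xOld s.yOld) (stochG P k n ζ s.x s.y)
  let w := storm t (a.α₃ * a.η ^ 2) s.w
    (stochH P k n ξ ζ s.xOld s.yOld s.zOld) (stochH P k n ξ ζ s.x s.y s.z)
  let u := storm t (a.α₁ * a.η ^ 2) s.u
    (stochF P k n ξ ζ s.xOld s.yOld s.zOld) (stochF P k n ξ ζ s.x s.y s.z)
  -- the components of the received average, in the order `x, p, y, q, z, r`
  let p := m.2.1 + u - s.u
  let q := m.2.2.2.1 + v - s.v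
  let r := m.2.2.2.2.2 + w - s.w
  let xHalf := m.1 - a.β₁ • p
  let yHalf := m.2.2.1 - a.β₂ • q
  let zHalf := projBall ρ (m.2.2.2.2.1 - a.β₃ • r)
  { x := s.x + a.η • (xHalf - s.x)
    xOld := s.x
    u := u
    p := p
    y := s.y + a.η • (yHalf - s.y)
    yOld := s.y
    v := v
    q := q
    z := s.z + a.η • (zHalf - s.z)
    zOld := s.z
    w := w
    r := r }

/-- The memories of all workers at the beginning of iteration `t`. Every iteration has exactly one
communication round. `ξ t k i`, `ζ t k i` is the `i`-th sample of worker `k` in iteration `t`. -/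
def run (P : Problem K dx dy Ξ Z) (E : Matrix (Fin K) (Fin K) ℝ) (ρ : ℝ) (a : Params)
    (x₀ : Vec dx) (y₀ z₀ : Vec dy) (ξ : ℕ → Fin K → ℕ → Ξ) (ζ : ℕ → Fin K → ℕ → Z) :
    ℕ → Fin K → Worker dx dy
  | 0 => fun _ => Worker.init x₀ y₀ z₀
  | t + 1 => fun k =>
      let s := run P E ρ a x₀ y₀ z₀ ξ ζ t
      localStep P ρ a t k (ξ t k) (ζ t k) (s k) (mix E (fun j => (s j).msg) k)

/-- The averaged iterate `x̄ₜ = (1/K) ∑ₖ xₜ⁽ᵏ⁾`. -/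
def xBar (P : Problem K dx dy Ξ Z) (E : Matrix (Fin K) (Fin K) ℝ) (ρ : ℝ) (a : Params)
    (x₀ : Vec dx) (y₀ z₀ : Vec dy) (ξ : ℕ → Fin K → ℕ → Ξ) (ζ : ℕ → Fin K → ℕ → Z)
    (t : ℕ) : Vec dx :=
  (K : ℝ)⁻¹ • ∑ k, (run P E ρ a x₀ y₀ z₀ ξ ζ t k).x

/-- The samples: `ξ t k i ∼ Df k`, `ζ t k i ∼ Dg k`, and the pairs `(ξ t k i, ζ t k i)` are
independent over all iterations `t`, workers `k` and batch indices `i`. -/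
structure IsSampling (P : Problem K dx dy Ξ Z) {Ω : Type*} [MeasurableSpace Ω] (Pr : Measure Ω)
    (ξ : ℕ → Fin K → ℕ → Ω → Ξ) (ζ : ℕ → Fin K → ℕ → Ω → Z) : Prop where
  meas_ξ : ∀ t k i, Measurable (ξ t k i)
  meas_ζ : ∀ t k i, Measurable (ζ t k i)
  law_ξ : ∀ t k i, Pr.map (ξ t k i) = P.Df k
  law_ζ : ∀ t k i, Pr.map (ζ t k i) = P.Dg k
  indep : iIndepFun (fun (s : ℕ × Fin K × ℕ) ω =>
    (ξ s.1 s.2.1 s.2.2 ω, ζ s.1 s.2.1 s.2.2 ω)) Pr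

end Algorithm

/-- The constants hidden in the `O`-notation for `αᵢ`, `βᵢ`, `η`, `B₀` and `T`. -/
structure OConst where
  (a₁ a₂ a₃ b₁ b₂ b₃ e b₀ C : ℝ)
  pos : 0 < a₁ ∧ 0 < a₂ ∧ 0 < a₃ ∧ 0 < b₁ ∧ 0 < b₂ ∧ 0 < b₃ ∧ 0 < e ∧ 0 < b₀ ∧ 0 < C

/-- `αᵢ = aᵢ / K`, `β₁ = b₁ (1-λ)⁴`, `β₂ = b₂ (1-λ)²`, `β₃ = b₃ (1-λ)⁴`, `η = e K ε^{1/2}`,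
`B₀ = ⌈b₀ / ε^{1/2}⌉`, and batch size `B` later. -/
def OConst.params (o : OConst) (K : ℕ) (l ε : ℝ) (B : ℕ) : Params where
  α₁ := o.a₁ / K
  α₂ := o.a₂ / K
  α₃ := o.a₃ / K
  β₁ := o.b₁ * (1 - l) ^ 4
  β₂ := o.b₂ * (1 - l) ^ 2
  β₃ := o.b₃ * (1 - l) ^ 4
  η := o.e * K * ε ^ (1 / 2 : ℝ)
  B₀ := ⌈o.b₀ / ε ^ (1 / 2 : ℝ)⌉₊
  B := B

/-- `T = ⌈C / (K (1-λ)⁴ ε^{3/2})⌉`. -/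
def OConst.iters (o : OConst) (K : ℕ) (l ε : ℝ) : ℕ :=
  ⌈o.C / (K * (1 - l) ^ 4 * ε ^ (3 / 2 : ℝ))⌉₊

end DBO

end

/-!
The proof separates a deterministic analysis, valid for every outcome of the sampling, from bounds
on the second moments of the three variance-reduced estimators.

*The problem.* Differentiating under the expectation and applying the implicit function theorem to
`∇₂ g (x, y) = 0` gives the hypergradient `∇F(x) = ∇₁ f - ∇²₁₂ g z*(x)` at `y = y*(x)`, where
`z*(x)` solves `∇²₂₂ g z = ∇₂ f` and lies in the ball of radius `c_{f_y} / μ`. So the three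
averaged oracles form a triangular system: a strongly monotone field in `y` with zero `y*(x)`, a
strongly monotone field in `z` with zero `z*(x)`, and the gradient of `F` at these zeros. This is
recorded in `Landscape` (`Problem.Regular.exists_landscape`).

*One trajectory.* Doubly stochastic mixing preserves averages, and gradient tracking makes the
average of the trackers equal to the average of the estimators. Hence the averaged iterates
perform an inexact gradient method: `F` descends along `x̄`, while `ȳ` and the `z` of the workers
contract towards the slowly moving targets `y*(x̄)` and `z*(x̄)`. The drift of the targets is
proportional to `β₁ / β₂` and `β₁ / β₃`, and is absorbed by the descent when these ratios are
small. The consensus errors of the variables are bounded by those of the trackers, and these by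
the variation of the estimators, through the contraction by `λ` on the orthogonal complement of
the constant vectors. Summation over the iterations gives `trajectory_bounds`: the squared
gradients and the squared movements are bounded by the initial gaps, the errors of the averaged
estimators and the consensus errors of the trackers.

*The estimators.* With `θ = η² / K`, the error of an estimator contracts by `1 - θ` in each
iteration and receives a noise that is centred given the past, with variance of order
`θ² σ² + L² ‖movement‖²`. For the average over the workers independence divides this by `K`. So
the total error of the averaged estimators is at most a constant times
`σ² / (η² B₀) + T η² σ² / K² + Σ ‖movement‖² / η²`, and the total variation of the local
estimators a constant times `σ² + heterogeneity + T θ² σ² + Σ ‖movement‖²`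
(`integral_err_le`, `integral_variation_le`).

*Closing the loop.* Movements are bounded by `η²` times (a constant times the consensus errors,
plus `b²` times the remaining terms), so both estimates can be inserted into each other once `b`
and `η` are small (`small_gain_total`), which bounds the sum of the expected squared gradients
(`StormRun.sum_integral_sq_gradient_le`). For `η = e K √ε`, `B₀ ≥ 1 / √ε` and
`T ≥ C / (K (1 - λ)⁴ ε^{3/2})` every term is a small fraction of `T ε` (`budget_le`); only here
`K² ε` has to be small compared with the heterogeneity at the starting point.
-/


noncomputable section

namespace DBO

/-! ### Averages over the workers -/

section Averages

variable {K : ℕ} {V : Type*} [NormedAddCommGroup V] [InnerProductSpace ℝ V]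

/-- The average `(1/K) ∑ₖ aₖ` of a family indexed by the workers. -/
def avg {V : Type*} [AddCommGroup V] [Module ℝ V] (a : Fin K → V) : V := (K : ℝ)⁻¹ • ∑ k, a k

/-- The mean square norm `(1/K) ∑ₖ ‖aₖ‖²` of a family indexed by the workers. -/
def msq {V : Type*} [NormedAddCommGroup V] (a : Fin K → V) : ℝ := (K : ℝ)⁻¹ * ∑ k, ‖a k‖ ^ 2

/-- The consensus error: the deviation of a family from its average. -/
def dev {V : Type*} [AddCommGroup V] [Module ℝ V] (a : Fin K → V) : Fin K → V :=
  fun k => a k - avg a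

/-- The family `∑ⱼ Eⱼₖ aⱼ` of weighted averages over neighbours. -/
def mixV {V : Type*} [AddCommGroup V] [Module ℝ V] (E : Matrix (Fin K) (Fin K) ℝ)
    (a : Fin K → V) : Fin K → V :=
  fun k => ∑ j, E j k • a j

lemma sq_norm_add_le (a b : V) : ‖a + b‖ ^ 2 ≤ 2 * ‖a‖ ^ 2 + 2 * ‖b‖ ^ 2 := by
  have := parallelogram_law_with_norm ℝ a b
  nlinarith [norm_nonneg (a - b), sq_nonneg ‖a - b‖]

lemma sq_norm_sub_le (a b : V) : ‖a - b‖ ^ 2 ≤ 2 * ‖a‖ ^ 2 + 2 * ‖b‖ ^ 2 := by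
  have := sq_norm_add_le a (-b)
  rwa [norm_neg, ← sub_eq_add_neg] at this

lemma sq_norm_add₃_le {V : Type*} [NormedAddCommGroup V] (a b c : V) :
    ‖a + b + c‖ ^ 2 ≤ 3 * ‖a‖ ^ 2 + 3 * ‖b‖ ^ 2 + 3 * ‖c‖ ^ 2 := by
  have h := norm_add₃_le (a := a) (b := b) (c := c)
  have : ‖a + b + c‖ ^ 2 ≤ (‖a‖ + ‖b‖ + ‖c‖) ^ 2 := by gcongr
  nlinarith [sq_nonneg (‖a‖ - ‖b‖), sq_nonneg (‖a‖ - ‖c‖), sq_nonneg (‖b‖ - ‖c‖)]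

/-- Young's inequality `‖a + b‖² ≤ (1 + δ) ‖a‖² + (1 + 1/δ) ‖b‖²`. -/
lemma sq_norm_add_le_young {V : Type*} [NormedAddCommGroup V] (a b : V) {δ : ℝ} (hδ : 0 < δ) :
    ‖a + b‖ ^ 2 ≤ (1 + δ) * ‖a‖ ^ 2 + (1 + 1 / δ) * ‖b‖ ^ 2 := by
  have h1 : ‖a + b‖ ^ 2 ≤ (‖a‖ + ‖b‖) ^ 2 := by gcongr; exact norm_add_le a b
  have h2 : 2 * (‖a‖ * ‖b‖) ≤ δ * ‖a‖ ^ 2 + 1 / δ * ‖b‖ ^ 2 := by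
    have := sq_nonneg (δ * ‖a‖ - ‖b‖)
    have h3 : δ * ‖a‖ ^ 2 + 1 / δ * ‖b‖ ^ 2 - 2 * (‖a‖ * ‖b‖) = (δ * ‖a‖ - ‖b‖) ^ 2 / δ := by
      field_simp; ring
    have : 0 ≤ (δ * ‖a‖ - ‖b‖) ^ 2 / δ := by positivity
    linarith
  nlinarith

lemma sq_norm_convex (a b : V) {η : ℝ} (h0 : 0 ≤ η) (h1 : η ≤ 1) :
    ‖(1 - η) • a + η • b‖ ^ 2 ≤ (1 - η) * ‖a‖ ^ 2 + η * ‖b‖ ^ 2 := by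
  have h : ‖(1 - η) • a + η • b‖ ≤ (1 - η) * ‖a‖ + η * ‖b‖ := by
    refine (norm_add_le _ _).trans ?_
    rw [norm_smul, norm_smul, Real.norm_of_nonneg h0, Real.norm_of_nonneg (by linarith)]
  have : ‖(1 - η) • a + η • b‖ ^ 2 ≤ ((1 - η) * ‖a‖ + η * ‖b‖) ^ 2 := by gcongr
  nlinarith [mul_nonneg (mul_nonneg h0 (by linarith : 0 ≤ 1 - η)) (sq_nonneg (‖a‖ - ‖b‖))]

lemma msq_nonneg {V : Type*} [NormedAddCommGroup V] (a : Fin K → V) : 0 ≤ msq a := by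
  unfold msq; positivity

lemma msq_mono_of {V W : Type*} [NormedAddCommGroup V] [NormedAddCommGroup W]
    {a : Fin K → V} {b : Fin K → W} (h : ∀ k, ‖a k‖ ^ 2 ≤ ‖b k‖ ^ 2) : msq a ≤ msq b := by
  have := Finset.sum_le_sum fun k (_ : k ∈ Finset.univ) => h k
  unfold msq
  gcongr

/-- Pointwise bounds by a combination of two squared norms pass to `msq`. -/
lemma msq_le_comb {V₀ V₁ V₂ : Type*} [NormedAddCommGroup V₀] [NormedAddCommGroup V₁]
    [NormedAddCommGroup V₂] {a : Fin K → V₀} {b : Fin K → V₁} {c : Fin K → V₂} {p q : ℝ}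
    (h : ∀ k, ‖a k‖ ^ 2 ≤ p * ‖b k‖ ^ 2 + q * ‖c k‖ ^ 2) : msq a ≤ p * msq b + q * msq c := by
  have : ∑ k, ‖a k‖ ^ 2 ≤ p * ∑ k, ‖b k‖ ^ 2 + q * ∑ k, ‖c k‖ ^ 2 := by
    rw [Finset.mul_sum, Finset.mul_sum, ← Finset.sum_add_distrib]
    exact Finset.sum_le_sum fun k _ => h k
  unfold msq
  calc _ ≤ (K : ℝ)⁻¹ * (p * ∑ k, ‖b k‖ ^ 2 + q * ∑ k, ‖c k‖ ^ 2) := by gcongr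
    _ = _ := by ring

lemma msq_add_le (a b : Fin K → V) : msq (fun k => a k + b k) ≤ 2 * msq a + 2 * msq b :=
  msq_le_comb fun _ => sq_norm_add_le _ _

lemma msq_sub_le (a b : Fin K → V) : msq (fun k => a k - b k) ≤ 2 * msq a + 2 * msq b :=
  msq_le_comb fun _ => sq_norm_sub_le _ _

lemma msq_smul (c : ℝ) (a : Fin K → V) : msq (fun k => c • a k) = c ^ 2 * msq a := by
  simp only [msq, norm_smul, mul_pow, ← Finset.mul_sum, Real.norm_eq_abs, sq_abs]
  ring

lemma msq_const {V : Type*} [NormedAddCommGroup V] (hK : 0 < K) (v : V) :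
    msq (fun _ : Fin K => v) = ‖v‖ ^ 2 := by
  have : (K : ℝ) ≠ 0 := by positivity
  simp [msq]; field_simp

lemma avg_const (hK : 0 < K) (v : V) : avg (fun _ : Fin K => v) = v := by
  have : (K : ℝ) ≠ 0 := by positivity
  simp only [avg, Finset.sum_const, Finset.card_univ, Fintype.card_fin, ← Nat.cast_smul_eq_nsmul ℝ,
    smul_smul, inv_mul_cancel₀ this, one_smul]

lemma avg_add (a b : Fin K → V) : avg (fun k => a k + b k) = avg a + avg b := by
  simp [avg, Finset.sum_add_distrib]

lemma avg_sub (a b : Fin K → V) : avg (fun k => a k - b k) = avg a - avg b := by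
  simp [avg, Finset.sum_sub_distrib, smul_sub]

lemma avg_smul (c : ℝ) (a : Fin K → V) : avg (fun k => c • a k) = c • avg a := by
  simp [avg, ← Finset.smul_sum, smul_comm c]

lemma dev_add (a b : Fin K → V) : dev (fun k => a k + b k) = fun k => dev a k + dev b k := by
  funext k; simp only [dev, avg_add]; abel

lemma dev_sub (a b : Fin K → V) : dev (fun k => a k - b k) = fun k => dev a k - dev b k := by
  funext k; simp only [dev, avg_sub]; abel

lemma dev_smul (c : ℝ) (a : Fin K → V) : dev (fun k => c • a k) = fun k => c • dev a k := by
  funext k; simp only [dev, avg_smul, smul_sub]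

lemma avg_dev (hK : 0 < K) (a : Fin K → V) : avg (dev a) = 0 := by
  have := avg_sub a (fun _ => avg a)
  rw [avg_const hK, sub_self] at this
  exact this

lemma sum_dev (hK : 0 < K) (a : Fin K → V) : ∑ k, dev a k = 0 := by
  have h := avg_dev hK a
  have : (K : ℝ)⁻¹ ≠ 0 := by positivity
  simpa [avg, this, hK.ne'] using h

/-- Bias-variance decomposition over the workers. -/
lemma msq_sub_const (hK : 0 < K) (a : Fin K → V) (c : V) :
    msq (fun k => a k - c) = msq (dev a) + ‖avg a - c‖ ^ 2 := by
  have h : ∀ k, ‖a k - c‖ ^ 2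
      = ‖dev a k‖ ^ 2 + 2 * ⟪dev a k, avg a - c⟫ + ‖avg a - c‖ ^ 2 := fun k => by
    rw [← norm_add_sq_real]; simp [dev]
  have h2 : ∑ k, ⟪dev a k, avg a - c⟫ = 0 := by rw [← sum_inner, sum_dev hK, inner_zero_left]
  have : (K : ℝ) ≠ 0 := by positivity
  simp only [msq, h, Finset.sum_add_distrib, ← Finset.mul_sum, h2]
  simp; field_simp

lemma msq_eq_dev_add (hK : 0 < K) (a : Fin K → V) : msq a = msq (dev a) + ‖avg a‖ ^ 2 := by
  simpa using msq_sub_const hK a 0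

lemma sq_norm_avg_le (hK : 0 < K) (a : Fin K → V) : ‖avg a‖ ^ 2 ≤ msq a := by
  rw [msq_eq_dev_add hK a]; linarith [msq_nonneg (dev a)]

lemma msq_dev_le (hK : 0 < K) (a : Fin K → V) : msq (dev a) ≤ msq a := by
  rw [msq_eq_dev_add hK a]; nlinarith [sq_nonneg ‖avg a‖]

lemma msq_dev_le_sub_const (hK : 0 < K) (a : Fin K → V) (c : V) :
    msq (dev a) ≤ msq (fun k => a k - c) := by
  rw [msq_sub_const hK a]; nlinarith [sq_nonneg ‖avg a - c‖]

end Averages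

/-! ### Mixing matrices and their spectral gap -/

section Mixing

variable {K : ℕ} {V : Type*} [NormedAddCommGroup V] [InnerProductSpace ℝ V]
  {E : Matrix (Fin K) (Fin K) ℝ}

lemma lam_nonneg (E : Matrix (Fin K) (Fin K) ℝ) : 0 ≤ lam E := by
  unfold lam
  rw [List.getD_eq_getElem?_getD]
  rcases h : ((E.charpoly.roots.map fun a => |a|).sort (· ≥ ·))[1]? with _ | a
  · simp
  · have := List.mem_of_getElem? h
    rw [Multiset.mem_sort, Multiset.mem_map] at this
    obtain ⟨b, -, rfl⟩ := this
    simp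

/-- Below the first entry, no entry of a decreasing list exceeds the second one. -/
lemma countP_gt_second_le_one (l : List ℝ) (hl : l.Pairwise (· ≥ ·)) :
    l.countP (fun a => decide (l.getD 1 0 < a)) ≤ 1 := by
  match l, hl with
  | [], _ => simp
  | [a], _ => exact List.countP_le_length
  | a :: b :: l, h =>
    have h2 := (List.pairwise_cons.1 h).2
    have h3 := (List.pairwise_cons.1 h2).1
    have : l.countP (fun a => decide (b < a)) = 0 := by
      rw [List.countP_eq_zero]
      intro c hc
      simpa using h3 c hc
    simp only [List.getD_cons_succ, List.getD_cons_zero]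
    rw [List.countP_cons, List.countP_cons, this]
    simp
    split_ifs <;> simp

/-- At most one eigenvalue exceeds `λ` in absolute value. -/
lemma abs_eigenvalue_le_lam (hE : E.IsHermitian) {i j : Fin K} (hij : i ≠ j)
    (hi : lam E < |hE.eigenvalues i|) : |hE.eigenvalues j| ≤ lam E := by
  by_contra! hj
  have h1 := countP_gt_second_le_one ((E.charpoly.roots.map fun a => |a|).sort (· ≥ ·))
    (Multiset.pairwise_sort _ _)
  change List.countP (fun a => decide (lam E < a)) _ ≤ 1 at h1
  rw [← Multiset.coe_countP, Multiset.sort_eq, hE.roots_charpoly_eq_eigenvalues, Multiset.map_map,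
    Multiset.countP_map] at h1
  have h2 : ({i, j} : Finset (Fin K)).val ≤
      Multiset.filter (fun a => lam E < ((fun a => |a|) ∘ (RCLike.ofReal ∘ hE.eigenvalues)) a)
        Finset.univ.val := by
    rw [Multiset.le_iff_subset (Finset.nodup _)]
    intro a ha
    rw [Multiset.mem_filter]
    refine ⟨Finset.mem_univ (α := Fin K) a, ?_⟩
    have : a = i ∨ a = j := by simpa using ha
    rcases this with rfl | rfl <;> simpa
  have h3 := Multiset.card_le_card h2
  rw [Finset.card_val, Finset.card_pair hij] at h3
  have := h3.trans h1
  omega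

/-- The spectral gap in one coordinate: `E` contracts vectors orthogonal to `1` by `λ`. -/
lemma sum_sq_mulVec_le (hE : IsMixing E) (x : Fin K → ℝ) (hx : ∑ k, x k = 0) :
    ∑ k, (∑ j, E j k * x j) ^ 2 ≤ lam E ^ 2 * ∑ k, x k ^ 2 := by
  have hH : E.IsHermitian := by
    rw [Matrix.IsHermitian, Matrix.conjTranspose_eq_transpose_of_trivial]; exact hE.symm
  set v := hH.eigenvectorBasis with hv
  set ev := hH.eigenvalues with hev
  -- coefficients of `E w` in the eigenbasis
  have hcoef : ∀ (w : EuclideanSpace ℝ (Fin K)) (i),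
      ⟪v i, WithLp.toLp 2 (E.mulVec w.ofLp)⟫ = ev i * ⟪v i, w⟫ := by
    intro w i
    have hm := hH.mulVec_eigenvectorBasis i
    have e1 : ⟪v i, WithLp.toLp 2 (E.mulVec w.ofLp)⟫ = (E.mulVec w.ofLp) ⬝ᵥ (v i).ofLp := by
      simp [EuclideanSpace.inner_eq_star_dotProduct]
    have e2 : ⟪v i, w⟫ = w.ofLp ⬝ᵥ (v i).ofLp := by
      simp [EuclideanSpace.inner_eq_star_dotProduct]
    rw [e1, e2, dotProduct_comm, Matrix.dotProduct_mulVec, ← Matrix.mulVec_transpose, hE.symm]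
    change dotProduct (E.mulVec (hH.eigenvectorBasis i).ofLp) _ = _
    rw [hm, smul_dotProduct, smul_eq_mul, dotProduct_comm]
  set one : EuclideanSpace ℝ (Fin K) := WithLp.toLp 2 (fun _ => 1) with hone
  set w : EuclideanSpace ℝ (Fin K) := WithLp.toLp 2 x with hw
  have h1 : WithLp.toLp 2 (E.mulVec one.ofLp) = one := by
    have := mulVec_one_of_mem_doublyStochastic hE.stoch
    rw [hone]; congr 1
  have hone_coef : ∀ i, ⟪v i, one⟫ ≠ 0 → ev i = 1 := by
    intro i hi
    have := hcoef one i
    rw [h1] at this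
    have h : (1 - ev i) * ⟪v i, one⟫ = 0 := by linarith
    rcases mul_eq_zero.1 h with h | h
    · linarith
    · exact absurd h hi
  have horth : ⟪one, w⟫ = 0 := by
    simp [hone, hw, EuclideanSpace.inner_eq_star_dotProduct, dotProduct, hx]
  -- each coefficient is contracted
  have key : ∀ i, (ev i * ⟪v i, w⟫) ^ 2 ≤ lam E ^ 2 * ⟪v i, w⟫ ^ 2 := by
    intro i
    rw [mul_pow]
    by_cases hi : |ev i| ≤ lam E
    · have : ev i ^ 2 ≤ lam E ^ 2 := by
        rw [← sq_abs]; gcongr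
      gcongr
    · push Not at hi
      have hz : ∀ j, j ≠ i → ⟪v j, one⟫ = 0 := by
        intro j hj
        by_contra hne
        have e := hone_coef j hne
        have := abs_eigenvalue_le_lam hH hj.symm hi
        rw [← hev, e, abs_one] at this
        linarith [hE.gap]
      have hsum : ⟪one, w⟫ = ⟪v i, one⟫ * ⟪v i, w⟫ := by
        rw [← v.sum_inner_mul_inner one w, Finset.sum_eq_single i]
        · rw [real_inner_comm]
        · intro j _ hj; rw [real_inner_comm, hz j hj, zero_mul]
        · simp
      have hK : 0 < K := Fin.pos i
      have hne : ⟪v i, one⟫ ≠ 0 := by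
        intro h0
        have : one = 0 := by
          rw [← v.sum_repr' one]
          refine Finset.sum_eq_zero fun j _ => ?_
          by_cases hj : j = i
          · subst hj; rw [h0, zero_smul]
          · rw [hz j hj, zero_smul]
        have h2 : one.ofLp ⟨0, hK⟩ = 0 := by rw [this]; rfl
        simp [hone] at h2
      have : ⟪v i, w⟫ = 0 := by
        rw [horth] at hsum
        rcases mul_eq_zero.1 hsum.symm with h | h
        · exact absurd h hne
        · exact h
      rw [this]; simp
  have hL : ∑ k, (∑ j, E j k * x j) ^ 2 = ‖WithLp.toLp 2 (E.mulVec w.ofLp)‖ ^ 2 := by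
    rw [EuclideanSpace.norm_sq_eq]
    refine Finset.sum_congr rfl fun k _ => ?_
    rw [Real.norm_eq_abs, sq_abs]
    congr 1
    refine Finset.sum_congr rfl fun j _ => ?_
    rw [hE.symm.apply]
  have hR : ∑ k, x k ^ 2 = ‖w‖ ^ 2 := by
    rw [EuclideanSpace.norm_sq_eq]
    simp [hw]
  rw [hL, hR, ← v.sum_sq_norm_inner_right, ← v.sum_sq_norm_inner_right w, Finset.mul_sum]
  refine Finset.sum_le_sum fun i _ => ?_
  rw [hcoef, Real.norm_eq_abs, sq_abs, Real.norm_eq_abs, sq_abs]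
  exact key i

lemma avg_mixV (hE : IsMixing E) (a : Fin K → V) : avg (mixV E a) = avg a := by
  simp only [avg, mixV]
  rw [Finset.sum_comm]
  simp only [← Finset.sum_smul, sum_row_of_mem_doublyStochastic hE.stoch, one_smul]

lemma mixV_const (hE : IsMixing E) (v : V) : mixV E (fun _ => v) = fun _ => v := by
  funext k
  simp only [mixV, ← Finset.sum_smul, sum_col_of_mem_doublyStochastic hE.stoch, one_smul]

lemma mixV_sub (a b : Fin K → V) :
    mixV E (fun k => a k - b k) = fun k => mixV E a k - mixV E b k := by
  funext k; simp [mixV, smul_sub]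

lemma dev_mixV (hE : IsMixing E) (a : Fin K → V) : dev (mixV E a) = mixV E (dev a) := by
  have := mixV_sub (E := E) a (fun _ => avg a)
  rw [mixV_const hE] at this
  unfold dev
  rw [this, avg_mixV hE]

/-- The spectral gap for vector-valued families. -/
lemma msq_mixV_dev_le {n : ℕ} (hE : IsMixing E) (hK : 0 < K) (a : Fin K → Vec n) :
    msq (mixV E (dev a)) ≤ lam E ^ 2 * msq (dev a) := by
  have h : ∀ c : Fin n, ∑ k, (∑ j, E j k * (dev a j) c) ^ 2 ≤ lam E ^ 2 * ∑ k, (dev a k) c ^ 2 := by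
    intro c
    refine sum_sq_mulVec_le hE _ ?_
    have := congrArg (fun v : Vec n => v c) (sum_dev hK a)
    simpa using this
  have h2 : ∑ k, ‖mixV E (dev a) k‖ ^ 2 ≤ lam E ^ 2 * ∑ k, ‖dev a k‖ ^ 2 := by
    simp only [EuclideanSpace.norm_sq_eq, Real.norm_eq_abs, sq_abs]
    rw [Finset.sum_comm, Finset.sum_comm (s := Finset.univ (α := Fin K))
      (t := Finset.univ (α := Fin n)),
      Finset.mul_sum]
    refine Finset.sum_le_sum fun c _ => ?_
    simpa [mixV] using h c
  unfold msq
  calc _ ≤ (K : ℝ)⁻¹ * (lam E ^ 2 * ∑ k, ‖dev a k‖ ^ 2) := by gcongr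
    _ = _ := by ring

/-- A mixing step followed by a perturbation: the contraction by `1 - s = λ` absorbs Young's
inequality. -/
lemma msq_dev_mixV_add_le {n : ℕ} (hE : IsMixing E) (hK : 0 < K) (a b : Fin K → Vec n) :
    msq (dev fun k => mixV E a k + b k)
      ≤ (1 - (1 - lam E)) * msq (dev a) + 1 / (1 - lam E) * msq (dev b) := by
  have hs : 0 < 1 - lam E := by linarith [hE.gap]
  have h0 := lam_nonneg E
  have hmix := msq_mixV_dev_le hE hK a
  have e : dev (fun k => mixV E a k + b k) = fun k => mixV E (dev a) k + dev b k := by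
    rw [dev_add, dev_mixV hE]
  rw [e]
  rcases h0.eq_or_lt with h | h
  · rw [← h] at hmix ⊢
    have hz : ∀ k, mixV E (dev a) k = 0 := by
      have : ∑ k, ‖mixV E (dev a) k‖ ^ 2 ≤ 0 := by
        unfold msq at hmix
        have hk : 0 < (K : ℝ)⁻¹ := by positivity
        by_contra! hc
        nlinarith [mul_pos hk hc]
      intro k
      have h3 := (Finset.sum_eq_zero_iff_of_nonneg (fun k _ => sq_nonneg _)).1
        (le_antisymm this (by positivity)) k (Finset.mem_univ _)
      simpa using h3
    simp [hz]
  · have hy := msq_le_comb (a := fun k => mixV E (dev a) k + dev b k) (b := mixV E (dev a))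
      (c := dev b) (fun k => sq_norm_add_le_young (mixV E (dev a) k) (dev b k)
        (δ := (1 - lam E) / lam E) (by positivity))
    refine hy.trans ?_
    have e1 : 1 + (1 - lam E) / lam E = 1 / lam E := by field_simp; ring
    have e2 : 1 + 1 / ((1 - lam E) / lam E) = 1 / (1 - lam E) := by field_simp; ring
    rw [e1, e2]
    have : 1 / lam E * msq (mixV E (dev a)) ≤ 1 / lam E * (lam E ^ 2 * msq (dev a)) := by gcongr
    have e3 : 1 / lam E * (lam E ^ 2 * msq (dev a)) = (1 - (1 - lam E)) * msq (dev a) := by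
      field_simp; ring
    linarith

/-- Mixing moves a family by at most twice its consensus error. -/
lemma msq_mixV_sub_le {n : ℕ} (hE : IsMixing E) (hK : 0 < K) (a : Fin K → Vec n) :
    msq (fun k => mixV E a k - a k) ≤ 4 * msq (dev a) := by
  have e : (fun k => mixV E a k - a k) = fun k => mixV E (dev a) k - dev a k := by
    funext k
    rw [← dev_mixV hE]
    simp [dev, avg_mixV hE]
  have h1 := msq_sub_le (mixV E (dev a)) (dev a)
  have h2 := msq_mixV_dev_le hE hK a
  have h3 : lam E ^ 2 ≤ 1 := by nlinarith [lam_nonneg E, hE.gap]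
  rw [e]
  nlinarith [msq_nonneg (dev a)]

end Mixing

/-- Summing a linear recursion `aₜ₊₁ ≤ (1 - q) aₜ + cₜ`. -/
lemma sum_le_of_recursion {a c : ℕ → ℝ} {q : ℝ} (ha : ∀ t, 0 ≤ a t) (T : ℕ)
    (h : ∀ t, t < T → a (t + 1) ≤ (1 - q) * a t + c t) :
    q * ∑ t ∈ Finset.range T, a t ≤ a 0 + ∑ t ∈ Finset.range T, c t := by
  have : a T + q * ∑ t ∈ Finset.range T, a t ≤ a 0 + ∑ t ∈ Finset.range T, c t := by
    induction T with
    | zero => simp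
    | succ T ih =>
      have h1 := ih fun t ht => h t (by omega)
      have h2 := h T (by omega)
      rw [Finset.sum_range_succ, Finset.sum_range_succ]
      linarith
  linarith [ha T]

/-! ### Projection onto a ball -/

section Projection

lemma norm_projBall_le {n : ℕ} {ρ : ℝ} (hρ : 0 ≤ ρ) (z : Vec n) : ‖projBall ρ z‖ ≤ ρ := by
  unfold projBall
  split_ifs with h
  · exact h
  · push Not at h
    rw [norm_smul, Real.norm_of_nonneg (by positivity), div_mul_cancel₀ _ (by linarith)]

lemma projBall_of_le {n : ℕ} {ρ : ℝ} {z : Vec n} (h : ‖z‖ ≤ ρ) : projBall ρ z = z := if_pos h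

/-- Variational characterization of the projection onto the ball. -/
lemma inner_sub_projBall_le {n : ℕ} {ρ : ℝ} (hρ : 0 ≤ ρ) (a w : Vec n) (hw : ‖w‖ ≤ ρ) :
    ⟪a - projBall ρ a, w - projBall ρ a⟫ ≤ 0 := by
  unfold projBall
  split_ifs with h
  · simp
  · push Not at h
    have ha : 0 < ‖a‖ := by linarith
    set c := ρ / ‖a‖ with hc
    have hca : c * ‖a‖ = ρ := by rw [hc, div_mul_cancel₀ _ ha.ne']
    have hc1 : c ≤ 1 := by rw [hc, div_le_one ha]; exact h.le
    have e : a - c • a = (1 - c) • a := by rw [sub_smul, one_smul]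
    rw [e, real_inner_smul_left, inner_sub_right, real_inner_smul_right, real_inner_self_eq_norm_sq]
    have h1 : ⟪a, w⟫ ≤ ‖a‖ * ρ := (real_inner_le_norm a w).trans (by gcongr)
    have h2 : ⟪a, w⟫ - c * ‖a‖ ^ 2 ≤ 0 := by
      have : c * ‖a‖ ^ 2 = ‖a‖ * ρ := by rw [← hca]; ring
      linarith
    nlinarith

lemma norm_projBall_sub_le {n : ℕ} {ρ : ℝ} (hρ : 0 ≤ ρ) (a b : Vec n) :
    ‖projBall ρ a - projBall ρ b‖ ≤ ‖a - b‖ := by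
  have h1 := inner_sub_projBall_le hρ a (projBall ρ b) (norm_projBall_le hρ b)
  have h2 := inner_sub_projBall_le hρ b (projBall ρ a) (norm_projBall_le hρ a)
  set p := projBall ρ a
  set q := projBall ρ b
  have h3 : ‖p - q‖ ^ 2 ≤ ⟪a - b, p - q⟫ := by
    have e : ⟪a - b, p - q⟫ - ‖p - q‖ ^ 2 = -⟪a - p, q - p⟫ - ⟪b - q, p - q⟫ := by
      rw [← real_inner_self_eq_norm_sq, ← inner_sub_left, ← inner_neg_right, neg_sub,
        ← inner_sub_left]
      congr 1; abel
    linarith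
  have h4 := real_inner_le_norm (a - b) (p - q)
  by_contra! h
  nlinarith [norm_nonneg (a - b), norm_nonneg (p - q)]

end Projection

/-! ### One step of an inexact gradient method -/

section OneStep

variable {V : Type*} [NormedAddCommGroup V] [InnerProductSpace ℝ V]

/-- A gradient step of a strongly monotone Lipschitz field contracts the distance to its zero. -/
lemma sq_norm_sub_smul_le {a g : V} {μ L γ : ℝ} (hmono : μ * ‖a‖ ^ 2 ≤ ⟪g, a⟫)
    (hlip : ‖g‖ ^ 2 ≤ L ^ 2 * ‖a‖ ^ 2) (hγ : 0 ≤ γ) (hγL : γ * L ^ 2 ≤ μ) :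
    ‖a - γ • g‖ ^ 2 ≤ (1 - γ * μ) * ‖a‖ ^ 2 := by
  have e : ‖a - γ • g‖ ^ 2 = ‖a‖ ^ 2 - 2 * γ * ⟪g, a⟫ + γ ^ 2 * ‖g‖ ^ 2 := by
    rw [norm_sub_sq_real, real_inner_smul_right, norm_smul, mul_pow, Real.norm_eq_abs, sq_abs,
      real_inner_comm]
    ring
  have h1 : γ ^ 2 * ‖g‖ ^ 2 ≤ γ * μ * ‖a‖ ^ 2 := by
    calc γ ^ 2 * ‖g‖ ^ 2 ≤ γ ^ 2 * (L ^ 2 * ‖a‖ ^ 2) := by gcongr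
      _ = γ * (γ * L ^ 2) * ‖a‖ ^ 2 := by ring
      _ ≤ γ * μ * ‖a‖ ^ 2 := by gcongr
  have h2 : γ * (μ * ‖a‖ ^ 2) ≤ γ * ⟪g, a⟫ := by gcongr
  rw [e]; linarith

/-- Inexact gradient step towards a drifting target: `e` is the error of the gradient and `d` the
displacement of the target. -/
lemma sq_norm_inexact_step_le {a g e d : V} {μ L γ : ℝ} (hmono : μ * ‖a‖ ^ 2 ≤ ⟪g, a⟫)
    (hlip : ‖g‖ ^ 2 ≤ L ^ 2 * ‖a‖ ^ 2) (hγ : 0 < γ) (hμ : 0 < μ) (hγL : γ * L ^ 2 ≤ μ)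
    (hγμ : γ * μ ≤ 1) :
    ‖a - γ • (g + e) + d‖ ^ 2 ≤
      (1 - γ * μ / 2) * ‖a‖ ^ 2 + 6 / (γ * μ) * (γ ^ 2 * ‖e‖ ^ 2 + ‖d‖ ^ 2) := by
  have hp : 0 < γ * μ := by positivity
  have e1 : a - γ • (g + e) + d = (a - γ • g) + (d - γ • e) := by rw [smul_add]; abel
  have h1 := sq_norm_sub_smul_le hmono hlip hγ.le hγL
  have h2 := sq_norm_add_le_young (a - γ • g) (d - γ • e) (δ := γ * μ / 2) (by positivity)
  have h3 := sq_norm_sub_le d (γ • e)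
  rw [norm_smul, mul_pow, Real.norm_eq_abs, sq_abs] at h3
  have h4 : (1 + γ * μ / 2) * ‖a - γ • g‖ ^ 2 ≤ (1 - γ * μ / 2) * ‖a‖ ^ 2 := by
    calc _ ≤ (1 + γ * μ / 2) * ((1 - γ * μ) * ‖a‖ ^ 2) := by gcongr
      _ = ((1 + γ * μ / 2) * (1 - γ * μ)) * ‖a‖ ^ 2 := by ring
      _ ≤ _ := by gcongr; nlinarith
  have h5 : 1 + 1 / (γ * μ / 2) ≤ 3 / (γ * μ) := by
    rw [show (1 : ℝ) + 1 / (γ * μ / 2) = (γ * μ + 2) / (γ * μ) by field_simp]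
    gcongr; linarith
  have h6 : (1 + 1 / (γ * μ / 2)) * ‖d - γ • e‖ ^ 2
      ≤ 3 / (γ * μ) * (2 * ‖d‖ ^ 2 + 2 * (γ ^ 2 * ‖e‖ ^ 2)) := by gcongr
  have e2 : 3 / (γ * μ) * (2 * ‖d‖ ^ 2 + 2 * (γ ^ 2 * ‖e‖ ^ 2))
      = 6 / (γ * μ) * (γ ^ 2 * ‖e‖ ^ 2 + ‖d‖ ^ 2) := by ring
  rw [e1]; linarith

/-- Descent along `-u` for a function with Lipschitz gradient. -/
lemma descent_step [CompleteSpace V] {F : V → ℝ} {gF : V → V} {l τ : ℝ} {x u : V}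
    (hF : ∀ x, HasGradientAt F (gF x) x) (hl : ∀ x x', ‖gF x - gF x'‖ ≤ l * ‖x - x'‖)
    (hτ : 0 ≤ τ) (hlτ : 4 * (l * τ) ≤ 1) :
    F (x - τ • u) ≤ F x - τ / 2 * ‖gF x‖ ^ 2 - τ / 4 * ‖u‖ ^ 2 + τ / 2 * ‖gF x - u‖ ^ 2 := by
  set y := x - τ • u with hy
  have hseg : ∀ z ∈ segment ℝ x y,
      ‖(InnerProductSpace.toDual ℝ V) (gF z) - (InnerProductSpace.toDual ℝ V) (gF x)‖
        ≤ l * ‖y - x‖ := by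
    intro z hz
    rw [← map_sub, LinearIsometryEquiv.norm_map]
    refine (hl z x).trans ?_
    obtain ⟨s, t, hs, ht, hst, rfl⟩ := hz
    have e : s • x + t • y - x = t • (y - x) := by
      rw [show s = 1 - t by linarith]; module
    rw [e, norm_smul, Real.norm_of_nonneg ht]
    have hln : 0 ≤ l * ‖y - x‖ := (norm_nonneg _).trans (hl y x)
    nlinarith
  have h1 := (convex_segment x y).norm_image_sub_le_of_norm_hasFDerivWithin_le'
    (fun z _ => (hF z).hasFDerivAt.hasFDerivWithinAt) hseg
    (left_mem_segment ..) (right_mem_segment ..)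
  have e : y - x = -(τ • u) := by rw [hy]; abel
  rw [InnerProductSpace.toDual_apply_apply, e, inner_neg_right, real_inner_smul_right, norm_neg,
    norm_smul, Real.norm_of_nonneg hτ] at h1
  have h2 := (le_abs_self _).trans h1
  have h3 : ‖gF x - u‖ ^ 2 = ‖gF x‖ ^ 2 - 2 * ⟪gF x, u⟫ + ‖u‖ ^ 2 := norm_sub_sq_real _ _
  have h4 : l * (τ * ‖u‖) * (τ * ‖u‖) ≤ τ / 4 * ‖u‖ ^ 2 := by
    have : 0 ≤ τ * ‖u‖ ^ 2 := by positivity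
    nlinarith
  have h5 : τ / 2 * ‖gF x - u‖ ^ 2 = τ / 2 * ‖gF x‖ ^ 2 - τ * ⟪gF x, u⟫ + τ / 2 * ‖u‖ ^ 2 := by
    rw [h3]; ring
  linarith

end OneStep

/-! ### The averaged problem and the recursions of the algorithm -/

/-- The variables `(x, y, z)` of one worker. -/
abbrev Pt (dx dy : ℕ) : Type := Vec dx × Vec dy × Vec dy

/-- Squared Euclidean distance of two points `(x, y, z)`. -/
def sqDist {dx dy : ℕ} (m m' : Pt dx dy) : ℝ :=
  ‖m.1 - m'.1‖ ^ 2 + ‖m.2.1 - m'.2.1‖ ^ 2 + ‖m.2.2 - m'.2.2‖ ^ 2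

/-- `h` is `L`-Lipschitz in the Euclidean norm on the set where `‖z‖ ≤ ρ`. -/
def LipBall {dx dy : ℕ} {V : Type*} [NormedAddCommGroup V] (ρ L : ℝ) (h : Pt dx dy → V) : Prop :=
  ∀ m m', ‖m.2.2‖ ≤ ρ → ‖m'.2.2‖ ≤ ρ → ‖h m - h m'‖ ^ 2 ≤ L ^ 2 * sqDist m m'

lemma sqDist_nonneg {dx dy : ℕ} (m m' : Pt dx dy) : 0 ≤ sqDist m m' := by
  unfold sqDist; positivity

/-- What the analysis of the algorithm uses about the bilevel problem. The fields `G k`, `H k`,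
`R k` are the expected stochastic gradients of worker `k` for `y`, `z`, `x`; `ys` and `zs` are the
solution maps of the lower-level problem and of the Hessian-inverse-vector problem. -/
structure Landscape {K dx dy : ℕ} (L μ ρ : ℝ) (G H : Fin K → Pt dx dy → Vec dy)
    (R : Fin K → Pt dx dy → Vec dx) (F : Vec dx → ℝ) (ys zs : Vec dx → Vec dy) : Prop where
  lipG : ∀ k, LipBall ρ L (G k)
  lipH : ∀ k, LipBall ρ L (H k)
  lipR : ∀ k, LipBall ρ L (R k)
  monoG : ∀ x y y' z, μ * ‖y - y'‖ ^ 2 ≤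
    ⟪avg (fun k => G k (x, y, z)) - avg (fun k => G k (x, y', z)), y - y'⟫
  monoH : ∀ x y z z', μ * ‖z - z'‖ ^ 2 ≤
    ⟪avg (fun k => H k (x, y, z)) - avg (fun k => H k (x, y, z')), z - z'⟫
  zeroG : ∀ x z, avg (fun k => G k (x, ys x, z)) = 0
  zeroH : ∀ x, avg (fun k => H k (x, ys x, zs x)) = 0
  ball : ∀ x, ‖zs x‖ ≤ ρ
  lip_ys : ∀ x x', ‖ys x - ys x'‖ ^ 2 ≤ L ^ 2 * ‖x - x'‖ ^ 2
  lip_zs : ∀ x x', ‖zs x - zs x'‖ ^ 2 ≤ L ^ 2 * ‖x - x'‖ ^ 2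
  grad : ∀ x, HasGradientAt F (avg fun k => R k (x, ys x, zs x)) x

/-- The recursions of the algorithm for given estimators `U`, `V`, `W`, with trackers `P`, `Q`,
`R`. -/
structure Trajectory {K dx dy : ℕ} (E : Matrix (Fin K) (Fin K) ℝ) (ρ η β₁ β₂ β₃ : ℝ)
    (x₀ : Vec dx) (y₀ z₀ : Vec dy) (X P U : ℕ → Fin K → Vec dx)
    (Y Q V Z R W : ℕ → Fin K → Vec dy) : Prop where
  stepX : ∀ t k, X (t + 1) k = X t k + η • (mixV E (X t) k - β₁ • P t k - X t k)
  stepY : ∀ t k, Y (t + 1) k = Y t k + η • (mixV E (Y t) k - β₂ • Q t k - Y t k)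
  stepZ : ∀ t k, Z (t + 1) k = Z t k + η • (projBall ρ (mixV E (Z t) k - β₃ • R t k) - Z t k)
  trackP : ∀ t k, P (t + 1) k = mixV E (P t) k + (U (t + 1) k - U t k)
  trackQ : ∀ t k, Q (t + 1) k = mixV E (Q t) k + (V (t + 1) k - V t k)
  trackR : ∀ t k, R (t + 1) k = mixV E (R t) k + (W (t + 1) k - W t k)
  initX : ∀ k, X 0 k = x₀
  initY : ∀ k, Y 0 k = y₀
  initZ : ∀ k, Z 0 k = z₀
  initP : ∀ k, P 0 k = U 0 k
  initQ : ∀ k, Q 0 k = V 0 k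
  initR : ∀ k, R 0 k = W 0 k

/-! ### Consensus errors -/

section Consensus

variable {K n : ℕ} {E : Matrix (Fin K) (Fin K) ℝ} {η β : ℝ}

/-- Gradient tracking: the trackers and the estimators have the same average. -/
lemma avg_tracker (hE : IsMixing E) {P U : ℕ → Fin K → Vec n}
    (h : ∀ t k, P (t + 1) k = mixV E (P t) k + (U (t + 1) k - U t k)) (h0 : ∀ k, P 0 k = U 0 k)
    (t : ℕ) : avg (P t) = avg (U t) := by
  induction t with
  | zero => congr 1; exact funext h0
  | succ t ih =>
    rw [show P (t + 1) = fun k => mixV E (P t) k + (U (t + 1) k - U t k) from funext (h t),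
      avg_add, avg_sub, avg_mixV hE, ih]
    abel

/-- The total consensus error of the trackers is bounded by the variation of the estimators. -/
lemma sum_dev_tracker_le (hE : IsMixing E) (hK : 0 < K) {P U : ℕ → Fin K → Vec n}
    (h : ∀ t k, P (t + 1) k = mixV E (P t) k + (U (t + 1) k - U t k)) (T : ℕ) :
    (1 - lam E) ^ 2 * ∑ t ∈ Finset.range T, msq (dev (P t)) ≤
      msq (dev (P 0)) + ∑ t ∈ Finset.range T, msq (fun k => U (t + 1) k - U t k) := by
  have hs : 0 < 1 - lam E := by linarith [hE.gap]
  have hs1 : 1 - lam E ≤ 1 := by linarith [lam_nonneg E]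
  have h1 := sum_le_of_recursion (a := fun t => msq (dev (P t)))
    (c := fun t => 1 / (1 - lam E) * msq (fun k => U (t + 1) k - U t k)) (q := 1 - lam E)
    (fun t => msq_nonneg _) T fun t _ => by
      rw [show P (t + 1) = fun k => mixV E (P t) k + (U (t + 1) k - U t k) from funext (h t)]
      refine (msq_dev_mixV_add_le hE hK _ _).trans ?_
      have := msq_dev_le hK (fun k => U (t + 1) k - U t k)
      gcongr
  rw [← Finset.mul_sum] at h1
  have h2 := mul_le_mul_of_nonneg_left h1 hs.le
  have e : (1 - lam E) * (1 / (1 - lam E) * ∑ t ∈ Finset.range T, msq fun k => U (t + 1) k - U t k)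
      = ∑ t ∈ Finset.range T, msq fun k => U (t + 1) k - U t k := by field_simp
  rw [mul_add, e] at h2
  have h3 : (1 - lam E) * msq (dev (P 0)) ≤ msq (dev (P 0)) := by
    nlinarith [msq_nonneg (dev (P 0))]
  nlinarith

lemma msq_dev_relaxed_step_le {V : Type*} [NormedAddCommGroup V] [InnerProductSpace ℝ V]
    {X X' A : Fin K → V} {s c : ℝ} (h0 : 0 ≤ η) (h1 : η ≤ 1)
    (h : ∀ k, X' k = X k + η • (A k - X k))
    (hA : msq (dev A) ≤ (1 - s) * msq (dev X) + c) :
    msq (dev X') ≤ (1 - η * s) * msq (dev X) + η * c := by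
  have e : dev X' = fun k => (1 - η) • dev X k + η • dev A k := by
    have e1 : X' = fun k => (1 - η) • X k + η • A k := by
      funext k; rw [h, sub_smul, one_smul, smul_sub]; abel
    rw [e1, dev_add, dev_smul, dev_smul]
  have h2 : msq (dev X') ≤ (1 - η) * msq (dev X) + η * msq (dev A) := by
    rw [e]; exact msq_le_comb fun k => sq_norm_convex _ _ h0 h1
  nlinarith

lemma msq_dev_mixV_sub_le (hE : IsMixing E) (hK : 0 < K) (a p : Fin K → Vec n) :
    msq (dev fun k => mixV E a k - β • p k)
      ≤ (1 - (1 - lam E)) * msq (dev a) + β ^ 2 / (1 - lam E) * msq (dev p) := by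
  have h := msq_dev_mixV_add_le hE hK a (fun k => (-β) • p k)
  rw [dev_smul, msq_smul] at h
  simp only [neg_smul, ← sub_eq_add_neg] at h
  refine h.trans (le_of_eq ?_)
  ring

lemma msq_dev_projBall_le (hK : 0 < K) {ρ : ℝ} (hρ : 0 ≤ ρ) (a : Fin K → Vec n) :
    msq (dev fun k => projBall ρ (a k)) ≤ msq (dev a) := by
  refine (msq_dev_le_sub_const hK _ (projBall ρ (avg a))).trans (msq_mono_of fun k => ?_)
  gcongr
  exact norm_projBall_sub_le hρ _ _

/-- Total consensus error of a variable in terms of that of its tracker. -/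
lemma sum_dev_le_of_step (hE : IsMixing E) {X A P : ℕ → Fin K → Vec n} {x₀ : Vec n}
    (hK : 0 < K) (h0 : 0 < η) (h1 : η ≤ 1) (h : ∀ t k, X (t + 1) k = X t k + η • (A t k - X t k))
    (hA : ∀ t, msq (dev (A t)) ≤
      (1 - (1 - lam E)) * msq (dev (X t)) + β ^ 2 / (1 - lam E) * msq (dev (P t)))
    (hX : ∀ k, X 0 k = x₀) (T : ℕ) :
    ∑ t ∈ Finset.range T, msq (dev (X t)) ≤
      β ^ 2 / (1 - lam E) ^ 2 * ∑ t ∈ Finset.range T, msq (dev (P t)) := by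
  have hs : 0 < 1 - lam E := by linarith [hE.gap]
  have h2 := sum_le_of_recursion (a := fun t => msq (dev (X t)))
    (c := fun t => η * (β ^ 2 / (1 - lam E) * msq (dev (P t)))) (q := η * (1 - lam E))
    (fun t => msq_nonneg _) T fun t _ => msq_dev_relaxed_step_le h0.le h1 (h t) (hA t)
  have h3 : msq (dev (X 0)) = 0 := by
    have : X 0 = fun _ => x₀ := funext hX
    rw [this]; simp [msq, dev, avg_const hK]
  rw [h3, zero_add, ← Finset.mul_sum, ← Finset.mul_sum, mul_assoc] at h2
  have h4 := le_of_mul_le_mul_left h2 h0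
  rw [div_mul_eq_mul_div, le_div_iff₀ hs] at h4
  rw [div_mul_eq_mul_div, le_div_iff₀ (by positivity)]
  have h5 := h4
  nlinarith

/-- Movement of a variable in one iteration. -/
lemma msq_step_le (hE : IsMixing E) (hK : 0 < K) {X X' P : Fin K → Vec n}
    (h : ∀ k, ‖X' k - X k‖ ≤ |η| * ‖mixV E X k - β • P k - X k‖) :
    msq (fun k => X' k - X k) ≤
      η ^ 2 * (8 * msq (dev X) + 2 * β ^ 2 * msq (dev P) + 2 * β ^ 2 * ‖avg P‖ ^ 2) := by
  have h1 : msq (fun k => X' k - X k) ≤ msq (fun k => η • (mixV E X k - β • P k - X k)) :=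
    msq_mono_of fun k => by
      rw [norm_smul, Real.norm_eq_abs]
      have := h k
      gcongr
  have h2 : msq (fun k => mixV E X k - β • P k - X k)
      ≤ 2 * msq (fun k => mixV E X k - X k) + 2 * msq (fun k => β • P k) := by
    refine (le_of_eq ?_).trans (msq_sub_le _ _)
    congr 1; funext k; abel
  rw [msq_smul, msq_eq_dev_add hK P] at h2
  rw [msq_smul] at h1
  have h3 := msq_mixV_sub_le hE hK X
  refine h1.trans ?_
  gcongr
  linarith

end Consensus

section Bias

variable {K dx dy : ℕ} {V : Type*} [NormedAddCommGroup V] [InnerProductSpace ℝ V]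

/-- Replacing the variables of the workers by a common point changes the averaged field by at
most the mean square distance. -/
lemma sq_norm_avg_sub_avg_le (hK : 0 < K) {ρ L : ℝ} {h : Fin K → Pt dx dy → V}
    (hh : ∀ k, LipBall ρ L (h k)) {X : Fin K → Vec dx} {Y Z : Fin K → Vec dy}
    (hZ : ∀ k, ‖Z k‖ ≤ ρ) {x : Vec dx} {y z : Vec dy} (hz : ‖z‖ ≤ ρ) :
    ‖avg (fun k => h k (X k, Y k, Z k)) - avg (fun k => h k (x, y, z))‖ ^ 2 ≤
      L ^ 2 * (msq (fun k => X k - x) + msq (fun k => Y k - y) + msq (fun k => Z k - z)) := by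
  rw [← avg_sub]
  refine (sq_norm_avg_le hK _).trans ?_
  have : ∑ k, ‖h k (X k, Y k, Z k) - h k (x, y, z)‖ ^ 2 ≤ L ^ 2 *
      (∑ k, ‖X k - x‖ ^ 2 + ∑ k, ‖Y k - y‖ ^ 2 + ∑ k, ‖Z k - z‖ ^ 2) := by
    rw [← Finset.sum_add_distrib, ← Finset.sum_add_distrib, Finset.mul_sum]
    exact Finset.sum_le_sum fun k _ => hh k _ _ (hZ k) hz
  unfold msq
  calc _ ≤ (K : ℝ)⁻¹ * (L ^ 2 *
      (∑ k, ‖X k - x‖ ^ 2 + ∑ k, ‖Y k - y‖ ^ 2 + ∑ k, ‖Z k - z‖ ^ 2)) := by gcongr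
    _ = _ := by ring

/-- Error of an averaged estimator with respect to the averaged field at a common point. -/
lemma sq_norm_estimator_sub_le (hK : 0 < K) {ρ L : ℝ} {h : Fin K → Pt dx dy → V}
    (hh : ∀ k, LipBall ρ L (h k)) {X : Fin K → Vec dx} {Y Z : Fin K → Vec dy}
    (hZ : ∀ k, ‖Z k‖ ≤ ρ) {x : Vec dx} {y z : Vec dy} (hz : ‖z‖ ≤ ρ) (v : V) :
    ‖v - avg (fun k => h k (x, y, z))‖ ^ 2 ≤
      2 * ‖v - avg (fun k => h k (X k, Y k, Z k))‖ ^ 2 +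
      2 * (L ^ 2 * (msq (fun k => X k - x) + msq (fun k => Y k - y) + msq (fun k => Z k - z))) := by
  have h1 := sq_norm_avg_sub_avg_le hK hh (X := X) (Y := Y) (x := x) (y := y) hZ hz
  have h2 := sq_norm_add_le (v - avg (fun k => h k (X k, Y k, Z k)))
    (avg (fun k => h k (X k, Y k, Z k)) - avg (fun k => h k (x, y, z)))
  rw [sub_add_sub_cancel] at h2
  linarith

end Bias

/-! ### The deterministic analysis of a trajectory -/

/-- Total error of the averaged estimators with respect to the averaged expected gradients. -/
def estErr {K dx dy : ℕ} (G H : Fin K → Pt dx dy → Vec dy) (R : Fin K → Pt dx dy → Vec dx)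
    (m : Fin K → Pt dx dy) (u : Fin K → Vec dx) (v w : Fin K → Vec dy) : ℝ :=
  ‖avg u - avg (fun k => R k (m k))‖ ^ 2 + ‖avg v - avg (fun k => G k (m k))‖ ^ 2 +
    ‖avg w - avg (fun k => H k (m k))‖ ^ 2

/-- Mean square movement of all variables between two points. -/
def move {K dx dy : ℕ} (m m' : Fin K → Pt dx dy) : ℝ := (K : ℝ)⁻¹ * ∑ k, sqDist (m' k) (m k)

/-- Elimination of the solution errors from the coupled inequalities: `G` is the sum of the
squared gradients, `U` of the squared averaged directions, `NY`, `NZ` of the errors of `ȳ` and `z`,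
`Er` of the estimation errors, `M` the consensus error, `D` the movement. -/
lemma small_gain_solution_errors {Λ r b G U NY NZ Er M D IF Iy Iz : ℝ} (hΛ : 1 ≤ Λ)
    (hr : 16 * Λ ^ 3 * r ^ 2 ≤ 1) (hU : 0 ≤ U) (hG : 0 ≤ G)
    (hEr : 0 ≤ Er) (hM : 0 ≤ M) (hIF : 0 ≤ IF) (hIy : 0 ≤ Iy) (hIz : 0 ≤ Iz)
    (h1 : G + U / 2 ≤ IF + Λ * (Er + M + NY + NZ))
    (h2 : NY ≤ Iy + Λ * (Er + M + r ^ 2 * U))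
    (h3 : NZ ≤ Iz + Λ * (Er + M + NY + r ^ 2 * U))
    (h4 : D ≤ Λ * (M + b ^ 2 * (U + Er + NY + NZ))) :
    G ≤ 4 * Λ ^ 3 * (IF + Iy + Iz + Er + M) ∧
      D ≤ 24 * Λ ^ 4 * (M + b ^ 2 * (IF + Iy + Iz + Er + M)) := by
  set S := Er + M with hS
  set J := IF + Iy + Iz + Er + M with hJ
  have hS0 : 0 ≤ S := by positivity
  have hJ0 : 0 ≤ J := by positivity
  have hSJ : S ≤ J := by linarith
  have hrU : 0 ≤ r ^ 2 * U := by positivity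
  have hΛ2 : Λ ≤ Λ ^ 2 := by nlinarith
  have hΛ3 : Λ ^ 2 ≤ Λ ^ 3 := by nlinarith [sq_nonneg Λ]
  have hΛ4 : Λ ^ 3 ≤ Λ ^ 4 := by nlinarith [pow_pos (by linarith : 0 < Λ) 3]
  -- eliminate the errors of `y`, then of `z`
  have a1 : Λ * NY ≤ Λ * Iy + Λ ^ 2 * (S + r ^ 2 * U) := by
    have := mul_le_mul_of_nonneg_left h2 (by linarith : 0 ≤ Λ)
    nlinarith
  have a2 : NY + NZ ≤ 3 * Λ * (Iy + Iz) + 3 * Λ ^ 2 * (S + r ^ 2 * U) := by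
    have b1 : Λ * (S + r ^ 2 * U) ≤ Λ ^ 2 * (S + r ^ 2 * U) := by gcongr
    have b2 : Iy + Iz ≤ Λ * (Iy + Iz) := by nlinarith
    have b3 : 0 ≤ Λ * Iz := by positivity
    nlinarith
  have a3 : Λ * (NY + NZ) ≤ 3 * Λ ^ 2 * (Iy + Iz) + 3 * Λ ^ 3 * (S + r ^ 2 * U) := by
    have := mul_le_mul_of_nonneg_left a2 (by linarith : 0 ≤ Λ)
    nlinarith
  have a4 : 3 * Λ ^ 3 * (r ^ 2 * U) ≤ U / 4 := by
    have := mul_le_mul_of_nonneg_right hr hU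
    have : 0 ≤ Λ ^ 3 * (r ^ 2 * U) := by positivity
    nlinarith
  have a5 : G + U / 4 ≤ 4 * Λ ^ 3 * J := by
    have b1 : Λ * S ≤ Λ ^ 3 * S := by gcongr; linarith
    have b2 : IF ≤ Λ ^ 3 * IF := le_mul_of_one_le_left hIF (by linarith)
    have b3 : 3 * Λ ^ 2 * (Iy + Iz) ≤ 3 * Λ ^ 3 * (Iy + Iz) := by gcongr
    have b4 : 0 ≤ Λ ^ 3 * (3 * IF + (Iy + Iz)) := by positivity
    have e : 4 * Λ ^ 3 * J = Λ ^ 3 * IF + 3 * Λ ^ 3 * (Iy + Iz) + Λ ^ 3 * (3 * IF + (Iy + Iz))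
      + Λ ^ 3 * S + 3 * Λ ^ 3 * S := by rw [hJ, hS]; ring
    nlinarith
  refine ⟨by linarith, ?_⟩
  have a6 : U + Er + NY + NZ ≤ 24 * Λ ^ 3 * J := by
    have b1 : 3 * Λ * (Iy + Iz) + 3 * Λ ^ 2 * S ≤ 3 * Λ ^ 3 * J := by
      have c1 : 3 * Λ * (Iy + Iz) ≤ 3 * Λ ^ 3 * (Iy + Iz) := by gcongr; linarith
      have c2 : 3 * Λ ^ 2 * S ≤ 3 * Λ ^ 3 * S := by gcongr
      have : 0 ≤ Λ ^ 3 * IF := by positivity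
      have e : 3 * Λ ^ 3 * J = 3 * Λ ^ 3 * (Iy + Iz) + 3 * Λ ^ 3 * S + 3 * (Λ ^ 3 * IF) := by
        rw [hJ, hS]; ring
      linarith
    have b2 : 3 * Λ ^ 2 * (r ^ 2 * U) ≤ U / 4 := by
      refine le_trans ?_ a4
      gcongr
    have b3 : Er ≤ Λ ^ 3 * J := by
      have : J ≤ Λ ^ 3 * J := le_mul_of_one_le_left hJ0 (by linarith)
      linarith
    linarith
  calc D ≤ Λ * (M + b ^ 2 * (U + Er + NY + NZ)) := h4
    _ ≤ Λ * (M + b ^ 2 * (24 * Λ ^ 3 * J)) := by gcongr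
    _ = Λ * M + 24 * Λ ^ 4 * (b ^ 2 * J) := by ring
    _ ≤ 24 * Λ ^ 4 * M + 24 * Λ ^ 4 * (b ^ 2 * J) := by gcongr; linarith
    _ = _ := by ring

/-- Arithmetic combination of the summed inequalities of one trajectory, with `cX, …, cR` the total
consensus errors, `eu, ev, ew` the total errors of the averaged estimators, `SG, SU, SV, SW` the
total squared norms of the gradient and of the averaged estimators, `MX, MY, MZ` the movements. -/
lemma trajectory_bounds_arith {L μ η β₁ β₂ β₃ b r s ΔF dy dz SG SU SV SW cP cQ cR cX cY cZ NY NZ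
    eu ev ew MX MY MZ Er M I : ℝ} (hL : 1 ≤ L) (hμ : 0 < μ) (hμ1 : μ ≤ 1) (h0 : 0 < η) (hβ₁ : 0 < β₁)
    (hβ₂ : 0 < β₂) (hβ₃ : 0 < β₃) (hb₁ : β₁ ≤ b) (hb₂ : β₂ ≤ b) (hb₃ : β₃ ≤ b)
    (hb1 : b ≤ 1) (hr₂ : β₁ / β₂ ≤ r) (hr₃ : β₁ / β₃ ≤ r)
    (hr : 16 * (300 * L ^ 2 / μ ^ 2) ^ 3 * r ^ 2 ≤ 1) (hs : 0 < s) (hs1 : s ≤ 1)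
    (pΔ : 0 ≤ ΔF) (pdy : 0 ≤ dy) (pdz : 0 ≤ dz)
    (pG : 0 ≤ SG) (pU : 0 ≤ SU) (pcP : 0 ≤ cP) (pcQ : 0 ≤ cQ) (pcR : 0 ≤ cR)
    (pcX : 0 ≤ cX) (pcY : 0 ≤ cY) (pcZ : 0 ≤ cZ) (pNY : 0 ≤ NY) (pNZ : 0 ≤ NZ) (peu : 0 ≤ eu)
    (pev : 0 ≤ ev) (pew : 0 ≤ ew)
    (hEr : Er = eu + ev + ew)
    (hM : M = β₁ ^ 2 / s ^ 2 * cP + β₂ ^ 2 / s ^ 2 * cQ + β₃ / s ^ 2 * cR)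
    (hI : I = 2 * ΔF / (η * β₁) + 2 / (η * β₂ * μ) * dy + 4 / (η * β₃ * μ) * dz)
    (cXle : cX ≤ β₁ ^ 2 / s ^ 2 * cP) (cYle : cY ≤ β₂ ^ 2 / s ^ 2 * cQ)
    (cZle : cZ ≤ β₃ ^ 2 / s ^ 2 * cR)
    (dsum : SG + SU / 2 ≤ 2 * ΔF / (η * β₁) + (2 * eu + 2 * (L ^ 2 * (cX + (cY + NY) + NZ))))
    (ysum : NY ≤ 2 / (η * β₂ * μ) * dy + 12 / μ ^ 2 * (2 * ev + 2 * (L ^ 2 * (cX + cY + cZ))) +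
      12 * L ^ 2 / μ ^ 2 * (β₁ / β₂) ^ 2 * SU)
    (zsum : NZ ≤ 4 / (η * β₃ * μ) * dz +
      48 / μ ^ 2 * (2 * ew + 2 * (L ^ 2 * (cX + (cY + NY) + cZ))) +
      16 / μ * (cZ / β₃ + β₃ * cR) + 32 * L ^ 2 / μ ^ 2 * (β₁ / β₃) ^ 2 * SU)
    (hV : SV ≤ 2 * ev + 2 * (L ^ 2 * (cX + (cY + NY) + NZ)))
    (hW : SW ≤ 2 * ew + 2 * (L ^ 2 * (cX + (cY + NY) + NZ)))
    (mX : MX ≤ η ^ 2 * (8 * cX + 2 * β₁ ^ 2 * cP + 2 * β₁ ^ 2 * SU))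
    (mY : MY ≤ η ^ 2 * (8 * cY + 2 * β₂ ^ 2 * cQ + 2 * β₂ ^ 2 * SV))
    (mZ : MZ ≤ η ^ 2 * (8 * cZ + 2 * β₃ ^ 2 * cR + 2 * β₃ ^ 2 * SW)) :
    SG ≤ 4 * (300 * L ^ 2 / μ ^ 2) ^ 3 * (I + Er + M) ∧
    MX + MY + MZ ≤ η ^ 2 * (24 * (300 * L ^ 2 / μ ^ 2) ^ 4 * (M + b ^ 2 * (I + Er + M))) := by
  set A := L ^ 2 / μ ^ 2 with hA
  have hL2 : 1 ≤ L ^ 2 := one_le_pow₀ hL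
  have hμ2 : μ ^ 2 ≤ 1 := pow_le_one₀ hμ.le hμ1
  have hμ2' : 0 < μ ^ 2 := by positivity
  have hAL : L ^ 2 ≤ A := by
    rw [hA, le_div_iff₀ hμ2']
    exact mul_le_of_le_one_right (by positivity) hμ2
  have hAμ : 1 / μ ^ 2 ≤ A := by rw [hA]; gcongr
  have hAμ1 : 1 / μ ≤ A := by
    refine le_trans ?_ hAμ
    gcongr; exact pow_le_of_le_one hμ.le hμ1 two_ne_zero
  have hA1 : 1 ≤ A := hL2.trans hAL
  have hΛ : 300 * L ^ 2 / μ ^ 2 = 300 * A := by rw [hA]; ring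
  rw [hΛ] at hr ⊢
  have hs2 : s ^ 2 ≤ 1 := pow_le_one₀ hs.le hs1
  have hs2' : 0 < s ^ 2 := by positivity
  have hβ1 : β₃ ≤ 1 := hb₃.trans hb1
  -- consensus errors are dominated by `M`
  have mP : 0 ≤ β₁ ^ 2 / s ^ 2 * cP := by positivity
  have mQ : 0 ≤ β₂ ^ 2 / s ^ 2 * cQ := by positivity
  have mR : 0 ≤ β₃ / s ^ 2 * cR := by positivity
  have cZ1 : β₃ ^ 2 / s ^ 2 * cR ≤ β₃ / s ^ 2 * cR := by
    gcongr; exact pow_le_of_le_one hβ₃.le hβ1 two_ne_zero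
  have hC : cX + cY + cZ ≤ M := by linarith
  have divs : ∀ a : ℝ, 0 ≤ a → a ≤ a / s ^ 2 := fun a ha => by
    rw [le_div_iff₀ hs2']; exact mul_le_of_le_one_right ha hs2
  have cR1 : β₃ * cR ≤ M := by
    have : β₃ * cR ≤ β₃ / s ^ 2 * cR := by gcongr; exact divs _ hβ₃.le
    linarith
  have cZ2 : cZ / β₃ ≤ M := by
    have : cZ / β₃ ≤ β₃ / s ^ 2 * cR := by
      rw [div_le_iff₀ hβ₃]
      refine cZle.trans (le_of_eq ?_); ring
    linarith
  have pM : 0 ≤ M := by linarith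
  have pEr : 0 ≤ Er := by linarith
  have rr2 : (β₁ / β₂) ^ 2 * SU ≤ r ^ 2 * SU := by gcongr
  have rr3 : (β₁ / β₃) ^ 2 * SU ≤ r ^ 2 * SU := by gcongr
  have prU : 0 ≤ r ^ 2 * SU := by positivity
  -- coefficient bounds
  have up : ∀ c k x : ℝ, 0 ≤ x → c ≤ k → c * x ≤ k * x := fun c k x hx h => by gcongr
  have q1 : L ^ 2 * (cX + (cY + NY) + NZ) ≤ A * (M + NY + NZ) :=
    mul_le_mul hAL (by linarith) (by positivity) (by linarith)
  have q2 : 1 / μ ^ 2 * ev ≤ A * ev := up _ _ _ pev hAμ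
  have q3 : 1 / μ ^ 2 * ew ≤ A * ew := up _ _ _ pew hAμ
  have q4 : A * (cX + cY + cZ) ≤ A * M := by gcongr
  have q5 : 1 / μ * (cZ / β₃ + β₃ * cR) ≤ A * (M + M) :=
    mul_le_mul hAμ1 (by linarith) (by positivity) (by linarith)
  have q6 : A * ((β₁ / β₂) ^ 2 * SU) ≤ A * (r ^ 2 * SU) := by gcongr
  have q7 : A * ((β₁ / β₃) ^ 2 * SU) ≤ A * (r ^ 2 * SU) := by gcongr
  have pAM : 0 ≤ A * M := by positivity
  have pAU : 0 ≤ A * (r ^ 2 * SU) := by positivity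
  have pAY : 0 ≤ A * NY := by positivity
  have pAZ : 0 ≤ A * NZ := by positivity
  have pAeu : eu ≤ A * eu := le_mul_of_one_le_left peu hA1
  have pAev : ev ≤ A * ev := le_mul_of_one_le_left pev hA1
  have pAew : ew ≤ A * ew := le_mul_of_one_le_left pew hA1
  have H1 : SG + SU / 2 ≤ 2 * ΔF / (η * β₁) + 300 * A * (Er + M + NY + NZ) := by
    rw [hEr]; linarith
  have H2 : NY ≤ 2 / (η * β₂ * μ) * dy + 300 * A * (Er + M + r ^ 2 * SU) := by
    have e : 12 / μ ^ 2 * (2 * ev + 2 * (L ^ 2 * (cX + cY + cZ))) +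
        12 * L ^ 2 / μ ^ 2 * (β₁ / β₂) ^ 2 * SU =
        24 * (1 / μ ^ 2 * ev) + 24 * (A * (cX + cY + cZ)) + 12 * (A * ((β₁ / β₂) ^ 2 * SU)) := by
      rw [hA]; ring
    rw [hEr]; linarith
  have H3 : NZ ≤ 4 / (η * β₃ * μ) * dz + 300 * A * (Er + M + NY + r ^ 2 * SU) := by
    have e : 48 / μ ^ 2 * (2 * ew + 2 * (L ^ 2 * (cX + (cY + NY) + cZ))) +
        16 / μ * (cZ / β₃ + β₃ * cR) + 32 * L ^ 2 / μ ^ 2 * (β₁ / β₃) ^ 2 * SU =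
        96 * (1 / μ ^ 2 * ew) + 96 * (A * (cX + cY + cZ)) + 96 * (A * NY) +
          16 * (1 / μ * (cZ / β₃ + β₃ * cR)) + 32 * (A * ((β₁ / β₃) ^ 2 * SU)) := by
      rw [hA]; ring
    rw [hEr]; linarith
  have H4 : (MX + MY + MZ) / η ^ 2 ≤ 300 * A * (M + b ^ 2 * (SU + Er + NY + NZ)) := by
    rw [div_le_iff₀' (by positivity)]
    have sq : ∀ β : ℝ, 0 < β → β ≤ b → β ^ 2 ≤ b ^ 2 := fun β h h' => by gcongr
    have hbb : b ^ 2 ≤ 1 := pow_le_one₀ (hβ₃.le.trans hb₃) hb1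
    have t1 : β₁ ^ 2 * cP ≤ β₁ ^ 2 / s ^ 2 * cP := by gcongr; exact divs _ (by positivity)
    have t2 : β₂ ^ 2 * cQ ≤ β₂ ^ 2 / s ^ 2 * cQ := by gcongr; exact divs _ (by positivity)
    have t3 : β₃ ^ 2 * cR ≤ β₃ / s ^ 2 * cR := by
      refine le_trans ?_ cZ1
      gcongr; exact divs _ (by positivity)
    have w1 : β₁ ^ 2 * SU ≤ b ^ 2 * SU := up _ _ _ pU (sq _ hβ₁ hb₁)
    set N := 2 * Er + 2 * (A * (M + NY + NZ)) with hN
    have pN : 0 ≤ N := by positivity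
    have w2 : β₂ ^ 2 * SV ≤ b ^ 2 * N := by
      calc _ ≤ β₂ ^ 2 * N := by gcongr; linarith
        _ ≤ _ := up _ _ _ pN (sq _ hβ₂ hb₂)
    have w3 : β₃ ^ 2 * SW ≤ b ^ 2 * N := by
      calc _ ≤ β₃ ^ 2 * N := by gcongr; linarith
        _ ≤ _ := up _ _ _ pN (sq _ hβ₃ hb₃)
    have w4 : b ^ 2 * N ≤ 2 * A * M + 2 * A * (b ^ 2 * (Er + NY + NZ)) := by
      have e : b ^ 2 * N = b ^ 2 * (2 * (A * M)) + 2 * (b ^ 2 * Er) +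
          2 * A * (b ^ 2 * (NY + NZ)) := by
        rw [hN]; ring
      have e1 : b ^ 2 * (2 * (A * M)) ≤ 1 * (2 * (A * M)) := by gcongr
      have e2 : b ^ 2 * Er ≤ A * (b ^ 2 * Er) := le_mul_of_one_le_left (by positivity) hA1
      rw [e]; linarith
    have w5 : M ≤ A * M := le_mul_of_one_le_left pM hA1
    have w6 : b ^ 2 * SU ≤ A * (b ^ 2 * SU) := le_mul_of_one_le_left (by positivity) hA1
    have w7 : 0 ≤ A * (b ^ 2 * (Er + NY + NZ)) := by positivity
    have w8 : 0 ≤ A * (b ^ 2 * SU) := by positivity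
    have tot : MX + MY + MZ ≤ η ^ 2 * ((8 * cX + 2 * β₁ ^ 2 * cP + 2 * β₁ ^ 2 * SU) +
      (8 * cY + 2 * β₂ ^ 2 * cQ + 2 * β₂ ^ 2 * SV) +
      (8 * cZ + 2 * β₃ ^ 2 * cR + 2 * β₃ ^ 2 * SW)) := by
      rw [mul_add, mul_add]; linarith
    refine tot.trans ?_
    gcongr
    have e : 300 * A * (M + b ^ 2 * (SU + Er + NY + NZ)) =
      300 * (A * M) + 300 * (A * (b ^ 2 * SU)) +
      300 * (A * (b ^ 2 * (Er + NY + NZ))) := by ring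
    rw [e]
    linarith
  have := small_gain_solution_errors (Λ := 300 * A) (by linarith) hr pU pG pEr pM
    (by positivity) (by positivity) (by positivity) H1 H2 H3 H4
  rw [← hI] at this
  refine ⟨this.1, ?_⟩
  have h2 := (div_le_iff₀' (by positivity)).1 this.2
  exact h2

section Bounds

variable {K dx dy : ℕ} {E : Matrix (Fin K) (Fin K) ℝ} {L μ ρ η β₁ β₂ β₃ : ℝ}
  {G H : Fin K → Pt dx dy → Vec dy} {Rh : Fin K → Pt dx dy → Vec dx} {F : Vec dx → ℝ}
  {ys zs : Vec dx → Vec dy} {x₀ : Vec dx} {y₀ z₀ : Vec dy} {X P U : ℕ → Fin K → Vec dx}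
  {Y Q V Z R W : ℕ → Fin K → Vec dy}

lemma Trajectory.ball (h : Trajectory E ρ η β₁ β₂ β₃ x₀ y₀ z₀ X P U Y Q V Z R W)
    (h0 : 0 ≤ η) (h1 : η ≤ 1) (hz : ‖z₀‖ ≤ ρ) (t : ℕ) (k : Fin K) : ‖Z t k‖ ≤ ρ := by
  have hρ : 0 ≤ ρ := (norm_nonneg _).trans hz
  induction t with
  | zero => rw [h.initZ]; exact hz
  | succ t ih =>
    rw [h.stepZ]
    have e : Z t k + η • (projBall ρ (mixV E (Z t) k - β₃ • R t k) - Z t k)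
        = (1 - η) • Z t k + η • projBall ρ (mixV E (Z t) k - β₃ • R t k) := by module
    rw [e]
    refine (norm_add_le _ _).trans ?_
    rw [norm_smul, norm_smul, Real.norm_of_nonneg h0, Real.norm_of_nonneg (by linarith)]
    have := norm_projBall_le hρ (mixV E (Z t) k - β₃ • R t k)
    nlinarith

lemma avg_relaxed_step (hE : IsMixing E) {n : ℕ} {X X' P : Fin K → Vec n} {β : ℝ}
    (h : ∀ k, X' k = X k + η • (mixV E X k - β • P k - X k)) :
    avg X' = avg X - (η * β) • avg P := by
  rw [show X' = fun k => X k + η • (mixV E X k - β • P k - X k) from funext h, avg_add, avg_smul,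
    avg_sub, avg_sub, avg_smul, avg_mixV hE]
  module

/-- The gradient of the objective is Lipschitz. -/
lemma Landscape.lip_grad (hK : 0 < K) (hL : 1 ≤ L) (l : Landscape L μ ρ G H Rh F ys zs)
    (x x' : Vec dx) :
    ‖avg (fun k => Rh k (x, ys x, zs x)) - avg (fun k => Rh k (x', ys x', zs x'))‖
      ≤ 2 * L ^ 2 * ‖x - x'‖ := by
  have h1 := sq_norm_avg_sub_avg_le hK l.lipR (X := fun _ => x) (Y := fun _ => ys x)
    (Z := fun _ => zs x) (x := x') (y := ys x') (z := zs x') (fun _ => l.ball x) (l.ball x')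
  rw [msq_const hK, msq_const hK, msq_const hK] at h1
  have h2 := l.lip_ys x x'
  have h3 := l.lip_zs x x'
  have hL2 : 1 ≤ L ^ 2 := by nlinarith
  have h4 : L ^ 2 * (‖x - x'‖ ^ 2 + ‖ys x - ys x'‖ ^ 2 + ‖zs x - zs x'‖ ^ 2)
      ≤ (2 * L ^ 2 * ‖x - x'‖) ^ 2 := by
    calc _ ≤ L ^ 2 * (L ^ 2 * ‖x - x'‖ ^ 2 + L ^ 2 * ‖x - x'‖ ^ 2 + L ^ 2 * ‖x - x'‖ ^ 2) := by
          gcongr; nlinarith [sq_nonneg ‖x - x'‖]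
      _ = 3 * (L ^ 2 * L ^ 2 * ‖x - x'‖ ^ 2) := by ring
      _ ≤ 4 * (L ^ 2 * L ^ 2 * ‖x - x'‖ ^ 2) := by gcongr; norm_num
      _ = _ := by ring
  exact le_of_sq_le_sq (h1.trans h4) (by positivity)

variable (l : Landscape L μ ρ G H Rh F ys zs)
  (h : Trajectory E ρ η β₁ β₂ β₃ x₀ y₀ z₀ X P U Y Q V Z R W)

include l h

/-- Inexact descent of the objective along the averaged iterates. -/
lemma descent_sum_le (hE : IsMixing E) (hK : 0 < K) (hL : 1 ≤ L) (h0 : 0 < η) (h1 : η ≤ 1)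
    (hz : ‖z₀‖ ≤ ρ) (hβ : 0 < β₁) (hβL : 8 * L ^ 2 * β₁ ≤ 1) {ΔF : ℝ}
    (hF : ∀ x, F x₀ - F x ≤ ΔF) (T : ℕ) :
    ∑ t ∈ Finset.range T, ‖avg (fun k => Rh k (avg (X t), ys (avg (X t)), zs (avg (X t))))‖ ^ 2 +
      (∑ t ∈ Finset.range T, ‖avg (U t)‖ ^ 2) / 2 ≤ 2 * ΔF / (η * β₁) +
      ∑ t ∈ Finset.range T, (2 * ‖avg (U t) - avg (fun k => Rh k (X t k, Y t k, Z t k))‖ ^ 2 +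
        2 * (L ^ 2 * (msq (dev (X t)) + (msq (dev (Y t)) + ‖avg (Y t) - ys (avg (X t))‖ ^ 2) +
          msq (fun k => Z t k - zs (avg (X t)))))) := by
  set gF : Vec dx → Vec dx := fun x => avg (fun k => Rh k (x, ys x, zs x)) with hgF
  have hτ : 0 < η * β₁ := by positivity
  have step : ∀ t, F (avg (X (t + 1))) ≤ F (avg (X t)) + η * β₁ / 2 *
      (-(‖gF (avg (X t))‖ ^ 2 + ‖avg (U t)‖ ^ 2 / 2) +
      (2 * ‖avg (U t) - avg (fun k => Rh k (X t k, Y t k, Z t k))‖ ^ 2 +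
        2 * (L ^ 2 * (msq (dev (X t)) + (msq (dev (Y t)) + ‖avg (Y t) - ys (avg (X t))‖ ^ 2) +
          msq (fun k => Z t k - zs (avg (X t))))))) := by
    intro t
    have e1 : avg (X (t + 1)) = avg (X t) - (η * β₁) • avg (U t) := by
      rw [avg_relaxed_step hE (h.stepX t), avg_tracker hE h.trackP h.initP]
    have d := descent_step (x := avg (X t)) (u := avg (U t)) l.grad (l.lip_grad hK hL) hτ.le
      (by nlinarith [sq_nonneg L, mul_le_mul h1 hβL (by positivity) (by norm_num)])
    rw [← e1] at d
    have b := sq_norm_estimator_sub_le hK l.lipR (X := X t) (Y := Y t) (Z := Z t)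
      (x := avg (X t)) (y := ys (avg (X t))) (z := zs (avg (X t)))
      (h.ball h0.le h1 hz t) (l.ball _) (avg (U t))
    rw [norm_sub_rev, msq_sub_const hK (X t), msq_sub_const hK (Y t), sub_self, norm_zero] at b
    have b2 := mul_le_mul_of_nonneg_left b (by positivity : 0 ≤ η * β₁ / 2)
    simp only [hgF] at d ⊢
    nlinarith
  have hsum : F (avg (X T)) ≤ F (avg (X 0)) + ∑ t ∈ Finset.range T, η * β₁ / 2 *
      (-(‖gF (avg (X t))‖ ^ 2 + ‖avg (U t)‖ ^ 2 / 2) +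
      (2 * ‖avg (U t) - avg (fun k => Rh k (X t k, Y t k, Z t k))‖ ^ 2 +
        2 * (L ^ 2 * (msq (dev (X t)) + (msq (dev (Y t)) + ‖avg (Y t) - ys (avg (X t))‖ ^ 2) +
          msq (fun k => Z t k - zs (avg (X t))))))) := by
    induction T with
    | zero => simp
    | succ T ih => rw [Finset.sum_range_succ]; linarith [step T]
  have hX0 : avg (X 0) = x₀ := by
    rw [show X 0 = fun _ => x₀ from funext h.initX, avg_const hK]
  have hF' := hF (avg (X T))
  rw [hX0, ← Finset.mul_sum, Finset.sum_add_distrib, Finset.sum_neg_distrib,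
    Finset.sum_add_distrib, ← Finset.sum_div] at hsum
  have e : 2 * ΔF / (η * β₁) = ΔF / (η * β₁ / 2) := by field_simp
  rw [e, ← sub_le_iff_le_add, le_div_iff₀ (by positivity)]
  linarith

/-- Tracking of the lower-level solution by the averaged iterates. -/
lemma lower_sum_le (hE : IsMixing E) (hK : 0 < K) (hL : 1 ≤ L) (hμ : 0 < μ) (hμ1 : μ ≤ 1)
    (h0 : 0 < η) (h1 : η ≤ 1) (hz : ‖z₀‖ ≤ ρ) (hβ : 0 < β₂) (hβL : β₂ * L ^ 2 ≤ μ) (T : ℕ) :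
    ∑ t ∈ Finset.range T, ‖avg (Y t) - ys (avg (X t))‖ ^ 2 ≤
      2 / (η * β₂ * μ) * ‖y₀ - ys x₀‖ ^ 2 + 12 / μ ^ 2 * ∑ t ∈ Finset.range T,
        (2 * ‖avg (V t) - avg (fun k => G k (X t k, Y t k, Z t k))‖ ^ 2 +
          2 * (L ^ 2 * (msq (dev (X t)) + msq (dev (Y t)) + msq (dev (Z t))))) +
      12 * L ^ 2 / μ ^ 2 * (β₁ / β₂) ^ 2 * ∑ t ∈ Finset.range T, ‖avg (U t)‖ ^ 2 := by
  set γ := η * β₂ with hγ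
  have hγ0 : 0 < γ := by positivity
  have hγβ : γ ≤ β₂ := by rw [hγ]; nlinarith
  have hγL : γ * L ^ 2 ≤ μ := (by gcongr : γ * L ^ 2 ≤ β₂ * L ^ 2).trans hβL
  have hL2 : 1 ≤ L ^ 2 := by nlinarith
  have hγμ : γ * μ ≤ 1 := by nlinarith
  have step : ∀ t, ‖avg (Y (t + 1)) - ys (avg (X (t + 1)))‖ ^ 2 ≤
      (1 - γ * μ / 2) * ‖avg (Y t) - ys (avg (X t))‖ ^ 2 + 6 / (γ * μ) * (γ ^ 2 *
        (2 * ‖avg (V t) - avg (fun k => G k (X t k, Y t k, Z t k))‖ ^ 2 +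
          2 * (L ^ 2 * (msq (dev (X t)) + msq (dev (Y t)) + msq (dev (Z t)))))
        + L ^ 2 * ((η * β₁) ^ 2 * ‖avg (U t)‖ ^ 2)) := by
    intro t
    have e1 : avg (X (t + 1)) = avg (X t) - (η * β₁) • avg (U t) := by
      rw [avg_relaxed_step hE (h.stepX t), avg_tracker hE h.trackP h.initP]
    have e2 : avg (Y (t + 1)) = avg (Y t) - γ • avg (V t) := by
      rw [avg_relaxed_step hE (h.stepY t), avg_tracker hE h.trackQ h.initQ]
    have hzt : ‖avg (Z t)‖ ≤ ρ := by
      have hρ : 0 ≤ ρ := (norm_nonneg _).trans hz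
      have h2 := sq_norm_avg_le hK (Z t)
      have h3 : msq (Z t) ≤ ρ ^ 2 := by
        have : msq (Z t) ≤ msq (fun _ : Fin K => ρ) := msq_mono_of fun k => by
          rw [Real.norm_of_nonneg hρ]; have := h.ball h0.le h1 hz t k; gcongr
        rwa [msq_const hK, Real.norm_of_nonneg hρ] at this
      exact le_of_sq_le_sq (h2.trans h3) hρ
    have hm := l.monoG (avg (X t)) (avg (Y t)) (ys (avg (X t))) (avg (Z t))
    rw [l.zeroG, sub_zero] at hm
    have hl := sq_norm_avg_sub_avg_le hK l.lipG (X := fun _ => avg (X t)) (Y := fun _ => avg (Y t))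
      (Z := fun _ => avg (Z t)) (x := avg (X t)) (y := ys (avg (X t))) (z := avg (Z t))
      (fun _ => hzt) hzt
    rw [l.zeroG, sub_zero, msq_const hK, msq_const hK, msq_const hK, sub_self, sub_self, norm_zero,
      norm_zero] at hl
    have b := sq_norm_estimator_sub_le hK l.lipG (X := X t) (Y := Y t) (Z := Z t)
      (x := avg (X t)) (y := avg (Y t)) (z := avg (Z t)) (h.ball h0.le h1 hz t) hzt (avg (V t))
    have key := sq_norm_inexact_step_le (a := avg (Y t) - ys (avg (X t)))
      (g := avg fun k => G k (avg (X t), avg (Y t), avg (Z t)))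
      (e := avg (V t) - avg fun k => G k (avg (X t), avg (Y t), avg (Z t)))
      (d := ys (avg (X t)) - ys (avg (X (t + 1)))) hm (by linarith) hγ0 hμ hγL hγμ
    have e3 : avg (Y t) - ys (avg (X t)) - γ • ((avg fun k => G k (avg (X t), avg (Y t), avg (Z t)))
        + (avg (V t) - avg fun k => G k (avg (X t), avg (Y t), avg (Z t))))
        + (ys (avg (X t)) - ys (avg (X (t + 1)))) = avg (Y (t + 1)) - ys (avg (X (t + 1))) := by
      rw [e2, add_sub_cancel]; abel
    have hd := l.lip_ys (avg (X t)) (avg (X (t + 1)))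
    rw [e1, sub_sub_cancel, norm_smul, mul_pow, Real.norm_eq_abs, sq_abs, ← e1] at hd
    rw [e3] at key
    refine key.trans ?_
    gcongr
    exact b
  have hs := sum_le_of_recursion (a := fun t => ‖avg (Y t) - ys (avg (X t))‖ ^ 2)
    (q := γ * μ / 2) (fun t => by positivity) T (fun t _ => step t)
  have hX0 : avg (X 0) = x₀ := by
    rw [show X 0 = fun _ => x₀ from funext h.initX, avg_const hK]
  have hY0 : avg (Y 0) = y₀ := by
    rw [show Y 0 = fun _ => y₀ from funext h.initY, avg_const hK]
  rw [hX0, hY0, ← Finset.mul_sum, Finset.sum_add_distrib, ← Finset.mul_sum, ← Finset.mul_sum,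
    ← Finset.mul_sum] at hs
  set A := ∑ t ∈ Finset.range T, (2 * ‖avg (V t) - avg (fun k => G k (X t k, Y t k, Z t k))‖ ^ 2 +
          2 * (L ^ 2 * (msq (dev (X t)) + msq (dev (Y t)) + msq (dev (Z t)))))
  set C := ∑ t ∈ Finset.range T, ‖avg (U t)‖ ^ 2
  have hq : 0 < γ * μ / 2 := by positivity
  have := (le_div_iff₀' hq).2 hs
  refine this.trans (le_of_eq ?_)
  rw [hγ]
  field_simp
  ring

/-- One step of the variables `z` towards the current Hessian-inverse-vector product. -/
lemma adjoint_fixed_target_le (hE : IsMixing E) (hK : 0 < K) (hL : 1 ≤ L) (hμ : 0 < μ) (hμ1 : μ ≤ 1)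
    (h0 : 0 < η) (h1 : η ≤ 1) (hz : ‖z₀‖ ≤ ρ) (hβ : 0 < β₃) (hβL : β₃ * L ^ 2 ≤ μ) (t : ℕ) :
    msq (fun k => Z (t + 1) k - zs (avg (X t))) ≤
      (1 - η * β₃ * μ / 2) * msq (fun k => Z t k - zs (avg (X t))) + η * (6 * β₃ / μ *
        (2 * ‖avg (W t) - avg (fun k => H k (X t k, Y t k, Z t k))‖ ^ 2 +
          2 * (L ^ 2 * (msq (dev (X t)) + (msq (dev (Y t)) + ‖avg (Y t) - ys (avg (X t))‖ ^ 2) +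
            msq (dev (Z t))))) +
        (2 * msq (dev (Z t)) + 2 * β₃ ^ 2 * msq (dev (R t)))) := by
  have hρ : 0 ≤ ρ := (norm_nonneg _).trans hz
  have hL2 : 1 ≤ L ^ 2 := by nlinarith
  have hβ1 : β₃ ≤ 1 := by nlinarith
  have hβμ : β₃ * μ ≤ 1 := by nlinarith
  set D := msq (fun k => Z t k - zs (avg (X t))) with hD
  set Er := (2 * ‖avg (W t) - avg (fun k => H k (X t k, Y t k, Z t k))‖ ^ 2 +
        2 * (L ^ 2 * (msq (dev (X t)) + (msq (dev (Y t)) + ‖avg (Y t) - ys (avg (X t))‖ ^ 2) +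
          msq (dev (Z t))))) with hEr
  have hzt : ‖avg (Z t)‖ ≤ ρ := by
    have h2 := sq_norm_avg_le hK (Z t)
    have h3 : msq (Z t) ≤ ρ ^ 2 := by
      have : msq (Z t) ≤ msq (fun _ : Fin K => ρ) := msq_mono_of fun k => by
        rw [Real.norm_of_nonneg hρ]; have := h.ball h0.le h1 hz t k; gcongr
      rwa [msq_const hK, Real.norm_of_nonneg hρ] at this
    exact le_of_sq_le_sq (h2.trans h3) hρ
  have hDdec : D = msq (dev (Z t)) + ‖avg (Z t) - zs (avg (X t))‖ ^ 2 := msq_sub_const hK _ _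
  -- the unprojected step
  set A : Fin K → Vec dy := fun k => mixV E (Z t) k - β₃ • R t k with hA
  have eA : avg A = avg (Z t) - β₃ • avg (W t) := by
    rw [hA, avg_sub, avg_smul, avg_mixV hE, avg_tracker hE h.trackR h.initR]
  have hdevA : msq (dev A) ≤ 2 * msq (dev (Z t)) + 2 * β₃ ^ 2 * msq (dev (R t)) := by
    have e : dev A = fun k => mixV E (dev (Z t)) k - β₃ • dev (R t) k := by
      rw [hA, dev_sub, dev_smul, dev_mixV hE]
    have h2 := msq_sub_le (mixV E (dev (Z t))) (fun k => β₃ • dev (R t) k)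
    rw [← e, msq_smul] at h2
    have h3 := msq_mixV_dev_le hE hK (Z t)
    have h4 : lam E ^ 2 ≤ 1 := by nlinarith [lam_nonneg E, hE.gap]
    nlinarith [msq_nonneg (dev (Z t))]
  have hm := l.monoH (avg (X t)) (ys (avg (X t))) (avg (Z t)) (zs (avg (X t)))
  rw [l.zeroH, sub_zero] at hm
  have hl := sq_norm_avg_sub_avg_le hK l.lipH (X := fun _ => avg (X t))
    (Y := fun _ => ys (avg (X t))) (Z := fun _ => avg (Z t)) (x := avg (X t))
    (y := ys (avg (X t))) (z := zs (avg (X t))) (fun _ => hzt) (l.ball _)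
  rw [l.zeroH, sub_zero, msq_const hK, msq_const hK, msq_const hK, sub_self, sub_self, norm_zero,
    norm_zero] at hl
  have b := sq_norm_estimator_sub_le hK l.lipH (X := X t) (Y := Y t) (Z := Z t)
    (x := avg (X t)) (y := ys (avg (X t))) (z := avg (Z t)) (h.ball h0.le h1 hz t) hzt (avg (W t))
  rw [msq_sub_const hK (X t), msq_sub_const hK (Y t), msq_sub_const hK (Z t), sub_self, sub_self,
    norm_zero, norm_zero] at b
  have key := sq_norm_inexact_step_le (a := avg (Z t) - zs (avg (X t)))
    (g := avg fun k => H k (avg (X t), ys (avg (X t)), avg (Z t)))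
    (e := avg (W t) - avg fun k => H k (avg (X t), ys (avg (X t)), avg (Z t)))
    (d := 0) hm (by linarith) hβ hμ hβL hβμ
  have e3 : avg (Z t) - zs (avg (X t)) -
      β₃ • ((avg fun k => H k (avg (X t), ys (avg (X t)), avg (Z t)))
      + (avg (W t) - avg fun k => H k (avg (X t), ys (avg (X t)), avg (Z t)))) + 0
      = avg A - zs (avg (X t)) := by
    rw [eA, add_sub_cancel]; abel
  rw [e3, norm_zero] at key
  have hA2 : msq (fun k => A k - zs (avg (X t))) ≤ (1 - β₃ * μ / 2) * D + (6 * β₃ / μ * Er +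
      (2 * msq (dev (Z t)) + 2 * β₃ ^ 2 * msq (dev (R t)))) := by
    rw [msq_sub_const hK]
    have c1 : 6 / (β₃ * μ) * (β₃ ^ 2 * ‖avg (W t) -
        avg fun k => H k (avg (X t), ys (avg (X t)), avg (Z t))‖ ^ 2 + 0 ^ 2)
        ≤ 6 * β₃ / μ * Er := by
      calc _ = 6 * β₃ / μ * ‖avg (W t) -
        avg fun k => H k (avg (X t), ys (avg (X t)), avg (Z t))‖ ^ 2 := by field_simp; ring
        _ ≤ _ := by gcongr; rw [hEr]; refine b.trans (le_of_eq ?_); ring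
    have c2 : (1 - β₃ * μ / 2) * ‖avg (Z t) - zs (avg (X t))‖ ^ 2 ≤ (1 - β₃ * μ / 2) * D := by
      have := msq_nonneg (dev (Z t))
      exact mul_le_mul_of_nonneg_left (by linarith) (by linarith)
    linarith
  -- the relaxed projected step, with the target fixed
  have c1 : msq (fun k => Z (t + 1) k - zs (avg (X t))) ≤
      (1 - η) * D + η * msq (fun k => A k - zs (avg (X t))) := by
    refine msq_le_comb fun k => ?_
    have e : Z (t + 1) k - zs (avg (X t)) = (1 - η) • (Z t k - zs (avg (X t))) +
        η • (projBall ρ (A k) - zs (avg (X t))) := by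
      rw [h.stepZ]; module
    rw [e]
    refine (sq_norm_convex _ _ h0.le h1).trans ?_
    have c : ‖projBall ρ (A k) - zs (avg (X t))‖ ≤ ‖A k - zs (avg (X t))‖ := by
      have := norm_projBall_sub_le hρ (A k) (zs (avg (X t)))
      rwa [projBall_of_le (l.ball _)] at this
    gcongr
  nlinarith

/-- One step of the variables `z`, including the drift of their target. -/
lemma adjoint_step_le (hE : IsMixing E) (hK : 0 < K) (hL : 1 ≤ L) (hμ : 0 < μ) (hμ1 : μ ≤ 1)
    (h0 : 0 < η) (h1 : η ≤ 1) (hz : ‖z₀‖ ≤ ρ) (hβ : 0 < β₃) (hβL : β₃ * L ^ 2 ≤ μ) (t : ℕ) :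
    msq (fun k => Z (t + 1) k - zs (avg (X (t + 1)))) ≤
      (1 - η * β₃ * μ / 4) * msq (fun k => Z t k - zs (avg (X t))) + (2 * η * (6 * β₃ / μ *
        (2 * ‖avg (W t) - avg (fun k => H k (X t k, Y t k, Z t k))‖ ^ 2 +
          2 * (L ^ 2 * (msq (dev (X t)) + (msq (dev (Y t)) + ‖avg (Y t) - ys (avg (X t))‖ ^ 2) +
            msq (dev (Z t))))) + (2 * msq (dev (Z t)) + 2 * β₃ ^ 2 * msq (dev (R t)))) +
        8 / (η * β₃ * μ) * (L ^ 2 * ((η * β₁) ^ 2 * ‖avg (U t)‖ ^ 2))) := by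
  have hρ : 0 ≤ ρ := (norm_nonneg _).trans hz
  have hL2 : 1 ≤ L ^ 2 := by nlinarith
  have hβ1 : β₃ ≤ 1 := by nlinarith
  have hβμ : β₃ * μ ≤ 1 := by nlinarith
  have hZ' := adjoint_fixed_target_le l h hE hK hL hμ hμ1 h0 h1 hz hβ hβL t
  set D := msq (fun k => Z t k - zs (avg (X t))) with hD
  set Er := (2 * ‖avg (W t) - avg (fun k => H k (X t k, Y t k, Z t k))‖ ^ 2 +
          2 * (L ^ 2 * (msq (dev (X t)) + (msq (dev (Y t)) + ‖avg (Y t) - ys (avg (X t))‖ ^ 2) +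
            msq (dev (Z t))))) with hEr
  have e1 : avg (X (t + 1)) = avg (X t) - (η * β₁) • avg (U t) := by
    rw [avg_relaxed_step hE (h.stepX t), avg_tracker hE h.trackP h.initP]
  -- the drift of the target
  set θ := η * β₃ * μ / 4 with hθ
  have hθ0 : 0 < θ := by positivity
  have hθ1 : θ ≤ 1 := by
    have : η * (β₃ * μ) ≤ 1 := mul_le_one₀ h1 (by positivity) hβμ
    rw [hθ]; linarith
  have hd := l.lip_zs (avg (X t)) (avg (X (t + 1)))
  rw [e1, sub_sub_cancel, norm_smul, mul_pow, Real.norm_eq_abs, sq_abs, ← e1] at hd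
  have hy : msq (fun k => Z (t + 1) k - zs (avg (X (t + 1)))) ≤
      (1 + θ) * msq (fun k => Z (t + 1) k - zs (avg (X t))) +
      (1 + 1 / θ) * msq (fun _ : Fin K => zs (avg (X t)) - zs (avg (X (t + 1)))) := by
    refine msq_le_comb fun k => ?_
    have := sq_norm_add_le_young (Z (t + 1) k - zs (avg (X t)))
      (zs (avg (X t)) - zs (avg (X (t + 1)))) hθ0
    rwa [sub_add_sub_cancel] at this
  rw [msq_const hK] at hy
  have f1 : (1 + 1 / θ) ≤ 8 / (η * β₃ * μ) := by
    rw [show 8 / (η * β₃ * μ) = 2 / θ by rw [hθ]; field_simp; norm_num,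
      show 1 + 1 / θ = (θ + 1) / θ by field_simp]
    gcongr; linarith
  have hS0 : 0 ≤ 6 * β₃ / μ * Er + (2 * msq (dev (Z t)) + 2 * β₃ ^ 2 * msq (dev (R t))) := by
    have := msq_nonneg (dev (X t)); have := msq_nonneg (dev (Y t))
    have := msq_nonneg (dev (Z t)); have := msq_nonneg (dev (R t))
    positivity
  have hD0 : 0 ≤ D := msq_nonneg _
  have f2 : (1 + θ) * msq (fun k => Z (t + 1) k - zs (avg (X t))) ≤ (1 - θ) * D +
      2 * η * (6 * β₃ / μ * Er + (2 * msq (dev (Z t)) + 2 * β₃ ^ 2 * msq (dev (R t)))) := by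
    have e : η * β₃ * μ / 2 = 2 * θ := by rw [hθ]; ring
    rw [e] at hZ'
    set S := 6 * β₃ / μ * Er + (2 * msq (dev (Z t)) + 2 * β₃ ^ 2 * msq (dev (R t)))
    calc _ ≤ (1 + θ) * ((1 - 2 * θ) * D + η * S) := by gcongr
      _ = ((1 + θ) * (1 - 2 * θ)) * D + (1 + θ) * (η * S) := by ring
      _ ≤ (1 - θ) * D + 2 * (η * S) := by
        gcongr
        · nlinarith
        · linarith
      _ = _ := by ring
  have f3 : (1 + 1 / θ) * ‖zs (avg (X t)) - zs (avg (X (t + 1)))‖ ^ 2 ≤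
      8 / (η * β₃ * μ) * (L ^ 2 * ((η * β₁) ^ 2 * ‖avg (U t)‖ ^ 2)) := by gcongr
  linarith

/-- Tracking of the Hessian-inverse-vector product by the variables `z` of the workers. -/
lemma adjoint_sum_le (hE : IsMixing E) (hK : 0 < K) (hL : 1 ≤ L) (hμ : 0 < μ) (hμ1 : μ ≤ 1)
    (h0 : 0 < η) (h1 : η ≤ 1) (hz : ‖z₀‖ ≤ ρ) (hβ : 0 < β₃) (hβL : β₃ * L ^ 2 ≤ μ) (T : ℕ) :
    ∑ t ∈ Finset.range T, msq (fun k => Z t k - zs (avg (X t))) ≤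
      4 / (η * β₃ * μ) * ‖z₀ - zs x₀‖ ^ 2 + 48 / μ ^ 2 * ∑ t ∈ Finset.range T,
        (2 * ‖avg (W t) - avg (fun k => H k (X t k, Y t k, Z t k))‖ ^ 2 +
          2 * (L ^ 2 * (msq (dev (X t)) + (msq (dev (Y t)) + ‖avg (Y t) - ys (avg (X t))‖ ^ 2) +
            msq (dev (Z t))))) +
      16 / μ * ((∑ t ∈ Finset.range T, msq (dev (Z t))) / β₃ +
        β₃ * ∑ t ∈ Finset.range T, msq (dev (R t))) +
      32 * L ^ 2 / μ ^ 2 * (β₁ / β₃) ^ 2 * ∑ t ∈ Finset.range T, ‖avg (U t)‖ ^ 2 := by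
  have hs := sum_le_of_recursion (a := fun t => msq (fun k => Z t k - zs (avg (X t))))
    (q := η * β₃ * μ / 4) (fun t => msq_nonneg _) T 
    (fun t _ => adjoint_step_le l h hE hK hL hμ hμ1 h0 h1 hz hβ hβL t)
  have hX0 : avg (X 0) = x₀ := by
    rw [show X 0 = fun _ => x₀ from funext h.initX, avg_const hK]
  have hZ0 : msq (fun k => Z 0 k - zs (avg (X 0))) = ‖z₀ - zs x₀‖ ^ 2 := by
    simp only [h.initZ, hX0, msq_const hK]
  rw [hZ0] at hs
  have hq : 0 < η * β₃ * μ / 4 := by positivity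
  have := (le_div_iff₀' hq).2 hs
  refine this.trans (le_of_eq ?_)
  simp only [Finset.sum_add_distrib, ← Finset.mul_sum]
  field_simp
  ring

omit l h in
/-- Total movement of a variable in terms of consensus errors and of the averaged estimators. -/
lemma sum_move_le (hE : IsMixing E) (hK : 0 < K) {n : ℕ} {β : ℝ} {X P U : ℕ → Fin K → Vec n}
    (h : ∀ t k, ‖X (t + 1) k - X t k‖ ≤ |η| * ‖mixV E (X t) k - β • P t k - X t k‖)
    (hP : ∀ t, avg (P t) = avg (U t)) (T : ℕ) :
    ∑ t ∈ Finset.range T, msq (fun k => X (t + 1) k - X t k) ≤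
      η ^ 2 * (8 * ∑ t ∈ Finset.range T, msq (dev (X t)) +
        2 * β ^ 2 * ∑ t ∈ Finset.range T, msq (dev (P t)) +
        2 * β ^ 2 * ∑ t ∈ Finset.range T, ‖avg (U t)‖ ^ 2) := by
  simp only [Finset.mul_sum, ← Finset.sum_add_distrib]
  refine Finset.sum_le_sum fun t _ => ?_
  have := msq_step_le hE hK (h t)
  rwa [hP] at this

set_option maxHeartbeats 800000 in
/-- Deterministic part of the analysis: sums of squared gradients and of movements in terms of the
estimation errors and of the consensus errors of the trackers. -/
theorem trajectory_bounds (hE : IsMixing E) (hK : 0 < K) (hL : 1 ≤ L) (hμ : 0 < μ) (hμ1 : μ ≤ 1)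
    (h0 : 0 < η) (h1 : η ≤ 1) (hz : ‖z₀‖ ≤ ρ) {b r : ℝ} (hβ₁ : 0 < β₁) (hβ₂ : 0 < β₂)
    (hβ₃ : 0 < β₃) (hb₂ : β₂ ≤ b) (hb₃ : β₃ ≤ b) (hr₂ : β₁ ≤ r * β₂) (hr₃ : β₁ ≤ r * β₃)
    (hr1 : r ≤ 1) (hb : 8 * L ^ 2 * b ≤ μ)
    (hr : 16 * (300 * L ^ 2 / μ ^ 2) ^ 3 * r ^ 2 ≤ 1)
    {ΔF : ℝ} (hF : ∀ x, F x₀ - F x ≤ ΔF) (T : ℕ) {Er M I : ℝ}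
    (hEr : Er = ∑ t ∈ Finset.range T,
      estErr G H Rh (fun k => (X t k, Y t k, Z t k)) (U t) (V t) (W t))
    (hM : M = β₁ ^ 2 / (1 - lam E) ^ 2 * ∑ t ∈ Finset.range T, msq (dev (P t)) +
      β₂ ^ 2 / (1 - lam E) ^ 2 * ∑ t ∈ Finset.range T, msq (dev (Q t)) +
      β₃ / (1 - lam E) ^ 2 * ∑ t ∈ Finset.range T, msq (dev (R t)))
    (hI : I = 2 * ΔF / (η * β₁) + 2 / (η * β₂ * μ) * ‖y₀ - ys x₀‖ ^ 2 +
      4 / (η * β₃ * μ) * ‖z₀ - zs x₀‖ ^ 2) :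
    ∑ t ∈ Finset.range T, ‖avg (fun k => Rh k (avg (X t), ys (avg (X t)), zs (avg (X t))))‖ ^ 2 ≤
      4 * (300 * L ^ 2 / μ ^ 2) ^ 3 * (I + Er + M) ∧
    ∑ t ∈ Finset.range T, move (fun k => (X t k, Y t k, Z t k))
      (fun k => (X (t + 1) k, Y (t + 1) k, Z (t + 1) k)) ≤
      η ^ 2 * (24 * (300 * L ^ 2 / μ ^ 2) ^ 4 * (M + b ^ 2 * (I + Er + M))) := by
  have hρ : 0 ≤ ρ := (norm_nonneg _).trans hz
  have hb0 : 0 < b := hβ₂.trans_le hb₂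
  have hs : 0 < 1 - lam E := by linarith [hE.gap]
  have hs1 : 1 - lam E ≤ 1 := by linarith [lam_nonneg E]
  have hL2 : 1 ≤ L ^ 2 := one_le_pow₀ hL
  have hLb : b ≤ L ^ 2 * b := le_mul_of_one_le_left hb0.le hL2
  have hb1 : b ≤ 1 := by linarith
  have hr2' : β₁ / β₂ ≤ r := by rwa [div_le_iff₀ hβ₂]
  have hr3' : β₁ / β₃ ≤ r := by rwa [div_le_iff₀ hβ₃]
  have hβ₁b : β₁ ≤ b := (hr₂.trans (mul_le_of_le_one_left hβ₂.le hr1)).trans hb₂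
  have g1 : 8 * L ^ 2 * β₁ ≤ 1 := by
    have : L ^ 2 * β₁ ≤ L ^ 2 * b := by gcongr
    linarith
  have g2 : β₂ * L ^ 2 ≤ μ := by
    have : β₂ * L ^ 2 ≤ b * L ^ 2 := by gcongr
    linarith
  have g3 : β₃ * L ^ 2 ≤ μ := by
    have : β₃ * L ^ 2 ≤ b * L ^ 2 := by gcongr
    linarith
  -- total consensus errors
  have cX := sum_dev_le_of_step hE hK h0 h1 h.stepX
    (fun t => msq_dev_mixV_sub_le hE hK (X t) (P t)) h.initX T
  have cY := sum_dev_le_of_step hE hK h0 h1 h.stepY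
    (fun t => msq_dev_mixV_sub_le hE hK (Y t) (Q t)) h.initY T
  have cZ := sum_dev_le_of_step hE hK h0 h1 h.stepZ
    (fun t => (msq_dev_projBall_le hK hρ _).trans (msq_dev_mixV_sub_le hE hK (Z t) (R t))) h.initZ T
  have dsum := descent_sum_le l h hE hK hL h0 h1 hz hβ₁ g1 hF T
  have ysum := lower_sum_le l h hE hK hL hμ hμ1 h0 h1 hz hβ₂ g2 T
  have zsum := adjoint_sum_le l h hE hK hL hμ hμ1 h0 h1 hz hβ₃ g3 T
  have mX := sum_move_le hE hK (β := β₁) (X := X) (P := P) (U := U)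
    (fun t k => by rw [h.stepX, add_sub_cancel_left, norm_smul, Real.norm_eq_abs])
    (avg_tracker hE h.trackP h.initP) T
  have mY := sum_move_le hE hK (β := β₂) (X := Y) (P := Q) (U := V)
    (fun t k => by rw [h.stepY, add_sub_cancel_left, norm_smul, Real.norm_eq_abs])
    (avg_tracker hE h.trackQ h.initQ) T
  have mZ := sum_move_le hE hK (β := β₃) (X := Z) (P := R) (U := W)
    (fun t k => by
      rw [h.stepZ, add_sub_cancel_left, norm_smul, Real.norm_eq_abs]
      have := norm_projBall_sub_le hρ (mixV E (Z t) k - β₃ • R t k) (Z t k)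
      rw [projBall_of_le (h.ball h0.le h1 hz t k)] at this
      gcongr)
    (avg_tracker hE h.trackR h.initR) T
  -- the averaged estimators for `y` and `z` are small near the solution
  have hV : ∀ t, ‖avg (V t)‖ ^ 2 ≤ 2 * ‖avg (V t) - avg (fun k => G k (X t k, Y t k, Z t k))‖ ^ 2 +
      2 * (L ^ 2 * (msq (dev (X t)) + (msq (dev (Y t)) + ‖avg (Y t) - ys (avg (X t))‖ ^ 2) +
        msq (fun k => Z t k - zs (avg (X t))))) := by
    intro t
    have b := sq_norm_estimator_sub_le hK l.lipG (X := X t) (Y := Y t) (Z := Z t)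
      (x := avg (X t)) (y := ys (avg (X t))) (z := zs (avg (X t)))
      (h.ball h0.le h1 hz t) (l.ball _) (avg (V t))
    rwa [l.zeroG, sub_zero, msq_sub_const hK (X t), msq_sub_const hK (Y t), sub_self, norm_zero,
      zero_pow two_ne_zero, add_zero] at b
  have hW : ∀ t, ‖avg (W t)‖ ^ 2 ≤ 2 * ‖avg (W t) - avg (fun k => H k (X t k, Y t k, Z t k))‖ ^ 2 +
      2 * (L ^ 2 * (msq (dev (X t)) + (msq (dev (Y t)) + ‖avg (Y t) - ys (avg (X t))‖ ^ 2) +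
        msq (fun k => Z t k - zs (avg (X t))))) := by
    intro t
    have b := sq_norm_estimator_sub_le hK l.lipH (X := X t) (Y := Y t) (Z := Z t)
      (x := avg (X t)) (y := ys (avg (X t))) (z := zs (avg (X t)))
      (h.ball h0.le h1 hz t) (l.ball _) (avg (W t))
    rwa [l.zeroH, sub_zero, msq_sub_const hK (X t), msq_sub_const hK (Y t), sub_self, norm_zero,
      zero_pow two_ne_zero, add_zero] at b
  have hVs := Finset.sum_le_sum fun t (_ : t ∈ Finset.range T) => hV t
  have hWs := Finset.sum_le_sum fun t (_ : t ∈ Finset.range T) => hW t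
  have hmove : ∑ t ∈ Finset.range T, move (fun k => (X t k, Y t k, Z t k))
      (fun k => (X (t + 1) k, Y (t + 1) k, Z (t + 1) k)) =
      ∑ t ∈ Finset.range T, msq (fun k => X (t + 1) k - X t k) +
      ∑ t ∈ Finset.range T, msq (fun k => Y (t + 1) k - Y t k) +
      ∑ t ∈ Finset.range T, msq (fun k => Z (t + 1) k - Z t k) := by
    simp only [move, sqDist, msq, Finset.sum_add_distrib, mul_add]
  rw [hmove]
  simp only [estErr, Finset.sum_add_distrib] at hEr
  simp only [Finset.sum_add_distrib, ← Finset.mul_sum] at dsum ysum zsum hVs hWs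
  have nn : ∀ a : ℕ → ℝ, (∀ t, 0 ≤ a t) → 0 ≤ ∑ t ∈ Finset.range T, a t :=
    fun a ha => Finset.sum_nonneg fun t _ => ha t
  have pG := nn _ fun t => sq_nonneg
    ‖avg (fun k => Rh k (avg (X t), ys (avg (X t)), zs (avg (X t))))‖
  have pU := nn _ fun t => sq_nonneg ‖avg (U t)‖
  have pcP := nn _ fun t => msq_nonneg (dev (P t))
  have pcQ := nn _ fun t => msq_nonneg (dev (Q t))
  have pcR := nn _ fun t => msq_nonneg (dev (R t))
  have pcX := nn _ fun t => msq_nonneg (dev (X t))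
  have pcY := nn _ fun t => msq_nonneg (dev (Y t))
  have pcZ := nn _ fun t => msq_nonneg (dev (Z t))
  have pNY := nn _ fun t => sq_nonneg ‖avg (Y t) - ys (avg (X t))‖
  have pNZ := nn _ fun t => msq_nonneg (fun k => Z t k - zs (avg (X t)))
  have peu := nn _ fun t => sq_nonneg ‖avg (U t) - avg (fun k => Rh k (X t k, Y t k, Z t k))‖
  have pev := nn _ fun t => sq_nonneg ‖avg (V t) - avg (fun k => G k (X t k, Y t k, Z t k))‖
  have pew := nn _ fun t => sq_nonneg ‖avg (W t) - avg (fun k => H k (X t k, Y t k, Z t k))‖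
  have hy0 : 0 ≤ ‖y₀ - ys x₀‖ ^ 2 := by positivity
  have hz0 : 0 ≤ ‖z₀ - zs x₀‖ ^ 2 := by positivity
  have hΔ : 0 ≤ ΔF := by have := hF x₀; linarith
  exact trajectory_bounds_arith hL hμ hμ1 h0 hβ₁ hβ₂ hβ₃ hβ₁b hb₂ hb₃ hb1 hr2' hr3' hr hs hs1 hΔ hy0
    hz0 pG pU pcP pcQ pcR pcX pcY pcZ pNY pNZ peu pev pew hEr hM hI cX cY cZ dsum ysum zsum hVs hWs
    mX mY mZ

end Bounds

/-! ### Conditionally centred noise -/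

section Noise

variable {Ω S : Type*} [MeasurableSpace Ω] [MeasurableSpace S] {Pr : Measure Ω}
  {n : ℕ}

lemma integrable_inner_of_memLp {f g : Ω → Vec n} (hf : MemLp f 2 Pr) (hg : MemLp g 2 Pr) :
    Integrable (fun ω => ⟪f ω, g ω⟫) Pr := by
  have h1 := (memLp_two_iff_integrable_sq_norm hf.1).1 hf
  have h2 := (memLp_two_iff_integrable_sq_norm hg.1).1 hg
  refine (h1.add h2).mono (hf.1.inner hg.1) (Filter.Eventually.of_forall fun ω => ?_)
  have h3 := abs_real_inner_le_norm (f ω) (g ω)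
  rw [Real.norm_eq_abs, Real.norm_eq_abs, Pi.add_apply,
    abs_of_nonneg (by positivity : 0 ≤ ‖f ω‖ ^ 2 + ‖g ω‖ ^ 2)]
  nlinarith [sq_nonneg (‖f ω‖ - ‖g ω‖), sq_nonneg ‖f ω‖, sq_nonneg ‖g ω‖]

lemma integrable_sq_of_memLp {f : Ω → Vec n} (hf : MemLp f 2 Pr) :
    Integrable (fun ω => ‖f ω‖ ^ 2) Pr := (memLp_two_iff_integrable_sq_norm hf.1).1 hf

/-- Pythagoras' theorem for sums of uncorrelated random vectors. -/
lemma integral_sq_norm_add_sum {ι : Type*} (J : Finset ι) {A : Ω → Vec n} {N : ι → Ω → Vec n}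
    (hA : MemLp A 2 Pr) (hN : ∀ j ∈ J, MemLp (N j) 2 Pr)
    (hAN : ∀ j ∈ J, ∫ ω, ⟪A ω, N j ω⟫ ∂Pr = 0)
    (hNN : ∀ i ∈ J, ∀ j ∈ J, i ≠ j → ∫ ω, ⟪N i ω, N j ω⟫ ∂Pr = 0) :
    ∫ ω, ‖A ω + ∑ j ∈ J, N j ω‖ ^ 2 ∂Pr = ∫ ω, ‖A ω‖ ^ 2 ∂Pr + ∑ j ∈ J, ∫ ω, ‖N j ω‖ ^ 2 ∂Pr := by
  classical
  induction J using Finset.induction_on with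
  | empty => simp
  | insert j J hj ih =>
    have ih' := ih (fun i hi => hN i (Finset.mem_insert_of_mem hi))
      (fun i hi => hAN i (Finset.mem_insert_of_mem hi))
      (fun i hi k hk => hNN i (Finset.mem_insert_of_mem hi) k (Finset.mem_insert_of_mem hk))
    have hNj := hN j (Finset.mem_insert_self _ _)
    have hsum : MemLp (fun ω => ∑ i ∈ J, N i ω) 2 Pr :=
      memLp_finsetSum J fun i hi => hN i (Finset.mem_insert_of_mem hi)
    have hA' : MemLp (fun ω => A ω + ∑ i ∈ J, N i ω) 2 Pr := hA.add hsum
    have hcross : ∫ ω, ⟪A ω + ∑ i ∈ J, N i ω, N j ω⟫ ∂Pr = 0 := by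
      simp only [inner_add_left, sum_inner]
      have hi : ∀ i ∈ J, Integrable (fun ω => ⟪N i ω, N j ω⟫) Pr := fun i hi =>
        integrable_inner_of_memLp (hN i (Finset.mem_insert_of_mem hi)) hNj
      rw [integral_add (integrable_inner_of_memLp hA hNj) (integrable_finsetSum _ hi),
        integral_finsetSum _ hi, hAN j (Finset.mem_insert_self _ _), zero_add]
      refine Finset.sum_eq_zero fun i hi => hNN i (Finset.mem_insert_of_mem hi) j
        (Finset.mem_insert_self _ _) ?_
      rintro rfl; exact hj ‹_›
    have e : ∀ ω, ‖A ω + ∑ i ∈ insert j J, N i ω‖ ^ 2 = ‖A ω + ∑ i ∈ J, N i ω‖ ^ 2 +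
        2 * ⟪A ω + ∑ i ∈ J, N i ω, N j ω⟫ + ‖N j ω‖ ^ 2 := fun ω => by
      rw [Finset.sum_insert hj, ← norm_add_sq_real]
      congr 2; abel
    simp only [e]
    rw [integral_add _ (integrable_sq_of_memLp hNj), integral_add (integrable_sq_of_memLp hA'),
      integral_const_mul, hcross, ih', Finset.sum_insert hj]
    · ring
    · exact (integrable_inner_of_memLp hA' hNj).const_mul 2
    · exact (integrable_sq_of_memLp hA').add ((integrable_inner_of_memLp hA' hNj).const_mul 2)

/-- Conditionally centred noise is uncorrelated with whatever is independent of its sample. -/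
lemma integral_inner_noise_eq_zero [IsProbabilityMeasure Pr] {M : Type*} [MeasurableSpace M]
    {A : Ω → Vec n} {X : Ω → M}
    {s : Ω → S} {f : M × S → Vec n} (hf : Measurable f) (hA : Measurable A) (hX : Measurable X)
    (hs : Measurable s) (hind : IndepFun (fun ω => (A ω, X ω)) s Pr) (hA2 : MemLp A 2 Pr)
    (hf2 : MemLp (fun ω => f (X ω, s ω)) 2 Pr)
    (hint : ∀ m, Integrable (fun ω => f (m, s ω)) Pr) (hzero : ∀ m, ∫ ω, f (m, s ω) ∂Pr = 0) :
    ∫ ω, ⟪A ω, f (X ω, s ω)⟫ ∂Pr = 0 := by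
  have hAX : Measurable fun ω => (A ω, X ω) := hA.prodMk hX
  have hmap := (indepFun_iff_map_prod_eq_prod_map_map hAX.aemeasurable hs.aemeasurable).1 hind
  have := Measure.isProbabilityMeasure_map (μ := Pr) hAX.aemeasurable
  have := Measure.isProbabilityMeasure_map (μ := Pr) hs.aemeasurable
  set φ : (Vec n × M) × S → ℝ := fun p => ⟪p.1.1, f (p.1.2, p.2)⟫ with hφ
  have hφm : Measurable φ := by
    have h1 : Measurable fun p : (Vec n × M) × S => p.1.1 := by fun_prop
    have h2 : Measurable fun p : (Vec n × M) × S => f (p.1.2, p.2) := by fun_prop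
    exact h1.inner h2
  have hAXs : Measurable fun ω => ((A ω, X ω), s ω) := hAX.prodMk hs
  have hφi : Integrable φ ((Pr.map fun ω => (A ω, X ω)).prod (Pr.map s)) := by
    rw [← hmap, integrable_map_measure hφm.aestronglyMeasurable hAXs.aemeasurable]
    exact integrable_inner_of_memLp hA2 hf2
  have e : ∫ ω, ⟪A ω, f (X ω, s ω)⟫ ∂Pr = ∫ p, φ p ∂(Pr.map fun ω => ((A ω, X ω), s ω)) := by
    rw [integral_map hAXs.aemeasurable hφm.aestronglyMeasurable]
  rw [e, hmap, integral_prod _ hφi]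
  refine integral_eq_zero_of_ae (Filter.Eventually.of_forall fun p => ?_)
  have hfp : Measurable fun y => f (p.2, y) := by fun_prop
  simp only [hφ, Pi.zero_apply]
  rw [integral_map hs.aemeasurable (Measurable.inner measurable_const hfp).aestronglyMeasurable]
  rw [integral_inner (hint p.2), hzero, inner_zero_right]

/-- A conditional second moment bound integrates to a bound for a random parameter that is
independent of the sample. -/
lemma lintegral_noise_le [IsProbabilityMeasure Pr] {M : Type*} [MeasurableSpace M]
    {X : Ω → M} {s : Ω → S}
    {f : M × S → Vec n} (hf : Measurable f) (hX : Measurable X) (hs : Measurable s)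
    (hind : IndepFun X s Pr) {good : Set M} {C : ENNReal}
    (hbound : ∀ m ∈ good, ∫⁻ ω, ‖f (m, s ω)‖ₑ ^ 2 ∂Pr ≤ C) (hgood : ∀ ω, X ω ∈ good) :
    ∫⁻ ω, ‖f (X ω, s ω)‖ₑ ^ 2 ∂Pr ≤ C := by
  have hmap := (indepFun_iff_map_prod_eq_prod_map_map hX.aemeasurable hs.aemeasurable).1 hind
  have := Measure.isProbabilityMeasure_map (μ := Pr) hX.aemeasurable
  have := Measure.isProbabilityMeasure_map (μ := Pr) hs.aemeasurable
  have hφ : Measurable fun p : M × S => ‖f p‖ₑ ^ 2 := by fun_prop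
  have e : ∫⁻ ω, ‖f (X ω, s ω)‖ₑ ^ 2 ∂Pr
      = ∫⁻ p, ‖f p‖ₑ ^ 2 ∂(Pr.map fun ω => (X ω, s ω)) := by
    rw [lintegral_map hφ (hX.prodMk hs)]
  rw [e, hmap, lintegral_prod _ hφ.aemeasurable,
    lintegral_map hφ.lintegral_prod_right' hX]
  calc _ ≤ ∫⁻ _, C ∂Pr := by
        refine lintegral_mono fun ω => ?_
        have hfp : Measurable fun y => ‖f (X ω, y)‖ₑ ^ 2 := by fun_prop
        rw [lintegral_map hfp hs]
        exact hbound _ (hgood ω)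
    _ = C := by simp

lemma memLp_two_of_lintegral_le {f : Ω → Vec n} (hf : AEStronglyMeasurable f Pr) {C : ℝ}
    (h : ∫⁻ ω, ‖f ω‖ₑ ^ 2 ∂Pr ≤ ENNReal.ofReal C) : MemLp f 2 Pr := by
  refine ⟨hf, ?_⟩
  rw [eLpNorm_lt_top_iff_lintegral_rpow_enorm_lt_top (by norm_num) (by norm_num)]
  have : ∀ ω, ‖f ω‖ₑ ^ (2 : ENNReal).toReal = ‖f ω‖ₑ ^ 2 := fun ω => by
    rw [ENNReal.toReal_ofNat]; exact ENNReal.rpow_natCast _ 2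
  simp only [this]
  exact h.trans_lt ENNReal.ofReal_lt_top

lemma integral_sq_le_of_lintegral_le {f : Ω → Vec n} (hf : AEStronglyMeasurable f Pr) {C : ℝ}
    (hC : 0 ≤ C) (h : ∫⁻ ω, ‖f ω‖ₑ ^ 2 ∂Pr ≤ ENNReal.ofReal C) : ∫ ω, ‖f ω‖ ^ 2 ∂Pr ≤ C := by
  rw [integral_eq_lintegral_of_nonneg_ae (Filter.Eventually.of_forall fun _ => sq_nonneg _)
    (hf.norm.pow 2)]
  refine ENNReal.toReal_le_of_le_ofReal hC (le_trans (le_of_eq ?_) h)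
  refine lintegral_congr fun ω => ?_
  rw [ENNReal.ofReal_pow (norm_nonneg _), ofReal_norm]

end Noise

/-! ### The past of an iteration -/

section Past

variable {Ω S ι : Type*} [mS : MeasurableSpace S] {K : ℕ}

/-- The σ-algebra generated by all samples except the `j`-th one. -/
@[reducible]
def othersσ {Ω S ι : Type*} [mS : MeasurableSpace S] (s : ι → Ω → S) (j : ι) : MeasurableSpace Ω :=
  ⨆ i ∈ ({j}ᶜ : Set ι), mS.comap (s i)

/-- The σ-algebra generated by the samples of the iterations before `t`. -/
@[reducible]
def pastσ {Ω S : Type*} [mS : MeasurableSpace S] {K : ℕ} (s : ℕ × Fin K × ℕ → Ω → S)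
    (t : ℕ) : MeasurableSpace Ω :=
  ⨆ i ∈ {i : ℕ × Fin K × ℕ | i.1 < t}, mS.comap (s i)

lemma pastσ_mono (s : ℕ × Fin K × ℕ → Ω → S) {t t' : ℕ} (h : t ≤ t') :
    pastσ s t ≤ pastσ s t' :=
  biSup_mono fun _ hi => lt_of_lt_of_le hi h

lemma pastσ_le_othersσ (s : ℕ × Fin K × ℕ → Ω → S) {t : ℕ} {j : ℕ × Fin K × ℕ} (h : t ≤ j.1) :
    pastσ s t ≤ othersσ s j :=
  biSup_mono fun i hi => by
    rintro rfl
    exact absurd h (not_le.2 hi)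

lemma measurable_sample_past (s : ℕ × Fin K × ℕ → Ω → S) {t : ℕ} {i : ℕ × Fin K × ℕ}
    (h : i.1 < t) : Measurable[pastσ s t] (s i) :=
  (comap_measurable (s i)).mono (le_biSup (fun i => mS.comap (s i)) h) le_rfl

lemma measurable_sample_others (s : ι → Ω → S) {i j : ι} (h : i ≠ j) :
    Measurable[othersσ s j] (s i) :=
  (comap_measurable (s i)).mono (le_biSup (fun i => mS.comap (s i)) h) le_rfl

variable [MeasurableSpace Ω] {Pr : Measure Ω}

lemma othersσ_le {s : ι → Ω → S} (hs : ∀ i, Measurable (s i)) (j : ι) :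
    othersσ s j ≤ (inferInstance : MeasurableSpace Ω) :=
  iSup₂_le fun i _ => (hs i).comap_le

lemma pastσ_le {s : ℕ × Fin K × ℕ → Ω → S} (hs : ∀ i, Measurable (s i)) (t : ℕ) :
    pastσ s t ≤ (inferInstance : MeasurableSpace Ω) :=
  iSup₂_le fun i _ => (hs i).comap_le

lemma indepFun_of_measurable_others {s : ι → Ω → S} (hs : ∀ i, Measurable (s i))
    (hind : iIndepFun s Pr) {M : Type*} [MeasurableSpace M] {j : ι} {Y : Ω → M}
    (hY : Measurable[othersσ s j] Y) : IndepFun Y (s j) Pr := by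
  rw [IndepFun_iff_Indep]
  have h := indep_iSup_of_disjoint (fun i => (hs i).comap_le) hind.iIndep
    (S := ({j}ᶜ : Set ι)) (T := {j}) disjoint_compl_left
  refine indep_of_indep_of_le_left (indep_of_indep_of_le_right h ?_) hY.comap_le
  exact le_biSup (fun i => mS.comap (s i)) (Set.mem_singleton j)

/-- Second moment of the sum of a past random vector and of the centred noises of one iteration. -/
lemma integral_sq_norm_add_noise [IsProbabilityMeasure Pr] {n : ℕ} {s : ℕ × Fin K × ℕ → Ω → S}
    (hs : ∀ i, Measurable (s i)) (hind : iIndepFun s Pr) {M : Type*} [MeasurableSpace M] (t : ℕ)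
    {X : Fin K → Ω → M} (hX : ∀ k, Measurable[pastσ s t] (X k)) {f : Fin K → M × S → Vec n}
    (hf : ∀ k, Measurable (f k))
    (hf2 : ∀ k i, MemLp (fun ω => f k (X k ω, s (t, k, i) ω)) 2 Pr)
    (hint : ∀ k i m, Integrable (fun ω => f k (m, s (t, k, i) ω)) Pr)
    (hzero : ∀ k i m, ∫ ω, f k (m, s (t, k, i) ω) ∂Pr = 0) (J : Finset (Fin K × ℕ))
    {A : Ω → Vec n} (hA : Measurable[pastσ s t] A) (hA2 : MemLp A 2 Pr) (c : ℝ) :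
    ∫ ω, ‖A ω + ∑ j ∈ J, c • f j.1 (X j.1 ω, s (t, j.1, j.2) ω)‖ ^ 2 ∂Pr =
      ∫ ω, ‖A ω‖ ^ 2 ∂Pr + c ^ 2 * ∑ j ∈ J, ∫ ω, ‖f j.1 (X j.1 ω, s (t, j.1, j.2) ω)‖ ^ 2 ∂Pr := by
  -- a vector that is measurable with respect to the other samples is orthogonal to a noise
  have key : ∀ (j : Fin K × ℕ) (A' : Ω → Vec n), Measurable[othersσ s (t, j.1, j.2)] A' →
      MemLp A' 2 Pr → ∫ ω, ⟪A' ω, f j.1 (X j.1 ω, s (t, j.1, j.2) ω)⟫ ∂Pr = 0 := by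
    intro j A' hA' hA'2
    have hX' : Measurable[othersσ s (t, j.1, j.2)] (X j.1) :=
      (hX j.1).mono (pastσ_le_othersσ s le_rfl) le_rfl
    exact integral_inner_noise_eq_zero (hf j.1) (hA'.mono (othersσ_le hs _) le_rfl)
      (hX'.mono (othersσ_le hs _) le_rfl) (hs _)
      (indepFun_of_measurable_others hs hind (hA'.prodMk hX')) hA'2 (hf2 _ _) (hint _ _) (hzero _ _)
  rw [integral_sq_norm_add_sum J hA2 (N := fun j ω => c • f j.1 (X j.1 ω, s (t, j.1, j.2) ω))
    (fun j _ => (hf2 j.1 j.2).const_smul c)]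
  · simp only [norm_smul, mul_pow, integral_const_mul, ← Finset.mul_sum, Real.norm_eq_abs, sq_abs]
  · intro j _
    simp only [real_inner_smul_right, integral_const_mul]
    rw [key j A (hA.mono (pastσ_le_othersσ s le_rfl) le_rfl) hA2, mul_zero]
  · intro i _ j _ hij
    simp only [real_inner_smul_right, real_inner_smul_left, integral_const_mul]
    rw [key j _ ?_ (hf2 _ _), mul_zero, mul_zero]
    have h1 : Measurable[othersσ s (t, j.1, j.2)] (X i.1) :=
      (hX i.1).mono (pastσ_le_othersσ s le_rfl) le_rfl
    have h2 : Measurable[othersσ s (t, j.1, j.2)] (s (t, i.1, i.2)) := by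
      refine measurable_sample_others s fun h => hij ?_
      simp only [Prod.mk.injEq, true_and] at h
      exact Prod.ext h.1 h.2
    exact (hf i.1).comp (h1.prodMk h2)

end Past

/-! ### Batch means and square integrable vectors -/

section BatchMean

variable {V : Type*} [NormedAddCommGroup V] [InnerProductSpace ℝ V]

lemma batchMean_sub_const {n : ℕ} (hn : 1 ≤ n) (a : ℕ → V) (v : V) :
    batchMean n a - v = ∑ i ∈ Finset.range n, (n : ℝ)⁻¹ • (a i - v) := by
  have : (n : ℝ) ≠ 0 := by positivity
  rw [← Finset.smul_sum, Finset.sum_sub_distrib, Finset.sum_const, Finset.card_range, smul_sub,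
    ← Nat.cast_smul_eq_nsmul ℝ, smul_smul, inv_mul_cancel₀ this, one_smul]
  rfl

lemma sq_norm_batchMean_le (n : ℕ) (a : ℕ → V) :
    ‖batchMean n a‖ ^ 2 ≤ (n : ℝ)⁻¹ * ∑ i ∈ Finset.range n, ‖a i‖ ^ 2 := by
  rcases Nat.eq_zero_or_pos n with rfl | hn
  · simp [batchMean]
  have hn' : (0 : ℝ) < n := by positivity
  have h1 : ‖∑ i ∈ Finset.range n, a i‖ ^ 2 ≤ n * ∑ i ∈ Finset.range n, ‖a i‖ ^ 2 := by
    calc _ ≤ (∑ i ∈ Finset.range n, ‖a i‖) ^ 2 := by gcongr; exact norm_sum_le _ _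
      _ ≤ _ := by simpa using sq_sum_le_card_mul_sum_sq (s := Finset.range n) (f := fun i => ‖a i‖)
  unfold batchMean
  rw [norm_smul, mul_pow, norm_inv, Real.norm_of_nonneg hn'.le]
  calc (n : ℝ)⁻¹ ^ 2 * ‖∑ i ∈ Finset.range n, a i‖ ^ 2
      ≤ (n : ℝ)⁻¹ ^ 2 * (n * ∑ i ∈ Finset.range n, ‖a i‖ ^ 2) := by gcongr
    _ = _ := by field_simp

end BatchMean

section Integration

variable {Ω : Type*} {mΩ : MeasurableSpace Ω} {Pr : Measure Ω} {n : ℕ}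

lemma memLp_smul {f : Ω → Vec n} (hf : MemLp f 2 Pr) (c : ℝ) : MemLp (fun ω => c • f ω) 2 Pr :=
  hf.const_smul c

lemma memLp_add {f g : Ω → Vec n} (hf : MemLp f 2 Pr) (hg : MemLp g 2 Pr) :
    MemLp (fun ω => f ω + g ω) 2 Pr := hf.add hg

lemma memLp_sub {f g : Ω → Vec n} (hf : MemLp f 2 Pr) (hg : MemLp g 2 Pr) :
    MemLp (fun ω => f ω - g ω) 2 Pr := hf.sub hg

lemma memLp_avg {K : ℕ} {f : Fin K → Ω → Vec n} (hf : ∀ k, MemLp (f k) 2 Pr) :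
    MemLp (fun ω => avg fun k => f k ω) 2 Pr :=
  memLp_smul (memLp_finsetSum _ fun k _ => hf k) _

lemma measurable_smul_vec {f : Ω → Vec n} (hf : Measurable f) (c : ℝ) :
    Measurable fun ω => c • f ω := hf.const_smul c

lemma measurable_avg {K : ℕ} {f : Fin K → Ω → Vec n} (hf : ∀ k, Measurable (f k)) :
    Measurable fun ω => avg fun k => f k ω :=
  measurable_smul_vec (Finset.measurable_sum _ fun k _ => hf k) _

lemma integral_comb₂ {f g : Ω → ℝ} (hf : Integrable f Pr) (hg : Integrable g Pr) (a b : ℝ) :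
    ∫ ω, (a * f ω + b * g ω) ∂Pr = a * ∫ ω, f ω ∂Pr + b * ∫ ω, g ω ∂Pr := by
  rw [integral_add (hf.const_mul a) (hg.const_mul b), integral_const_mul, integral_const_mul]

lemma integral_comb₃ {f g h : Ω → ℝ} (hf : Integrable f Pr) (hg : Integrable g Pr)
    (hh : Integrable h Pr) (a b c : ℝ) :
    ∫ ω, (a * f ω + b * g ω + c * h ω) ∂Pr =
      a * ∫ ω, f ω ∂Pr + b * ∫ ω, g ω ∂Pr + c * ∫ ω, h ω ∂Pr := by
  have h1 : Integrable (fun ω => a * f ω + b * g ω) Pr := (hf.const_mul a).add (hg.const_mul b)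
  rw [integral_add h1 (hh.const_mul c), integral_comb₂ hf hg, integral_const_mul]

end Integration

/-! ### Variance-reduced estimators -/

/-- A stochastic oracle `h k m s` of worker `k` at the point `m` with a sample `s`: jointly
measurable, Lipschitz in `m` on the ball, unbiased for `hb k m` and of variance at most `σ²`. -/
structure SampleOracle {K dx dy n : ℕ} {Ω S : Type*} [MeasurableSpace Ω] [MeasurableSpace S]
    (ρ L σ : ℝ) (Pr : Measure Ω) (s : ℕ × Fin K × ℕ → Ω → S)
    (h : Fin K → Pt dx dy → S → Vec n) (hb : Fin K → Pt dx dy → Vec n) : Prop where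
  meas : ∀ k, Measurable fun p : Pt dx dy × S => h k p.1 p.2
  lip : ∀ k σ, LipBall ρ L fun m => h k m σ
  int : ∀ t k i m, Integrable (fun ω => h k m (s (t, k, i) ω)) Pr
  mean : ∀ t k i m, ∫ ω, h k m (s (t, k, i) ω) ∂Pr = hb k m
  var : ∀ t k i m, ‖m.2.2‖ ≤ ρ →
    ∫⁻ ω, ‖h k m (s (t, k, i) ω) - hb k m‖ₑ ^ 2 ∂Pr ≤ ENNReal.ofReal (σ ^ 2)

/-- A variance-reduced estimator `u` along the points `m`, together with the adaptedness of both
processes: the points of iteration `t` depend on the samples of earlier iterations only. -/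
structure StormProcess {K dx dy n : ℕ} {Ω S : Type*} [MeasurableSpace S]
    (ρ θ : ℝ) (B₀ B : ℕ) (s : ℕ × Fin K × ℕ → Ω → S) (h : Fin K → Pt dx dy → S → Vec n)
    (m : ℕ → Fin K → Ω → Pt dx dy) (u : ℕ → Fin K → Ω → Vec n) : Prop where
  init : ∀ k ω, u 0 k ω = batchMean B₀ fun i => h k (m 0 k ω) (s (0, k, i) ω)
  step : ∀ t k ω, u (t + 1) k ω =
    (1 - θ) • (u t k ω - batchMean B fun i => h k (m t k ω) (s (t + 1, k, i) ω)) +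
      batchMean B fun i => h k (m (t + 1) k ω) (s (t + 1, k, i) ω)
  adapted_m : ∀ t k, Measurable[pastσ s t] (m t k)
  adapted_u : ∀ t k, Measurable[pastσ s (t + 1)] (u t k)
  ball : ∀ t k ω, ‖(m t k ω).2.2‖ ≤ ρ

section Storm

variable {K dx dy n : ℕ} {Ω S : Type*} [MeasurableSpace Ω] [MeasurableSpace S] {ρ L σ θ : ℝ}
  {Pr : Measure Ω} [IsProbabilityMeasure Pr] {s : ℕ × Fin K × ℕ → Ω → S}
  {h : Fin K → Pt dx dy → S → Vec n} {hb : Fin K → Pt dx dy → Vec n} {B₀ B : ℕ}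
  {m : ℕ → Fin K → Ω → Pt dx dy} {u : ℕ → Fin K → Ω → Vec n}

lemma SampleOracle.meas_bar (o : SampleOracle ρ L σ Pr s h hb) (hs : ∀ i, Measurable (s i))
    (k : Fin K) : Measurable (hb k) := by
  have e : hb k = fun m => ∫ ω, h k m (s (0, k, 0) ω) ∂Pr := funext fun m => (o.mean 0 k 0 m).symm
  rw [e]
  have h1 : Measurable fun p : Pt dx dy × Ω => h k p.1 (s (0, k, 0) p.2) :=
    (o.meas k).comp (measurable_fst.prodMk ((hs _).comp measurable_snd))
  exact (h1.stronglyMeasurable.integral_prod_right' (ν := Pr)).measurable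

/-- The expected oracle inherits the Lipschitz constant. -/
lemma SampleOracle.lip_bar (o : SampleOracle ρ L σ Pr s h hb) (k : Fin K) :
    LipBall ρ L (hb k) := by
  intro m m' hm hm'
  rw [← o.mean 0 k 0 m, ← o.mean 0 k 0 m', ← integral_sub (o.int 0 k 0 m) (o.int 0 k 0 m')]
  have hnn : 0 ≤ L ^ 2 * sqDist m m' := mul_nonneg (sq_nonneg _) (sqDist_nonneg _ _)
  have h1 := norm_integral_le_of_norm_le_const (μ := Pr)
    (f := fun ω => h k m (s (0, k, 0) ω) - h k m' (s (0, k, 0) ω)) (C := √(L ^ 2 * sqDist m m'))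
    (Filter.Eventually.of_forall fun ω => Real.le_sqrt_of_sq_le (o.lip k _ m m' hm hm'))
  rw [probReal_univ, mul_one] at h1
  calc _ ≤ √(L ^ 2 * sqDist m m') ^ 2 := by gcongr
    _ = _ := Real.sq_sqrt hnn

lemma SampleOracle.meas_centered (o : SampleOracle ρ L σ Pr s h hb) (hs : ∀ i, Measurable (s i))
    (k : Fin K) : Measurable fun p : Pt dx dy × S => h k p.1 p.2 - hb k p.1 :=
  (o.meas k).sub ((o.meas_bar hs k).comp measurable_fst)

/-- The centred oracle at a random point that does not depend on the sample. -/
lemma SampleOracle.centered (o : SampleOracle ρ L σ Pr s h hb) (hs : ∀ i, Measurable (s i))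
    (hind : iIndepFun s Pr) {t : ℕ} {k : Fin K} (i : ℕ) {X : Ω → Pt dx dy}
    (hX : Measurable[pastσ s t] X) (hball : ∀ ω, ‖(X ω).2.2‖ ≤ ρ) :
    MemLp (fun ω => h k (X ω) (s (t, k, i) ω) - hb k (X ω)) 2 Pr ∧
    ∫ ω, ‖h k (X ω) (s (t, k, i) ω) - hb k (X ω)‖ ^ 2 ∂Pr ≤ σ ^ 2 := by
  have hX' : Measurable X := hX.mono (pastσ_le hs t) le_rfl
  have hI : IndepFun X (s (t, k, i)) Pr := indepFun_of_measurable_others hs hind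
    (hX.mono (pastσ_le_othersσ s le_rfl) le_rfl)
  have hm : Measurable fun ω => h k (X ω) (s (t, k, i) ω) - hb k (X ω) :=
    (o.meas_centered hs k).comp (hX'.prodMk (hs _))
  have hl := lintegral_noise_le (o.meas_centered hs k) hX' (hs (t, k, i)) hI
    (good := {m | ‖m.2.2‖ ≤ ρ}) (C := ENNReal.ofReal (σ ^ 2)) (fun m hm => o.var t k i m hm) hball
  exact ⟨memLp_two_of_lintegral_le hm.aestronglyMeasurable hl,
    integral_sq_le_of_lintegral_le hm.aestronglyMeasurable (sq_nonneg σ) hl⟩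

/-- The noise of one step of the variance-reduced estimator. -/
def stormNoise {K dx dy n : ℕ} {S : Type*} (θ : ℝ) (h : Fin K → Pt dx dy → S → Vec n)
    (hb : Fin K → Pt dx dy → Vec n) (k : Fin K) (p : (Pt dx dy × Pt dx dy) × S) : Vec n :=
  (h k p.1.2 p.2 - hb k p.1.2) - (1 - θ) • (h k p.1.1 p.2 - hb k p.1.1)

variable (o : SampleOracle ρ L σ Pr s h hb) (hs : ∀ i, Measurable (s i)) (hind : iIndepFun s Pr)
  (p : StormProcess ρ θ B₀ B s h m u)

include o hs

lemma measurable_stormNoise (k : Fin K) : Measurable (stormNoise θ h hb k) := by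
  have h1 : Measurable fun p : (Pt dx dy × Pt dx dy) × S => h k p.1.2 p.2 - hb k p.1.2 :=
    (o.meas_centered hs k).comp (g := fun p : Pt dx dy × S => h k p.1 p.2 - hb k p.1)
      (f := fun p : (Pt dx dy × Pt dx dy) × S => (p.1.2, p.2)) (by fun_prop)
  have h2 : Measurable fun p : (Pt dx dy × Pt dx dy) × S => h k p.1.1 p.2 - hb k p.1.1 :=
    (o.meas_centered hs k).comp (g := fun p : Pt dx dy × S => h k p.1 p.2 - hb k p.1)
      (f := fun p : (Pt dx dy × Pt dx dy) × S => (p.1.1, p.2)) (by fun_prop)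
  exact h1.sub (h2.const_smul (1 - θ))

include hind p

lemma stormNoise_memLp (t : ℕ) (k : Fin K) (i : ℕ) :
    MemLp (fun ω => stormNoise θ h hb k ((m t k ω, m (t + 1) k ω), s (t + 1, k, i) ω)) 2 Pr := by
  have h1 := (o.centered hs hind i (k := k) (p.adapted_m (t + 1) k) (p.ball (t + 1) k)).1
  have h2 := (o.centered hs hind i (k := k)
    ((p.adapted_m t k).mono (pastσ_mono s t.le_succ) le_rfl) (p.ball t k)).1
  exact h1.sub (h2.const_smul (1 - θ))

/-- Second moment of the noise: the variance is damped by `θ²`, up to the movement of the point. -/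
lemma integral_sq_stormNoise_le (t : ℕ) (k : Fin K) (i : ℕ)
    (hmove : Integrable (fun ω => sqDist (m (t + 1) k ω) (m t k ω)) Pr) :
    ∫ ω, ‖stormNoise θ h hb k ((m t k ω, m (t + 1) k ω), s (t + 1, k, i) ω)‖ ^ 2 ∂Pr ≤
      2 * θ ^ 2 * σ ^ 2 + 8 * L ^ 2 * ∫ ω, sqDist (m (t + 1) k ω) (m t k ω) ∂Pr := by
  have h2 := o.centered hs hind i (k := k)
    ((p.adapted_m t k).mono (pastσ_mono s t.le_succ) le_rfl) (p.ball t k)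
  have hpt : ∀ ω, ‖stormNoise θ h hb k ((m t k ω, m (t + 1) k ω), s (t + 1, k, i) ω)‖ ^ 2 ≤
      2 * θ ^ 2 * ‖h k (m t k ω) (s (t + 1, k, i) ω) - hb k (m t k ω)‖ ^ 2 +
        8 * L ^ 2 * sqDist (m (t + 1) k ω) (m t k ω) := by
    intro ω
    set m₁ := m (t + 1) k ω
    set m₀ := m t k ω
    set σ' := s (t + 1, k, i) ω
    have e : stormNoise θ h hb k ((m₀, m₁), σ') = θ • (h k m₀ σ' - hb k m₀) +
        ((h k m₁ σ' - h k m₀ σ') - (hb k m₁ - hb k m₀)) := by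
      simp only [stormNoise]; module
    have a1 := sq_norm_add_le (θ • (h k m₀ σ' - hb k m₀))
      ((h k m₁ σ' - h k m₀ σ') - (hb k m₁ - hb k m₀))
    have a2 := sq_norm_sub_le (h k m₁ σ' - h k m₀ σ') (hb k m₁ - hb k m₀)
    have a3 := o.lip k σ' m₁ m₀ (p.ball _ _ _) (p.ball _ _ _)
    have a4 := o.lip_bar k m₁ m₀ (p.ball _ _ _) (p.ball _ _ _)
    rw [norm_smul, mul_pow, Real.norm_eq_abs, sq_abs] at a1
    rw [e]; linarith
  have hi1 := (integrable_sq_of_memLp h2.1).const_mul (2 * θ ^ 2)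
  have hi2 := hmove.const_mul (8 * L ^ 2)
  refine (integral_mono (integrable_sq_of_memLp (stormNoise_memLp o hs hind p t k i))
    (hi1.add hi2) hpt).trans ?_
  simp only [Pi.add_apply]
  rw [integral_add hi1 hi2, integral_const_mul, integral_const_mul]
  gcongr
  exact h2.2

omit hs hind o [MeasurableSpace Ω] in
/-- The error contracts by `1 - θ` and receives the average of `B` independent noises. -/
lemma err_step (hB : 1 ≤ B) (t : ℕ) (k : Fin K) (ω : Ω) :
    u (t + 1) k ω - hb k (m (t + 1) k ω) = (1 - θ) • (u t k ω - hb k (m t k ω)) +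
      ∑ i ∈ Finset.range B, (B : ℝ)⁻¹ •
        stormNoise θ h hb k ((m t k ω, m (t + 1) k ω), s (t + 1, k, i) ω) := by
  have h1 := batchMean_sub_const hB (fun i => h k (m (t + 1) k ω) (s (t + 1, k, i) ω))
    (hb k (m (t + 1) k ω))
  have h2 := batchMean_sub_const hB (fun i => h k (m t k ω) (s (t + 1, k, i) ω)) (hb k (m t k ω))
  have e : ∑ i ∈ Finset.range B, (B : ℝ)⁻¹ •
        stormNoise θ h hb k ((m t k ω, m (t + 1) k ω), s (t + 1, k, i) ω) =
      ∑ i ∈ Finset.range B, (B : ℝ)⁻¹ • (h k (m (t + 1) k ω) (s (t + 1, k, i) ω) -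
        hb k (m (t + 1) k ω)) - (1 - θ) • ∑ i ∈ Finset.range B, (B : ℝ)⁻¹ •
          (h k (m t k ω) (s (t + 1, k, i) ω) - hb k (m t k ω)) := by
    rw [Finset.smul_sum, ← Finset.sum_sub_distrib]
    refine Finset.sum_congr rfl fun i _ => ?_
    simp only [stormNoise]; module
  rw [e, ← h1, ← h2, p.step]
  module

omit hs hind o [MeasurableSpace Ω] in
lemma err_zero (hB₀ : 1 ≤ B₀) (k : Fin K) (ω : Ω) :
    u 0 k ω - hb k (m 0 k ω) = ∑ i ∈ Finset.range B₀, (B₀ : ℝ)⁻¹ •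
      (h k (m 0 k ω) (s (0, k, i) ω) - hb k (m 0 k ω)) := by
  rw [p.init, batchMean_sub_const hB₀]

/-- The estimation errors are square integrable. -/
lemma err_memLp (hB₀ : 1 ≤ B₀) (hB : 1 ≤ B) (t : ℕ) (k : Fin K) :
    MemLp (fun ω => u t k ω - hb k (m t k ω)) 2 Pr := by
  induction t with
  | zero =>
    simp only [err_zero (hb := hb) p hB₀]
    exact memLp_finsetSum _ fun i _ =>
      memLp_smul (o.centered hs hind i (k := k) (p.adapted_m 0 k) (p.ball 0 k)).1 _
  | succ t ih =>
    simp only [err_step (hb := hb) p hB]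
    exact memLp_add (memLp_smul ih _) (memLp_finsetSum _ fun i _ =>
      memLp_smul (stormNoise_memLp o hs hind p t k i) _)

omit hind in
lemma measurable_err (t : ℕ) (k : Fin K) :
    Measurable[pastσ s (t + 1)] (fun ω => u t k ω - hb k (m t k ω)) := by
  have h1 : Measurable[pastσ s (t + 1)] (m t k) :=
    (p.adapted_m t k).mono (pastσ_mono s t.le_succ) le_rfl
  exact (p.adapted_u t k).sub ((o.meas_bar hs k).comp h1)

/-- Second moment of a past vector plus the noises of one step. -/
lemma integral_sq_add_stormNoise (t : ℕ) (J : Finset (Fin K × ℕ)) {A : Ω → Vec n}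
    (hA : Measurable[pastσ s (t + 1)] A) (hA2 : MemLp A 2 Pr) (c : ℝ) :
    ∫ ω, ‖A ω + ∑ j ∈ J, c • stormNoise θ h hb j.1
        ((m t j.1 ω, m (t + 1) j.1 ω), s (t + 1, j.1, j.2) ω)‖ ^ 2 ∂Pr =
      ∫ ω, ‖A ω‖ ^ 2 ∂Pr + c ^ 2 * ∑ j ∈ J, ∫ ω, ‖stormNoise θ h hb j.1
        ((m t j.1 ω, m (t + 1) j.1 ω), s (t + 1, j.1, j.2) ω)‖ ^ 2 ∂Pr := by
  have hX : ∀ k, Measurable[pastσ s (t + 1)] (fun ω => (m t k ω, m (t + 1) k ω)) := fun k =>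
    ((p.adapted_m t k).mono (pastσ_mono s t.le_succ) le_rfl).prodMk (p.adapted_m (t + 1) k)
  have i1 : ∀ k i (q : Pt dx dy), Integrable (fun ω => h k q (s (t + 1, k, i) ω) - hb k q) Pr :=
    fun k i q => (o.int (t + 1) k i q).sub (integrable_const _)
  have e1 : ∀ k i (q : Pt dx dy), ∫ ω, (h k q (s (t + 1, k, i) ω) - hb k q) ∂Pr = 0 := by
    intro k i q
    rw [integral_sub (o.int (t + 1) k i q) (integrable_const _), o.mean]; simp
  have i2 : ∀ k i (q : Pt dx dy),
      Integrable (fun ω => (1 - θ) • (h k q (s (t + 1, k, i) ω) - hb k q)) Pr :=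
    fun k i q => (i1 k i q).smul (1 - θ)
  have hint : ∀ k i (q : Pt dx dy × Pt dx dy),
      Integrable (fun ω => stormNoise θ h hb k (q, s (t + 1, k, i) ω)) Pr :=
    fun k i q => (i1 k i q.2).sub (i2 k i q.1)
  have hzero : ∀ k i (q : Pt dx dy × Pt dx dy),
      ∫ ω, stormNoise θ h hb k (q, s (t + 1, k, i) ω) ∂Pr = 0 := by
    intro k i q
    simp only [stormNoise]
    rw [integral_sub (i1 k i q.2) (i2 k i q.1), integral_smul, e1, e1, smul_zero, sub_zero]
  have hmeas : ∀ k, Measurable (stormNoise θ h hb k) := fun k => measurable_stormNoise o hs k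
  have hf2 : ∀ k i, MemLp (fun ω => stormNoise θ h hb k
      ((fun k ω => (m t k ω, m (t + 1) k ω)) k ω, s (t + 1, k, i) ω)) 2 Pr :=
    fun k i => stormNoise_memLp o hs hind p t k i
  generalize stormNoise θ h hb = f at *
  exact integral_sq_norm_add_noise hs hind (t + 1) hX hmeas hf2 hint hzero J hA hA2 c

/-- Second moment of the sum of the initial noises. -/
lemma integral_sq_initial (J : Finset (Fin K × ℕ)) (c : ℝ) :
    ∫ ω, ‖∑ j ∈ J, c • (h j.1 (m 0 j.1 ω) (s (0, j.1, j.2) ω) - hb j.1 (m 0 j.1 ω))‖ ^ 2 ∂Pr ≤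
      c ^ 2 * (J.card * σ ^ 2) := by
  have key := integral_sq_norm_add_noise hs hind 0 (X := fun k ω => m 0 k ω)
    (f := fun k p => h k p.1 p.2 - hb k p.1) (fun k => p.adapted_m 0 k)
    (fun k => o.meas_centered hs k)
    (fun k i => (o.centered hs hind i (k := k) (p.adapted_m 0 k) (p.ball 0 k)).1)
    (fun k i q => (o.int 0 k i q).sub (integrable_const (hb k q)))
    (fun k i q => by
      change ∫ ω, (h k q (s (0, k, i) ω) - hb k q) ∂Pr = 0
      rw [integral_sub (o.int 0 k i q) (integrable_const _), o.mean]; simp)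
    J (A := fun _ => (0 : Vec n)) measurable_const (memLp_const 0) c
  simp only [zero_add, norm_zero, zero_pow two_ne_zero, integral_zero] at key
  rw [key]
  gcongr
  rw [← nsmul_eq_mul]
  exact Finset.sum_le_card_nsmul _ _ _ fun j _ =>
    (o.centered hs hind j.2 (k := j.1) (p.adapted_m 0 j.1) (p.ball 0 j.1)).2

variable (hmove : ∀ t k, Integrable (fun ω => sqDist (m (t + 1) k ω) (m t k ω)) Pr)

omit o hs hind p [IsProbabilityMeasure Pr] in
lemma integral_move_eq
    (hmove : ∀ t k, Integrable (fun ω => sqDist (m (t + 1) k ω) (m t k ω)) Pr) (t : ℕ) :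
    ∫ ω, move (fun k => m t k ω) (fun k => m (t + 1) k ω) ∂Pr =
      (K : ℝ)⁻¹ * ∑ k, ∫ ω, sqDist (m (t + 1) k ω) (m t k ω) ∂Pr := by
  unfold move
  rw [integral_const_mul, integral_finsetSum _ fun k _ => hmove t k]

include hmove

/-- Recursion for the error of the averaged estimator: independence over the workers divides the
variance by their number. -/
lemma integral_sq_avg_err_succ_le (hK : 0 < K) (hB₀ : 1 ≤ B₀) (hB : 1 ≤ B) (hθ : 0 ≤ θ)
    (hθ1 : θ ≤ 1) (t : ℕ) :
    ∫ ω, ‖avg (fun k => u (t + 1) k ω - hb k (m (t + 1) k ω))‖ ^ 2 ∂Pr ≤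
      (1 - θ) * ∫ ω, ‖avg (fun k => u t k ω - hb k (m t k ω))‖ ^ 2 ∂Pr +
      (K : ℝ)⁻¹ * (2 * θ ^ 2 * σ ^ 2 +
        8 * L ^ 2 * ∫ ω, move (fun k => m t k ω) (fun k => m (t + 1) k ω) ∂Pr) := by
  have hB' : (1 : ℝ) ≤ B := by exact_mod_cast hB
  have hB0 : (0 : ℝ) < B := by linarith
  have hK' : (0 : ℝ) < K := by exact_mod_cast hK
  have e : ∀ ω, avg (fun k => u (t + 1) k ω - hb k (m (t + 1) k ω)) =
      (1 - θ) • avg (fun k => u t k ω - hb k (m t k ω)) +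
      ∑ j ∈ (Finset.univ : Finset (Fin K)) ×ˢ Finset.range B, ((K : ℝ)⁻¹ * (B : ℝ)⁻¹) •
        stormNoise θ h hb j.1 ((m t j.1 ω, m (t + 1) j.1 ω), s (t + 1, j.1, j.2) ω) := by
    intro ω
    simp only [err_step (hb := hb) p hB]
    rw [avg_add, avg_smul, Finset.sum_product]
    congr 1
    simp only [avg, Finset.smul_sum, smul_smul]
  simp only [e]
  have hAm : Measurable[pastσ s (t + 1)]
      fun ω => (1 - θ) • avg (fun k => u t k ω - hb k (m t k ω)) :=
    measurable_smul_vec (measurable_avg fun k => measurable_err o hs p t k) _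
  have hA2 : MemLp (fun ω => (1 - θ) • avg (fun k => u t k ω - hb k (m t k ω))) 2 Pr :=
    memLp_smul (memLp_avg fun k => err_memLp o hs hind p hB₀ hB t k) _
  rw [integral_sq_add_stormNoise o hs hind p t _ hAm hA2]
  simp only [norm_smul, mul_pow, Real.norm_eq_abs, sq_abs, integral_const_mul]
  have h1 : (1 - θ) ^ 2 * ∫ ω, ‖avg (fun k => u t k ω - hb k (m t k ω))‖ ^ 2 ∂Pr ≤
      (1 - θ) * ∫ ω, ‖avg (fun k => u t k ω - hb k (m t k ω))‖ ^ 2 ∂Pr := by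
    gcongr ?_ * _
    nlinarith
  have h2 : ∑ j ∈ (Finset.univ : Finset (Fin K)) ×ˢ Finset.range B, ∫ ω, ‖stormNoise θ h hb j.1
        ((m t j.1 ω, m (t + 1) j.1 ω), s (t + 1, j.1, j.2) ω)‖ ^ 2 ∂Pr ≤
      B * (K * (2 * θ ^ 2 * σ ^ 2) +
        8 * L ^ 2 * ∑ k, ∫ ω, sqDist (m (t + 1) k ω) (m t k ω) ∂Pr) := by
    rw [Finset.sum_product]
    calc _ ≤ ∑ k : Fin K, ∑ i ∈ Finset.range B, (2 * θ ^ 2 * σ ^ 2 +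
          8 * L ^ 2 * ∫ ω, sqDist (m (t + 1) k ω) (m t k ω) ∂Pr) :=
          Finset.sum_le_sum fun k _ => Finset.sum_le_sum fun i _ =>
            integral_sq_stormNoise_le o hs hind p t k i (hmove t k)
      _ = _ := by
          simp only [Finset.sum_const, Finset.card_range, nsmul_eq_mul, ← Finset.mul_sum,
            Finset.sum_add_distrib, Finset.card_univ, Fintype.card_fin]
  have hS : 0 ≤ ∑ k, ∫ ω, sqDist (m (t + 1) k ω) (m t k ω) ∂Pr :=
    Finset.sum_nonneg fun k _ => integral_nonneg fun _ => sqDist_nonneg _ _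
  rw [integral_move_eq hmove]
  have h3 : (K : ℝ)⁻¹ ^ 2 * (B : ℝ)⁻¹ ^ 2 * (B * (K * (2 * θ ^ 2 * σ ^ 2) +
        8 * L ^ 2 * ∑ k, ∫ ω, sqDist (m (t + 1) k ω) (m t k ω) ∂Pr)) ≤
      (K : ℝ)⁻¹ * (2 * θ ^ 2 * σ ^ 2 +
        8 * L ^ 2 * ((K : ℝ)⁻¹ * ∑ k, ∫ ω, sqDist (m (t + 1) k ω) (m t k ω) ∂Pr)) := by
    set Q := ∑ k, ∫ ω, sqDist (m (t + 1) k ω) (m t k ω) ∂Pr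
    have e1 : (K : ℝ)⁻¹ ^ 2 * (B : ℝ)⁻¹ ^ 2 * (B * (K * (2 * θ ^ 2 * σ ^ 2) + 8 * L ^ 2 * Q)) =
        (B : ℝ)⁻¹ * ((K : ℝ)⁻¹ * (2 * θ ^ 2 * σ ^ 2 + 8 * L ^ 2 * ((K : ℝ)⁻¹ * Q))) := by
      field_simp
    rw [e1]
    exact mul_le_of_le_one_left (by positivity) (inv_le_one_of_one_le₀ hB')
  have h4 := mul_le_mul_of_nonneg_left h2
    (by positivity : 0 ≤ (K : ℝ)⁻¹ ^ 2 * (B : ℝ)⁻¹ ^ 2)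
  linarith

/-- Recursion for the errors of the individual estimators. -/
lemma integral_msq_err_succ_le (hB₀ : 1 ≤ B₀) (hB : 1 ≤ B) (hθ : 0 ≤ θ) (hθ1 : θ ≤ 1) (hK : 0 < K)
    (t : ℕ) :
    ∫ ω, msq (fun k => u (t + 1) k ω - hb k (m (t + 1) k ω)) ∂Pr ≤
      (1 - θ) * ∫ ω, msq (fun k => u t k ω - hb k (m t k ω)) ∂Pr +
      (2 * θ ^ 2 * σ ^ 2 +
        8 * L ^ 2 * ∫ ω, move (fun k => m t k ω) (fun k => m (t + 1) k ω) ∂Pr) := by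
  have hB' : (1 : ℝ) ≤ B := by exact_mod_cast hB
  have hB0 : (0 : ℝ) < B := by linarith
  have hK' : (0 : ℝ) < K := by exact_mod_cast hK
  have hone : ∀ k, ∫ ω, ‖u (t + 1) k ω - hb k (m (t + 1) k ω)‖ ^ 2 ∂Pr ≤
      (1 - θ) * ∫ ω, ‖u t k ω - hb k (m t k ω)‖ ^ 2 ∂Pr +
      (2 * θ ^ 2 * σ ^ 2 + 8 * L ^ 2 * ∫ ω, sqDist (m (t + 1) k ω) (m t k ω) ∂Pr) := by
    intro k
    have e : ∀ ω, u (t + 1) k ω - hb k (m (t + 1) k ω) = (1 - θ) • (u t k ω - hb k (m t k ω)) +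
        ∑ j ∈ ({k} : Finset (Fin K)) ×ˢ Finset.range B, (B : ℝ)⁻¹ •
          stormNoise θ h hb j.1 ((m t j.1 ω, m (t + 1) j.1 ω), s (t + 1, j.1, j.2) ω) := fun ω => by
      rw [err_step p hB, Finset.sum_product, Finset.sum_singleton]
    simp only [e]
    rw [integral_sq_add_stormNoise o hs hind p t _
      (measurable_smul_vec (measurable_err o hs p t k) _)
      (memLp_smul (err_memLp o hs hind p hB₀ hB t k) _), Finset.sum_product, Finset.sum_singleton]
    simp only [norm_smul, mul_pow, Real.norm_eq_abs, sq_abs, integral_const_mul]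
    have h1 : (1 - θ) ^ 2 * ∫ ω, ‖u t k ω - hb k (m t k ω)‖ ^ 2 ∂Pr ≤
        (1 - θ) * ∫ ω, ‖u t k ω - hb k (m t k ω)‖ ^ 2 ∂Pr := by
      gcongr ?_ * _
      nlinarith
    have hnn : 0 ≤ ∫ ω, sqDist (m (t + 1) k ω) (m t k ω) ∂Pr :=
      integral_nonneg fun _ => sqDist_nonneg _ _
    have h2 : (B : ℝ)⁻¹ ^ 2 * ∑ i ∈ Finset.range B, ∫ ω, ‖stormNoise θ h hb k
        ((m t k ω, m (t + 1) k ω), s (t + 1, k, i) ω)‖ ^ 2 ∂Pr ≤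
        2 * θ ^ 2 * σ ^ 2 + 8 * L ^ 2 * ∫ ω, sqDist (m (t + 1) k ω) (m t k ω) ∂Pr := by
      calc _ ≤ (B : ℝ)⁻¹ ^ 2 * ∑ i ∈ Finset.range B, (2 * θ ^ 2 * σ ^ 2 +
            8 * L ^ 2 * ∫ ω, sqDist (m (t + 1) k ω) (m t k ω) ∂Pr) := by
            gcongr with i _
            exact integral_sq_stormNoise_le o hs hind p t k i (hmove t k)
        _ = (B : ℝ)⁻¹ * (2 * θ ^ 2 * σ ^ 2 +
            8 * L ^ 2 * ∫ ω, sqDist (m (t + 1) k ω) (m t k ω) ∂Pr) := by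
            rw [Finset.sum_const, Finset.card_range, nsmul_eq_mul]; field_simp
        _ ≤ _ := mul_le_of_le_one_left (by positivity) (inv_le_one_of_one_le₀ hB')
    linarith
  have hi : ∀ t k, Integrable (fun ω => ‖u t k ω - hb k (m t k ω)‖ ^ 2) Pr := fun t k =>
    integrable_sq_of_memLp (err_memLp o hs hind p hB₀ hB t k)
  rw [integral_move_eq hmove]
  unfold msq
  rw [integral_const_mul, integral_const_mul, integral_finsetSum _ fun k _ => hi (t + 1) k,
    integral_finsetSum _ fun k _ => hi t k]
  have hsum := Finset.sum_le_sum fun k (_ : k ∈ Finset.univ) => hone k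
  simp only [Finset.sum_add_distrib, ← Finset.mul_sum, Finset.sum_const, Finset.card_univ,
    Fintype.card_fin, nsmul_eq_mul] at hsum
  refine (mul_le_mul_of_nonneg_left hsum (by positivity : 0 ≤ (K : ℝ)⁻¹)).trans (le_of_eq ?_)
  field_simp

omit hmove in
lemma integral_sq_avg_err_zero_le (hK : 0 < K) (hB₀ : 1 ≤ B₀) :
    ∫ ω, ‖avg (fun k => u 0 k ω - hb k (m 0 k ω))‖ ^ 2 ∂Pr ≤ σ ^ 2 / (K * B₀) := by
  have hB0 : (0 : ℝ) < B₀ := by exact_mod_cast hB₀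
  have hK' : (0 : ℝ) < K := by exact_mod_cast hK
  have e : ∀ ω, avg (fun k => u 0 k ω - hb k (m 0 k ω)) =
      ∑ j ∈ (Finset.univ : Finset (Fin K)) ×ˢ Finset.range B₀, ((K : ℝ)⁻¹ * (B₀ : ℝ)⁻¹) •
        (h j.1 (m 0 j.1 ω) (s (0, j.1, j.2) ω) - hb j.1 (m 0 j.1 ω)) := by
    intro ω
    simp only [err_zero (hb := hb) p hB₀]
    rw [Finset.sum_product]
    simp only [avg, Finset.smul_sum, smul_smul]
  simp only [e]
  refine (integral_sq_initial o hs hind p _ _).trans (le_of_eq ?_)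
  rw [Finset.card_product, Finset.card_univ, Fintype.card_fin, Finset.card_range]
  push_cast
  field_simp

omit hmove in
lemma integral_msq_err_zero_le (hK : 0 < K) (hB₀ : 1 ≤ B₀) :
    ∫ ω, msq (fun k => u 0 k ω - hb k (m 0 k ω)) ∂Pr ≤ σ ^ 2 := by
  have hB0 : (1 : ℝ) ≤ B₀ := by exact_mod_cast hB₀
  have hB0' : (0 : ℝ) < B₀ := by linarith
  have hK' : (0 : ℝ) < K := by exact_mod_cast hK
  have hone : ∀ k, ∫ ω, ‖u 0 k ω - hb k (m 0 k ω)‖ ^ 2 ∂Pr ≤ σ ^ 2 := by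
    intro k
    have e : ∀ ω, u 0 k ω - hb k (m 0 k ω) =
        ∑ j ∈ ({k} : Finset (Fin K)) ×ˢ Finset.range B₀, (B₀ : ℝ)⁻¹ •
          (h j.1 (m 0 j.1 ω) (s (0, j.1, j.2) ω) - hb j.1 (m 0 j.1 ω)) := fun ω => by
      rw [err_zero p hB₀, Finset.sum_product, Finset.sum_singleton]
    simp only [e]
    refine (integral_sq_initial o hs hind p _ _).trans ?_
    rw [Finset.card_product, Finset.card_singleton, Finset.card_range, one_mul]
    calc _ = (B₀ : ℝ)⁻¹ * σ ^ 2 := by field_simp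
      _ ≤ _ := mul_le_of_le_one_left (by positivity) (inv_le_one_of_one_le₀ hB0)
  have hi : ∀ k, Integrable (fun ω => ‖u 0 k ω - hb k (m 0 k ω)‖ ^ 2) Pr := fun k => by
    refine integrable_sq_of_memLp ?_
    simp only [err_zero (hb := hb) p hB₀]
    exact memLp_finsetSum _ fun i _ =>
      memLp_smul (o.centered hs hind i (k := k) (p.adapted_m 0 k) (p.ball 0 k)).1 _
  unfold msq
  rw [integral_const_mul, integral_finsetSum _ fun k _ => hi k]
  have hsum := Finset.sum_le_sum fun k (_ : k ∈ Finset.univ) => hone k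
  simp only [Finset.sum_const, Finset.card_univ, Fintype.card_fin, nsmul_eq_mul] at hsum
  calc _ ≤ (K : ℝ)⁻¹ * (K * σ ^ 2) := by gcongr
    _ = _ := by field_simp

/-- Variation of the individual estimators in one step. -/
lemma integral_msq_estimator_sub_le (hB₀ : 1 ≤ B₀) (hB : 1 ≤ B) (hK : 0 < K) (t : ℕ) :
    Integrable (fun ω => msq (fun k => u (t + 1) k ω - u t k ω)) Pr ∧
    ∫ ω, msq (fun k => u (t + 1) k ω - u t k ω) ∂Pr ≤
      3 * θ ^ 2 * ∫ ω, msq (fun k => u t k ω - hb k (m t k ω)) ∂Pr + 3 * θ ^ 2 * σ ^ 2 +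
        3 * L ^ 2 * ∫ ω, move (fun k => m t k ω) (fun k => m (t + 1) k ω) ∂Pr := by
  have hB0 : (0 : ℝ) < B := by exact_mod_cast hB
  have hK' : (0 : ℝ) < K := by exact_mod_cast hK
  have hi : ∀ k, Integrable (fun ω => ‖u t k ω - hb k (m t k ω)‖ ^ 2) Pr := fun k =>
    integrable_sq_of_memLp (err_memLp o hs hind p hB₀ hB t k)
  have hc := fun k i => o.centered hs hind i (k := k)
    ((p.adapted_m t k).mono (pastσ_mono s t.le_succ) le_rfl) (p.ball t k)
  have hpt : ∀ k ω, ‖u (t + 1) k ω - u t k ω‖ ^ 2 ≤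
      3 * θ ^ 2 * ‖u t k ω - hb k (m t k ω)‖ ^ 2 + 3 * θ ^ 2 * ((B : ℝ)⁻¹ *
        ∑ i ∈ Finset.range B, ‖h k (m t k ω) (s (t + 1, k, i) ω) - hb k (m t k ω)‖ ^ 2) +
      3 * L ^ 2 * sqDist (m (t + 1) k ω) (m t k ω) := by
    intro k ω
    have e : u (t + 1) k ω - u t k ω = (-θ) • (u t k ω - hb k (m t k ω)) +
        θ • (batchMean B (fun i => h k (m t k ω) (s (t + 1, k, i) ω)) - hb k (m t k ω)) +
        batchMean B (fun i => h k (m (t + 1) k ω) (s (t + 1, k, i) ω) -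
          h k (m t k ω) (s (t + 1, k, i) ω)) := by
      have : batchMean B (fun i => h k (m (t + 1) k ω) (s (t + 1, k, i) ω) -
          h k (m t k ω) (s (t + 1, k, i) ω)) =
          batchMean B (fun i => h k (m (t + 1) k ω) (s (t + 1, k, i) ω)) -
          batchMean B (fun i => h k (m t k ω) (s (t + 1, k, i) ω)) := by
        simp only [batchMean, Finset.sum_sub_distrib, smul_sub]
      rw [p.step, this]; module
    rw [e]
    refine (sq_norm_add₃_le _ _ _).trans ?_
    rw [norm_smul, norm_smul, mul_pow, mul_pow, Real.norm_eq_abs, Real.norm_eq_abs, sq_abs, sq_abs,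
      neg_sq]
    have h1 : ‖batchMean B (fun i => h k (m t k ω) (s (t + 1, k, i) ω)) - hb k (m t k ω)‖ ^ 2 ≤
        (B : ℝ)⁻¹ *
        ∑ i ∈ Finset.range B, ‖h k (m t k ω) (s (t + 1, k, i) ω) - hb k (m t k ω)‖ ^ 2 := by
      rw [batchMean_sub_const hB, ← Finset.smul_sum]
      exact sq_norm_batchMean_le B fun i => h k (m t k ω) (s (t + 1, k, i) ω) - hb k (m t k ω)
    have h2 : ‖batchMean B (fun i => h k (m (t + 1) k ω) (s (t + 1, k, i) ω) -
          h k (m t k ω) (s (t + 1, k, i) ω))‖ ^ 2 ≤ L ^ 2 * sqDist (m (t + 1) k ω) (m t k ω) := by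
      refine (sq_norm_batchMean_le _ _).trans ?_
      calc _ ≤ (B : ℝ)⁻¹ * ∑ i ∈ Finset.range B, L ^ 2 * sqDist (m (t + 1) k ω) (m t k ω) := by
            gcongr with i _
            exact o.lip k _ _ _ (p.ball _ _ _) (p.ball _ _ _)
        _ = _ := by
            rw [Finset.sum_const, Finset.card_range, nsmul_eq_mul]; field_simp
    have h3 := mul_le_mul_of_nonneg_left h1 (by positivity : 0 ≤ 3 * θ ^ 2)
    linarith
  have hR : ∀ k, Integrable (fun ω => 3 * θ ^ 2 * ‖u t k ω - hb k (m t k ω)‖ ^ 2 +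
      3 * θ ^ 2 * ((B : ℝ)⁻¹ *
        ∑ i ∈ Finset.range B, ‖h k (m t k ω) (s (t + 1, k, i) ω) - hb k (m t k ω)‖ ^ 2) +
      3 * L ^ 2 * sqDist (m (t + 1) k ω) (m t k ω)) Pr := fun k =>
    (((hi k).const_mul _).add (((integrable_finsetSum _ fun i _ =>
      integrable_sq_of_memLp (hc k i).1).const_mul _).const_mul _)).add ((hmove t k).const_mul _)
  have hum : ∀ t k, Measurable (u t k) := fun t k => (p.adapted_u t k).mono (pastσ_le hs _) le_rfl
  have hL : ∀ k, Integrable (fun ω => ‖u (t + 1) k ω - u t k ω‖ ^ 2) Pr := fun k => by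
    refine (hR k).mono' (((hum (t + 1) k).sub (hum t k)).norm.pow_const 2).aestronglyMeasurable
      (Filter.Eventually.of_forall fun ω => ?_)
    rw [Real.norm_of_nonneg (sq_nonneg _)]
    exact hpt k ω
  refine ⟨(integrable_finsetSum _ fun k _ => hL k).const_mul _, ?_⟩
  have hone : ∀ k, ∫ ω, ‖u (t + 1) k ω - u t k ω‖ ^ 2 ∂Pr ≤
      3 * θ ^ 2 * ∫ ω, ‖u t k ω - hb k (m t k ω)‖ ^ 2 ∂Pr + 3 * θ ^ 2 * σ ^ 2 +
      3 * L ^ 2 * ∫ ω, sqDist (m (t + 1) k ω) (m t k ω) ∂Pr := by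
    intro k
    refine (integral_mono (hL k) (hR k) (hpt k)).trans ?_
    rw [integral_comb₃ (hi k) ((integrable_finsetSum _ fun i _ =>
      integrable_sq_of_memLp (hc k i).1).const_mul _) (hmove t k), integral_const_mul,
      integral_finsetSum _ fun i _ => integrable_sq_of_memLp (hc k i).1]
    gcongr
    calc _ ≤ (B : ℝ)⁻¹ * ∑ i ∈ Finset.range B, σ ^ 2 := by
          gcongr with i _; exact (hc k i).2
      _ = _ := by rw [Finset.sum_const, Finset.card_range, nsmul_eq_mul]; field_simp
  rw [integral_move_eq hmove]
  unfold msq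
  rw [integral_const_mul, integral_const_mul, integral_finsetSum _ fun k _ => hL k,
    integral_finsetSum _ fun k _ => hi k]
  have hsum := Finset.sum_le_sum fun k (_ : k ∈ Finset.univ) => hone k
  simp only [Finset.sum_add_distrib, ← Finset.mul_sum, Finset.sum_const, Finset.card_univ,
    Fintype.card_fin, nsmul_eq_mul] at hsum
  refine (mul_le_mul_of_nonneg_left hsum (by positivity : 0 ≤ (K : ℝ)⁻¹)).trans (le_of_eq ?_)
  field_simp

/-- Total expected error of the averaged estimator. -/
theorem sum_integral_sq_avg_err_le (hK : 0 < K) (hB₀ : 1 ≤ B₀) (hB : 1 ≤ B) (hθ : 0 < θ)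
    (hθ1 : θ ≤ 1) (T : ℕ) :
    θ * ∑ t ∈ Finset.range T, ∫ ω, ‖avg (fun k => u t k ω - hb k (m t k ω))‖ ^ 2 ∂Pr ≤
      σ ^ 2 / (K * B₀) + (K : ℝ)⁻¹ * (T * (2 * θ ^ 2 * σ ^ 2) + 8 * L ^ 2 *
        ∑ t ∈ Finset.range T, ∫ ω, move (fun k => m t k ω) (fun k => m (t + 1) k ω) ∂Pr) := by
  have h1 := sum_le_of_recursion
    (a := fun t => ∫ ω, ‖avg (fun k => u t k ω - hb k (m t k ω))‖ ^ 2 ∂Pr) (q := θ)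
    (fun t => integral_nonneg fun _ => sq_nonneg _) T
    (fun t _ => integral_sq_avg_err_succ_le o hs hind p hmove hK hB₀ hB hθ.le hθ1 t)
  have h2 := integral_sq_avg_err_zero_le o hs hind p hK hB₀
  rw [← Finset.mul_sum, Finset.sum_add_distrib, Finset.sum_const, Finset.card_range, nsmul_eq_mul,
    ← Finset.mul_sum] at h1
  linarith

/-- Total expected variation of the individual estimators. -/
theorem sum_integral_msq_estimator_sub_le (hK : 0 < K) (hB₀ : 1 ≤ B₀) (hB : 1 ≤ B) (hθ : 0 < θ)
    (hθ1 : θ ≤ 1) (T : ℕ) :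
    ∑ t ∈ Finset.range T, ∫ ω, msq (fun k => u (t + 1) k ω - u t k ω) ∂Pr ≤
      3 * σ ^ 2 + 9 * (T * θ ^ 2 * σ ^ 2) + 27 * L ^ 2 *
        ∑ t ∈ Finset.range T, ∫ ω, move (fun k => m t k ω) (fun k => m (t + 1) k ω) ∂Pr := by
  have h1 := sum_le_of_recursion
    (a := fun t => ∫ ω, msq (fun k => u t k ω - hb k (m t k ω)) ∂Pr) (q := θ)
    (fun t => integral_nonneg fun _ => msq_nonneg _) T
    (fun t _ => integral_msq_err_succ_le o hs hind p hmove hB₀ hB hθ.le hθ1 hK t)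
  have h2 := integral_msq_err_zero_le o hs hind p hK hB₀
  have h3 := Finset.sum_le_sum fun t (_ : t ∈ Finset.range T) =>
    (integral_msq_estimator_sub_le o hs hind p hmove hB₀ hB hK t).2
  simp only [Finset.sum_add_distrib, ← Finset.mul_sum, Finset.sum_const, Finset.card_range,
    nsmul_eq_mul] at h1 h3
  set Q := ∑ t ∈ Finset.range T, ∫ ω, move (fun k => m t k ω) (fun k => m (t + 1) k ω) ∂Pr
  set e := ∑ t ∈ Finset.range T, ∫ ω, msq (fun k => u t k ω - hb k (m t k ω)) ∂Pr
  have hQ : 0 ≤ Q := Finset.sum_nonneg fun t _ => integral_nonneg fun ω => by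
    unfold move
    exact mul_nonneg (by positivity) (Finset.sum_nonneg fun k _ => sqDist_nonneg _ _)
  have h4 : θ ^ 2 * e ≤ σ ^ 2 + 2 * (T * θ ^ 2 * σ ^ 2) + 8 * L ^ 2 * Q := by
    have h0 : 0 ≤ σ ^ 2 + (T * (2 * θ ^ 2 * σ ^ 2) + 8 * L ^ 2 * Q) := by positivity
    calc θ ^ 2 * e = θ * (θ * e) := by ring
      _ ≤ θ * (σ ^ 2 + (T * (2 * θ ^ 2 * σ ^ 2) + 8 * L ^ 2 * Q)) := by gcongr; linarith
      _ ≤ 1 * (σ ^ 2 + (T * (2 * θ ^ 2 * σ ^ 2) + 8 * L ^ 2 * Q)) := by gcongr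
      _ = _ := by ring
  linarith

end Storm

/-! ### Differentiation of expectations -/

section Expectation

variable {S : Type*} [MeasurableSpace S] {n m : ℕ} {V : Type*} [NormedAddCommGroup V]
  [NormedSpace ℝ V]

lemma clm_eq_sum_smulRight (A : Vec n →L[ℝ] V) :
    A = ∑ i, ContinuousLinearMap.smulRightL ℝ (Vec n) V (EuclideanSpace.proj i)
      (A (EuclideanSpace.single i 1)) := by
  ext v
  rw [sum_apply]
  conv_lhs => rw [← (EuclideanSpace.basisFun (Fin n) ℝ).sum_repr v, map_sum]
  refine Finset.sum_congr rfl fun i _ => ?_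
  simp

/-- A random linear map is measurable if its values are. -/
lemma measurable_clm_of_apply [SecondCountableTopology V] [MeasurableSpace V] [BorelSpace V]
    {A : S → Vec n →L[ℝ] V} (h : ∀ v, Measurable fun s => A s v) : Measurable A := by
  have e : A = fun s => ∑ i, ContinuousLinearMap.smulRightL ℝ (Vec n) V (EuclideanSpace.proj i)
      (A s (EuclideanSpace.single i 1)) := funext fun s => clm_eq_sum_smulRight (A s)
  rw [e]
  exact Finset.measurable_sum _ fun i _ => (ContinuousLinearMap.measurable _).comp (h _)

lemma integrable_sum_clm {W : Type*} [NormedAddCommGroup W] [NormedSpace ℝ W] {D : Measure S}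
    {ι : Type*} [Fintype ι] (T : ι → V →L[ℝ] W) {f : ι → S → V} (hf : ∀ i, Integrable (f i) D) :
    Integrable (fun s => ∑ i, T i (f i s)) D :=
  integrable_finsetSum _ fun i _ => (T i).integrable_comp (hf i)

/-- A random linear map is integrable if its values are. -/
lemma integrable_clm_of_apply {D : Measure S} {A : S → Vec n →L[ℝ] V}
    (h : ∀ v, Integrable (fun s => A s v) D) : Integrable A D :=
  (integrable_sum_clm (fun i => ContinuousLinearMap.smulRightL ℝ (Vec n) V
    (EuclideanSpace.proj i)) fun i => h (EuclideanSpace.single i 1)).congr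
    (Filter.Eventually.of_forall fun s => (clm_eq_sum_smulRight (A s)).symm)

/-- Derivatives are limits of difference quotients, hence measurable in the sample. -/
lemma measurable_fderiv_apply [MeasurableSpace V] [BorelSpace V] [SecondCountableTopology V]
    {φ : S → Vec n → V} (hm : ∀ x, Measurable fun s => φ s x) (hd : ∀ s, Differentiable ℝ (φ s))
    (x v : Vec n) : Measurable fun s => fderiv ℝ (φ s) x v := by
  refine measurable_of_tendsto_metrizable
    (f := fun (j : ℕ) s => (j : ℝ) • (φ s (x + (j : ℝ)⁻¹ • v) - φ s x)) (fun j => ?_) ?_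
  · exact ((hm _).sub (hm _)).const_smul (j : ℝ)
  · rw [tendsto_pi_nhds]
    intro s
    exact ((hd s) x).hasFDerivAt.lim v (c := fun j : ℕ => (j : ℝ))
      (tendsto_norm_atTop_atTop.comp tendsto_natCast_atTop_atTop)

/-- The error of the linear approximation under a Lipschitz derivative. -/
lemma norm_sub_sub_fderiv_le {φ : Vec n → V} {L : ℝ} (hd : Differentiable ℝ φ)
    (hL : ∀ x x', ‖fderiv ℝ φ x - fderiv ℝ φ x'‖ ≤ L * ‖x - x'‖) (hL0 : 0 ≤ L) (x v : Vec n) :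
    ‖φ (x + v) - φ x - fderiv ℝ φ x v‖ ≤ L * ‖v‖ * ‖v‖ := by
  have := (convex_segment x (x + v)).norm_image_sub_le_of_norm_hasFDerivWithin_le' (f := φ)
    (f' := fderiv ℝ φ) (φ := fderiv ℝ φ x) (C := L * ‖v‖) (x := x) (y := x + v)
    (fun z _ => (hd z).hasFDerivAt.hasFDerivWithinAt) (fun z hz => ?_) (left_mem_segment ℝ _ _)
    (right_mem_segment ℝ _ _)
  · simpa using this
  · refine (hL z x).trans ?_
    gcongr
    have := norm_sub_le_of_mem_segment hz
    simpa using this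

/-- Differentiation under the expectation, for sample functions with uniformly Lipschitz
derivatives. -/
lemma hasFDerivAt_expectation [MeasurableSpace V] [BorelSpace V] [SecondCountableTopology V]
    [CompleteSpace V] {D : Measure S} [IsProbabilityMeasure D] {φ : S → Vec n → V} {L : ℝ}
    (hm : ∀ x, Measurable fun s => φ s x) (hi : ∀ x, Integrable (fun s => φ s x) D)
    (hd : ∀ s, Differentiable ℝ (φ s)) (hL0 : 0 ≤ L)
    (hL : ∀ s x x', ‖fderiv ℝ (φ s) x - fderiv ℝ (φ s) x'‖ ≤ L * ‖x - x'‖) (x : Vec n) :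
    Integrable (fun s => fderiv ℝ (φ s) x) D ∧
      HasFDerivAt (fun x => ∫ s, φ s x ∂D) (∫ s, fderiv ℝ (φ s) x ∂D) x := by
  have hint : Integrable (fun s => fderiv ℝ (φ s) x) D := by
    refine integrable_clm_of_apply fun v => ?_
    refine (((hi (x + v)).sub (hi x)).norm.add (integrable_const (L * ‖v‖ * ‖v‖))).mono'
      (measurable_fderiv_apply hm hd x v).aestronglyMeasurable
      (Filter.Eventually.of_forall fun s => ?_)
    have h1 := norm_sub_sub_fderiv_le (hd s) (hL s) hL0 x v
    have h2 := norm_sub_norm_le (fderiv ℝ (φ s) x v) (φ s (x + v) - φ s x)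
    rw [norm_sub_rev] at h1
    simp only [Pi.add_apply, Pi.sub_apply]
    linarith
  refine ⟨hint, hasFDerivAt_integral_of_dominated_of_fderiv_le (F := fun x s => φ s x)
    (F' := fun x s => fderiv ℝ (φ s) x) (bound := fun s => ‖fderiv ℝ (φ s) x‖ + L)
    (Metric.ball_mem_nhds x one_pos)
    (Filter.Eventually.of_forall fun z => (hm z).aestronglyMeasurable) (hi x)
    hint.aestronglyMeasurable (Filter.Eventually.of_forall fun s z hz => ?_)
    (hint.norm.add (integrable_const L))
    (Filter.Eventually.of_forall fun s z _ => (hd s z).hasFDerivAt)⟩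
  have h1 := hL s z x
  have h2 := norm_sub_norm_le (fderiv ℝ (φ s) z) (fderiv ℝ (φ s) x)
  have h3 : L * ‖z - x‖ ≤ L * 1 := by
    gcongr; rw [Metric.mem_ball, dist_eq_norm] at hz; exact hz.le
  linarith

/-- The Riesz isomorphism as a linear map over the reals. -/
def rieszCLM (n : ℕ) : Vec n →L[ℝ] StrongDual ℝ (Vec n) :=
  LinearMap.mkContinuous
    { toFun := fun v => InnerProductSpace.toDual ℝ (Vec n) v
      map_add' := fun v w => map_add _ v w
      map_smul' := fun c v => by simp } 1 fun v => by simp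

/-- The inverse of the Riesz isomorphism as a linear map over the reals. -/
def rieszSymmCLM (n : ℕ) : StrongDual ℝ (Vec n) →L[ℝ] Vec n :=
  LinearMap.mkContinuous
    { toFun := fun v => (InnerProductSpace.toDual ℝ (Vec n)).symm v
      map_add' := fun v w => map_add _ v w
      map_smul' := fun c v => by simp } 1 fun v => by simp

lemma inner_gradient (φ : Vec n → ℝ) (x v : Vec n) : ⟪gradient φ x, v⟫ = fderiv ℝ φ x v := by
  rw [gradient, InnerProductSpace.toDual_symm_apply]

lemma norm_fderiv_sub_eq (φ : Vec n → ℝ) (x x' : Vec n) :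
    ‖fderiv ℝ φ x - fderiv ℝ φ x'‖ = ‖gradient φ x - gradient φ x'‖ := by
  rw [gradient, gradient, ← map_sub, LinearIsometryEquiv.norm_map]

/-- A random vector is measurable if its inner products are. -/
lemma measurable_of_inner {f : S → Vec n} (h : ∀ v, Measurable fun s => ⟪f s, v⟫) :
    Measurable f := by
  have e : f = fun s => ∑ i, (⟪f s, EuclideanSpace.single i 1⟫) • EuclideanSpace.single i 1 := by
    funext s
    conv_lhs => rw [← (EuclideanSpace.basisFun (Fin n) ℝ).sum_repr' (f s)]
    simp [real_inner_comm]
  rw [e]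
  exact Finset.measurable_sum _ fun i _ => (h _).smul_const _

/-- The gradient of an expectation is the expectation of the gradient. -/
lemma hasGradientAt_expectation {D : Measure S} [IsProbabilityMeasure D] {φ : S → Vec n → ℝ}
    {L : ℝ} (hm : ∀ x, Measurable fun s => φ s x) (hi : ∀ x, Integrable (fun s => φ s x) D)
    (hd : ∀ s, Differentiable ℝ (φ s)) (hL0 : 0 ≤ L)
    (hL : ∀ s x x', ‖gradient (φ s) x - gradient (φ s) x'‖ ≤ L * ‖x - x'‖) (x : Vec n) :
    Measurable (fun s => gradient (φ s) x) ∧ Integrable (fun s => gradient (φ s) x) D ∧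
      HasGradientAt (fun x => ∫ s, φ s x ∂D) (∫ s, gradient (φ s) x ∂D) x := by
  obtain ⟨h1, h2⟩ := hasFDerivAt_expectation hm hi hd hL0
    (fun s x x' => (norm_fderiv_sub_eq (φ s) x x').le.trans (hL s x x')) x
  have e : ∀ s, gradient (φ s) x = rieszSymmCLM n (fderiv ℝ (φ s) x) := fun s => rfl
  refine ⟨measurable_of_inner fun v => ?_, ?_, ?_⟩
  · simp only [inner_gradient]
    exact measurable_fderiv_apply hm hd x v
  · simp only [e]
    exact (rieszSymmCLM n).integrable_comp h1
  · rw [hasGradientAt_iff_hasFDerivAt]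
    have e2 : InnerProductSpace.toDual ℝ (Vec n) (∫ s, gradient (φ s) x ∂D) =
        ∫ s, fderiv ℝ (φ s) x ∂D := by
      simp only [e]
      rw [(rieszSymmCLM n).integral_comp_comm h1]
      exact LinearIsometryEquiv.apply_symm_apply _ _
    rw [e2]
    exact h2

/-- The adjoint as a continuous linear map. -/
def adjointCLM (n m : ℕ) : (Vec n →L[ℝ] Vec m) →L[ℝ] (Vec m →L[ℝ] Vec n) :=
  LinearMap.mkContinuous
    { toFun := fun A => ContinuousLinearMap.adjoint A
      map_add' := fun A B => map_add _ A B
      map_smul' := fun c A => by simp } 1 fun A => by simp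

lemma adjointCLM_apply (A : Vec n →L[ℝ] Vec m) :
    adjointCLM n m A = ContinuousLinearMap.adjoint A := rfl

end Expectation

section JointLip

variable {dx dy : ℕ} {V : Type*} [NormedAddCommGroup V] {L : ℝ} {h : Vec dx → Vec dy → V}

lemma JointLip.left (hh : JointLip L h) (x x' : Vec dx) (y : Vec dy) :
    ‖h x y - h x' y‖ ≤ L * ‖x - x'‖ := by
  simpa using hh x y x' y

lemma JointLip.right (hh : JointLip L h) (x : Vec dx) (y y' : Vec dy) :
    ‖h x y - h x y'‖ ≤ L * ‖y - y'‖ := by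
  simpa using hh x y x y'

lemma JointLip.continuous (hh : JointLip L h) :
    Continuous fun p : Vec dx × Vec dy => h p.1 p.2 := by
  rw [continuous_iff_continuousAt]
  intro p
  rw [ContinuousAt, tendsto_iff_norm_sub_tendsto_zero]
  have hc : Continuous fun q : Vec dx × Vec dy => L * √(‖q.1 - p.1‖ ^ 2 + ‖q.2 - p.2‖ ^ 2) := by
    fun_prop
  refine squeeze_zero (fun _ => norm_nonneg _) (fun q => hh q.1 q.2 p.1 p.2) ?_
  simpa using hc.tendsto p

/-- Squared form of the Lipschitz condition. -/
lemma JointLip.sq_le (hh : JointLip L h) (x x' : Vec dx) (y y' : Vec dy) :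
    ‖h x y - h x' y'‖ ^ 2 ≤ L ^ 2 * (‖x - x'‖ ^ 2 + ‖y - y'‖ ^ 2) := by
  calc _ ≤ (L * √(‖x - x'‖ ^ 2 + ‖y - y'‖ ^ 2)) ^ 2 := by gcongr; exact hh x y x' y'
    _ = _ := by rw [mul_pow, Real.sq_sqrt (by positivity)]

variable {S : Type*} [MeasurableSpace S] [NormedSpace ℝ V]

/-- Expectations of uniformly Lipschitz maps. -/
lemma JointLip.expectation {D : Measure S} [IsProbabilityMeasure D] {h : S → Vec dx → Vec dy → V}
    (hh : ∀ s, JointLip L (h s)) (hi : ∀ x y, Integrable (fun s => h s x y) D) :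
    JointLip L fun x y => ∫ s, h s x y ∂D := by
  intro x y x' y'
  rw [← integral_sub (hi x y) (hi x' y')]
  have h1 := norm_integral_le_of_norm_le_const (μ := D) (f := fun s => h s x y - h s x' y')
    (Filter.Eventually.of_forall fun s => hh s x y x' y')
  rwa [probReal_univ, mul_one] at h1

lemma JointLip.average {K : ℕ} (hK : 0 < K) {h : Fin K → Vec dx → Vec dy → V}
    (hh : ∀ k, JointLip L (h k)) : JointLip L fun x y => (K : ℝ)⁻¹ • ∑ k, h k x y := by
  intro x y x' y'
  have hK' : (0 : ℝ) < K := by exact_mod_cast hK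
  rw [← smul_sub, ← Finset.sum_sub_distrib, norm_smul, norm_inv, Real.norm_of_nonneg hK'.le]
  calc _ ≤ (K : ℝ)⁻¹ * ∑ k : Fin K, L * √(‖x - x'‖ ^ 2 + ‖y - y'‖ ^ 2) := by
        gcongr
        exact (norm_sum_le _ _).trans (Finset.sum_le_sum fun k _ => hh k x y x' y')
    _ = _ := by
        rw [Finset.sum_const, Finset.card_univ, Fintype.card_fin, nsmul_eq_mul]; field_simp

end JointLip

/-! ### Strongly monotone gradients and the hypergradient -/

section Hypergradient

variable {dx dy n : ℕ}

/-- A map with coercive derivative is strongly monotone. -/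
lemma strong_mono_of_fderiv {g : Vec n → Vec n} {B : Vec n → Vec n →L[ℝ] Vec n} {μ : ℝ}
    (hg : ∀ y, HasFDerivAt g (B y) y) (hB : ∀ y v, μ * ‖v‖ ^ 2 ≤ ⟪B y v, v⟫) (y y' : Vec n) :
    μ * ‖y - y'‖ ^ 2 ≤ ⟪g y - g y', y - y'⟫ := by
  set d := y - y' with hd
  have hp : ∀ t : ℝ, HasDerivAt (fun t : ℝ => y' + t • d) d t := fun t => by
    simpa using ((hasDerivAt_id t).smul_const d).const_add y'
  have h1 : ∀ t : ℝ, HasDerivAt (fun t : ℝ => ⟪g (y' + t • d), d⟫) ⟪B (y' + t • d) d, d⟫ t :=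
    fun t => by
      have := ((hg (y' + t • d)).comp_hasDerivAt t (hp t)).inner ℝ (hasDerivAt_const t d)
      simpa using this
  have h2 := mul_sub_le_image_sub_of_le_deriv (fun t => (h1 t).differentiableAt)
    (C := μ * ‖d‖ ^ 2) (fun t => by rw [(h1 t).deriv]; exact hB _ _) zero_le_one
  rw [inner_sub_left]
  simpa [hd] using h2

/-- A critical point of a function with monotone gradient is a minimizer. -/
lemma le_of_gradient_eq_zero {φ : Vec n → ℝ} {g : Vec n → Vec n} {μ : ℝ} (hμ : 0 ≤ μ)
    (hφ : ∀ y, HasGradientAt φ (g y) y)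
    (hmono : ∀ y y', μ * ‖y - y'‖ ^ 2 ≤ ⟪g y - g y', y - y'⟫) {y₀ : Vec n} (h0 : g y₀ = 0)
    (y : Vec n) : φ y₀ ≤ φ y := by
  set d := y - y₀ with hd
  have hp : ∀ t : ℝ, HasDerivAt (fun t : ℝ => y₀ + t • d) d t := fun t => by
    simpa using ((hasDerivAt_id t).smul_const d).const_add y₀
  have h1 : ∀ t : ℝ, HasDerivAt (fun t : ℝ => φ (y₀ + t • d)) ⟪g (y₀ + t • d), d⟫ t := fun t => by
    have := (hφ (y₀ + t • d)).hasFDerivAt.comp_hasDerivAt t (hp t)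
    rw [InnerProductSpace.toDual_apply_apply] at this
    exact this
  have h2 : MonotoneOn (fun t : ℝ => φ (y₀ + t • d)) (Set.Ici 0) := by
    refine monotoneOn_of_deriv_nonneg (convex_Ici 0)
      (fun t _ => (h1 t).continuousAt.continuousWithinAt)
      (fun t _ => (h1 t).differentiableAt.differentiableWithinAt) fun t ht => ?_
    rw [interior_Ici, Set.mem_Ioi] at ht
    rw [(h1 t).deriv]
    have h3 := hmono (y₀ + t • d) y₀
    rw [h0, sub_zero, add_sub_cancel_left, inner_smul_right] at h3
    have : 0 ≤ t * ⟪g (y₀ + t • d), d⟫ := le_trans (by positivity) h3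
    exact nonneg_of_mul_nonneg_right this ht
  have h3 := h2 (Set.mem_Ici.2 le_rfl) (Set.mem_Ici.2 zero_le_one) zero_le_one
  simpa [hd] using h3

/-- A Lipschitz, strongly monotone vector field has a zero, the fixed point of a small step. -/
lemma exists_zero_of_strong_mono {g : Vec n → Vec n} {μ L : ℝ} (hμ : 0 < μ)
    (hL : ∀ y y', ‖g y - g y'‖ ≤ L * ‖y - y'‖)
    (hmono : ∀ y y', μ * ‖y - y'‖ ^ 2 ≤ ⟪g y - g y', y - y'⟫) : ∃ y, g y = 0 := by
  -- a step size `γ` with `γ L² ≤ μ` and `γ μ ≤ 1`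
  set γ : ℝ := μ / (L ^ 2 + μ ^ 2) with hγ
  have hden : 0 < L ^ 2 + μ ^ 2 := by positivity
  have hγ0 : 0 < γ := by positivity
  have hγμ : γ * μ ≤ 1 := by
    rw [hγ, div_mul_eq_mul_div, div_le_one hden]; nlinarith [sq_nonneg L]
  have hγL : γ * L ^ 2 ≤ μ := by
    rw [hγ, div_mul_eq_mul_div, div_le_iff₀ hden]
    nlinarith [mul_nonneg hμ.le (sq_nonneg μ)]
  have hcontr : ∀ y y', ‖(y - γ • g y) - (y' - γ • g y')‖ ≤ √(1 - γ * μ) * ‖y - y'‖ := by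
    intro y y'
    have e : (y - γ • g y) - (y' - γ • g y') = (y - y') - γ • (g y - g y') := by module
    have h1 : ‖(y - y') - γ • (g y - g y')‖ ^ 2 ≤ (1 - γ * μ) * ‖y - y'‖ ^ 2 := by
      rw [norm_sub_sq_real, inner_smul_right, norm_smul, mul_pow, Real.norm_eq_abs, sq_abs,
        real_inner_comm]
      have h2 := hmono y y'
      have h3 : ‖g y - g y'‖ ^ 2 ≤ L ^ 2 * ‖y - y'‖ ^ 2 := by
        rw [← mul_pow]; gcongr; exact hL y y'
      have h4 : γ ^ 2 * ‖g y - g y'‖ ^ 2 ≤ γ * (μ * ‖y - y'‖ ^ 2) := by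
        calc _ ≤ γ ^ 2 * (L ^ 2 * ‖y - y'‖ ^ 2) := by gcongr
          _ = γ * (γ * L ^ 2 * ‖y - y'‖ ^ 2) := by ring
          _ ≤ _ := by gcongr
      have h5 := mul_le_mul_of_nonneg_left h2 hγ0.le
      linarith
    rw [e]
    refine abs_le_of_sq_le_sq' ?_ (by positivity) |>.2
    rw [mul_pow, Real.sq_sqrt (by linarith)]
    exact h1
  have hc : ContractingWith (√(1 - γ * μ)).toNNReal (fun y => y - γ • g y) := by
    constructor
    · rw [← NNReal.coe_lt_coe, Real.coe_toNNReal _ (Real.sqrt_nonneg _), NNReal.coe_one,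
        Real.sqrt_lt' one_pos]
      nlinarith [mul_pos hγ0 hμ]
    · refine LipschitzWith.of_dist_le_mul fun y y' => ?_
      rw [dist_eq_norm, dist_eq_norm, Real.coe_toNNReal _ (Real.sqrt_nonneg _)]
      exact hcontr y y'
  refine ⟨hc.fixedPoint, ?_⟩
  have h1 : hc.fixedPoint - γ • g hc.fixedPoint = hc.fixedPoint := hc.fixedPoint_isFixedPt
  rw [sub_eq_self, smul_eq_zero] at h1
  exact h1.resolve_left hγ0.ne'

/-- The derivative of a gradient is symmetric. -/
lemma inner_hessian_symm {φ : Vec n → ℝ} {g : Vec n → Vec n} {B : Vec n →L[ℝ] Vec n} {y : Vec n}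
    (hφ : ∀ y, HasGradientAt φ (g y) y) (hg : HasFDerivAt g B y) (u v : Vec n) :
    ⟪B u, v⟫ = ⟪u, B v⟫ := by
  have h1 : ∀ y, HasFDerivAt φ (InnerProductSpace.toDual ℝ (Vec n) (g y)) y :=
    fun y => (hφ y).hasFDerivAt
  have h2 : HasFDerivAt (fun y => InnerProductSpace.toDual ℝ (Vec n) (g y)) ((rieszCLM n).comp B)
      y := (rieszCLM n).hasFDerivAt.comp y hg
  have h3 : ⟪B u, v⟫ = ⟪B v, u⟫ := second_derivative_symmetric h1 h2 u v
  rw [h3, real_inner_comm]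

/-- A coercive linear map of a finite-dimensional space is onto. -/
lemma exists_apply_eq_of_coercive {B : Vec n →L[ℝ] Vec n} {μ : ℝ} (hμ : 0 < μ)
    (hB : ∀ v, μ * ‖v‖ ^ 2 ≤ ⟪B v, v⟫) (w : Vec n) : ∃ z, B z = w := by
  have hinj : Function.Injective B.toLinearMap := by
    rw [← LinearMap.ker_eq_bot, LinearMap.ker_eq_bot']
    intro v hv
    have h1 := hB v
    rw [show B v = 0 from hv, inner_zero_left] at h1
    have h2 : ‖v‖ ^ 2 ≤ 0 := by nlinarith [sq_nonneg ‖v‖]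
    simpa using h2
  exact LinearMap.surjective_of_injective hinj w

/-- The hypergradient: along the zeros `y = ys x` of `G`, the gradient of `x ↦ f (x, ys x)` is
`∇₁ f - (∂₁ G)ᵀ z`, where `z` solves `∂₂ G z = ∇₂ f`. Only the Lipschitz continuity of `ys` is
needed: its first-order variation enters through `G (x, ys x) = 0`. -/
lemma hasGradientAt_hyper {f : Vec dx → Vec dy → ℝ} {f₁ : Vec dx → Vec dy → Vec dx}
    {f₂ : Vec dx → Vec dy → Vec dy} {G : Vec dx → Vec dy → Vec dy}
    {A : Vec dx → Vec dy → Vec dx →L[ℝ] Vec dy} {B : Vec dx → Vec dy → Vec dy →L[ℝ] Vec dy}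
    {ys : Vec dx → Vec dy} {C : ℝ}
    (h₁ : ∀ x y, HasGradientAt (fun x => f x y) (f₁ x y) x)
    (h₂ : ∀ x y, HasGradientAt (fun y => f x y) (f₂ x y) y)
    (c₁ : Continuous fun p : Vec dx × Vec dy => f₁ p.1 p.2)
    (c₂ : Continuous fun p : Vec dx × Vec dy => f₂ p.1 p.2)
    (hA : ∀ x y, HasFDerivAt (fun x => G x y) (A x y) x)
    (hB : ∀ x y, HasFDerivAt (fun y => G x y) (B x y) y)
    (cA : Continuous fun p : Vec dx × Vec dy => A p.1 p.2)
    (cB : Continuous fun p : Vec dx × Vec dy => B p.1 p.2)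
    (hsymm : ∀ x y u v, ⟪B x y u, v⟫ = ⟪u, B x y v⟫)
    (hzero : ∀ x, G x (ys x) = 0) (hys : ∀ x x', ‖ys x - ys x'‖ ≤ C * ‖x - x'‖)
    {x : Vec dx} {z : Vec dy} (hz : B x (ys x) z = f₂ x (ys x)) :
    HasGradientAt (fun x => f x (ys x)) (f₁ x (ys x) - ContinuousLinearMap.adjoint (A x (ys x)) z)
      x := by
  have hF : HasFDerivAt (fun p : Vec dx × Vec dy => f p.1 p.2)
      ((InnerProductSpace.toDual ℝ _ (f₁ x (ys x))).coprod
        (InnerProductSpace.toDual ℝ _ (f₂ x (ys x)))) (x, ys x) :=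
    (hasStrictFDerivAt_uncurry_coprod (u := (x, ys x)) (f := f)
      (f₁ := fun x y => InnerProductSpace.toDual ℝ _ (f₁ x y))
      (f₂ := fun x y => InnerProductSpace.toDual ℝ _ (f₂ x y))
      (Filter.Eventually.of_forall fun v => (h₁ v.1 v.2).hasFDerivAt)
      (Filter.Eventually.of_forall fun v => (h₂ v.1 v.2).hasFDerivAt)
      ((LinearIsometryEquiv.continuous _).comp c₁).continuousAt
      ((LinearIsometryEquiv.continuous _).comp c₂).continuousAt).hasFDerivAt
  have hG : HasFDerivAt (fun p : Vec dx × Vec dy => G p.1 p.2)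
      ((A x (ys x)).coprod (B x (ys x))) (x, ys x) :=
    (hasStrictFDerivAt_uncurry_coprod (u := (x, ys x)) (f := G) (f₁ := A) (f₂ := B)
      (Filter.Eventually.of_forall fun v => hA v.1 v.2)
      (Filter.Eventually.of_forall fun v => hB v.1 v.2) cA.continuousAt
      cB.continuousAt).hasFDerivAt
  have hcont : Filter.Tendsto (fun x' => (x', ys x')) (nhds x) (nhds (x, ys x)) := by
    refine Filter.Tendsto.prodMk_nhds Filter.tendsto_id ?_
    rw [tendsto_iff_norm_sub_tendsto_zero]
    refine squeeze_zero (fun _ => norm_nonneg _) (fun x' => hys x' x) ?_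
    have : Continuous fun x' : Vec dx => C * ‖x' - x‖ := by fun_prop
    simpa using this.tendsto x
  have hO : (fun x' => ((x', ys x') : Vec dx × Vec dy) - (x, ys x)) =O[nhds x]
      fun x' => x' - x := by
    refine Asymptotics.IsBigO.of_bound (max 1 C) (Filter.Eventually.of_forall fun x' => ?_)
    rw [Prod.mk_sub_mk, Prod.norm_def]
    refine max_le ?_ ((hys x' x).trans (by gcongr; exact le_max_right _ _))
    exact le_mul_of_one_le_left (norm_nonneg _) (le_max_left _ _)
  have oF := (hF.isLittleO.comp_tendsto hcont).trans_isBigO hO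
  have oG := (hG.isLittleO.comp_tendsto hcont).trans_isBigO hO
  have oGz : (fun x' => ⟪z, A x (ys x) (x' - x) + B x (ys x) (ys x' - ys x)⟫) =o[nhds x]
      fun x' => x' - x := by
    refine Asymptotics.IsBigO.trans_isLittleO (g := fun x' =>
      A x (ys x) (x' - x) + B x (ys x) (ys x' - ys x)) ?_ ?_
    · exact Asymptotics.IsBigO.of_bound ‖z‖
        (Filter.Eventually.of_forall fun x' => norm_inner_le_norm _ _)
    · refine oG.neg_left.congr_left fun x' => ?_
      simp [hzero]
  rw [hasGradientAt_iff_hasFDerivAt, hasFDerivAt_iff_isLittleO]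
  refine (oF.add oGz).congr_left fun x' => ?_
  simp only [Function.comp_apply, Prod.mk_sub_mk, ContinuousLinearMap.coprod_apply,
    InnerProductSpace.toDual_apply_apply, inner_sub_left, inner_add_right,
    ContinuousLinearMap.adjoint_inner_left, ← hz, hsymm]
  ring

end Hypergradient

/-! ### The expected losses and their derivatives -/

namespace Problem

variable {K dx dy : ℕ} {Ξ Z : Type*} [MeasurableSpace Ξ] [MeasurableSpace Z]
  {P : Problem K dx dy Ξ Z} {c : Constants}

namespace Regular

variable (h : P.Regular c)
include h

lemma expect_grad₁_f (k : Fin K) (x : Vec dx) (y : Vec dy) :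
    Measurable (fun ξ => grad₁ (P.fS k ξ) x y) ∧
      Integrable (fun ξ => grad₁ (P.fS k ξ) x y) (P.Df k) ∧
      HasGradientAt (fun x => P.fLoc k x y) (∫ ξ, grad₁ (P.fS k ξ) x y ∂(P.Df k)) x :=
  have := h.prob_f k
  hasGradientAt_expectation (φ := fun ξ x => P.fS k ξ x y) (fun x => h.meas_f k x y)
    (fun x => h.int_f k x y) (fun ξ => h.diff_f₁ k ξ y) c.lfx_pos.le
    (fun ξ x x' => (h.lip_f₁ k ξ).left x x' y) x

lemma expect_grad₂_f (k : Fin K) (x : Vec dx) (y : Vec dy) :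
    Measurable (fun ξ => grad₂ (P.fS k ξ) x y) ∧
      Integrable (fun ξ => grad₂ (P.fS k ξ) x y) (P.Df k) ∧
      HasGradientAt (fun y => P.fLoc k x y) (∫ ξ, grad₂ (P.fS k ξ) x y ∂(P.Df k)) y :=
  have := h.prob_f k
  hasGradientAt_expectation (φ := fun ξ y => P.fS k ξ x y) (fun y => h.meas_f k x y)
    (fun y => h.int_f k x y) (fun ξ => h.diff_f₂ k ξ x) c.lfy_pos.le
    (fun ξ y y' => (h.lip_f₂ k ξ).right x y y') y

lemma expect_grad₂_g (k : Fin K) (x : Vec dx) (y : Vec dy) :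
    Measurable (fun ζ => grad₂ (P.gS k ζ) x y) ∧
      Integrable (fun ζ => grad₂ (P.gS k ζ) x y) (P.Dg k) ∧
      HasGradientAt (fun y => P.gLoc k x y) (∫ ζ, grad₂ (P.gS k ζ) x y ∂(P.Dg k)) y :=
  have := h.prob_g k
  hasGradientAt_expectation (φ := fun ζ y => P.gS k ζ x y) (fun y => h.meas_g k x y)
    (fun y => h.int_g k x y) (fun ζ => h.diff_g₂ k ζ x) c.lgy_pos.le
    (fun ζ y y' => (h.lip_g₂ k ζ).right x y y') y

lemma grad₁_fLoc (k : Fin K) (x : Vec dx) (y : Vec dy) :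
    grad₁ (P.fLoc k) x y = ∫ ξ, grad₁ (P.fS k ξ) x y ∂(P.Df k) :=
  (h.expect_grad₁_f k x y).2.2.gradient

lemma grad₂_fLoc (k : Fin K) (x : Vec dx) (y : Vec dy) :
    grad₂ (P.fLoc k) x y = ∫ ξ, grad₂ (P.fS k ξ) x y ∂(P.Df k) :=
  (h.expect_grad₂_f k x y).2.2.gradient

lemma grad₂_gLoc (k : Fin K) (x : Vec dx) (y : Vec dy) :
    grad₂ (P.gLoc k) x y = ∫ ζ, grad₂ (P.gS k ζ) x y ∂(P.Dg k) :=
  (h.expect_grad₂_g k x y).2.2.gradient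

lemma lip_grad₁_fLoc (k : Fin K) : JointLip c.lfx (grad₁ (P.fLoc k)) := by
  have := h.prob_f k
  rw [show grad₁ (P.fLoc k) = _ from funext₂ (h.grad₁_fLoc k)]
  exact JointLip.expectation (h.lip_f₁ k) fun x y => (h.expect_grad₁_f k x y).2.1

lemma lip_grad₂_fLoc (k : Fin K) : JointLip c.lfy (grad₂ (P.fLoc k)) := by
  have := h.prob_f k
  rw [show grad₂ (P.fLoc k) = _ from funext₂ (h.grad₂_fLoc k)]
  exact JointLip.expectation (h.lip_f₂ k) fun x y => (h.expect_grad₂_f k x y).2.1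

lemma norm_grad₂_fLoc_le (k : Fin K) (x : Vec dx) (y : Vec dy) :
    ‖grad₂ (P.fLoc k) x y‖ ≤ c.cfy := by
  have := h.prob_f k
  rw [h.grad₂_fLoc]
  have h1 := norm_integral_le_of_norm_le_const (μ := P.Df k)
    (f := fun ξ => grad₂ (P.fS k ξ) x y) (Filter.Eventually.of_forall fun ξ => h.bdd_f₂ k ξ x y)
  rwa [probReal_univ, mul_one] at h1

/-- The Jacobian in `x` of `∇₂ g`, of which `∇²₁₂ g` is the transpose. -/
lemma lip_jacobian (k : Fin K) (ζ : Z) :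
    JointLip c.lgxy fun x y => fderiv ℝ (fun x' => grad₂ (P.gS k ζ) x' y) x := fun x y x' y' => by
  have h1 := h.lip_g₁₂ k ζ x y x' y'
  unfold hess₁₂ at h1
  rwa [← map_sub, LinearIsometryEquiv.norm_map] at h1

lemma expect_jacobian (k : Fin K) (x : Vec dx) (y : Vec dy) :
    Integrable (fun ζ => fderiv ℝ (fun x' => grad₂ (P.gS k ζ) x' y) x) (P.Dg k) ∧
      HasFDerivAt (fun x => grad₂ (P.gLoc k) x y)
        (∫ ζ, fderiv ℝ (fun x' => grad₂ (P.gS k ζ) x' y) x ∂(P.Dg k)) x := by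
  have := h.prob_g k
  have h1 := hasFDerivAt_expectation (D := P.Dg k) (φ := fun ζ x => grad₂ (P.gS k ζ) x y)
    (fun x => (h.expect_grad₂_g k x y).1) (fun x => (h.expect_grad₂_g k x y).2.1)
    (fun ζ => h.diff_g₁₂ k ζ y) c.lgxy_pos.le (fun ζ x x' => (h.lip_jacobian k ζ).left x x' y) x
  simpa only [← h.grad₂_gLoc] using h1

lemma expect_hess₂₂ (k : Fin K) (x : Vec dx) (y : Vec dy) :
    Integrable (fun ζ => hess₂₂ (P.gS k ζ) x y) (P.Dg k) ∧
      HasFDerivAt (fun y => grad₂ (P.gLoc k) x y) (∫ ζ, hess₂₂ (P.gS k ζ) x y ∂(P.Dg k)) y := by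
  have := h.prob_g k
  have h1 := hasFDerivAt_expectation (D := P.Dg k) (φ := fun ζ y => grad₂ (P.gS k ζ) x y)
    (fun y => (h.expect_grad₂_g k x y).1) (fun y => (h.expect_grad₂_g k x y).2.1)
    (fun ζ => h.diff_g₂₂ k ζ x) c.lgyy_pos.le (fun ζ y y' => (h.lip_g₂₂ k ζ).right x y y') y
  simp only [← h.grad₂_gLoc] at h1
  exact h1

lemma measurable_hess₂₂ (k : Fin K) (x : Vec dx) (y : Vec dy) :
    Measurable fun ζ => hess₂₂ (P.gS k ζ) x y :=
  measurable_clm_of_apply fun v => measurable_fderiv_apply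
    (φ := fun ζ y => grad₂ (P.gS k ζ) x y) (fun y => (h.expect_grad₂_g k x y).1)
    (fun ζ => h.diff_g₂₂ k ζ x) y v

lemma measurable_hess₁₂ (k : Fin K) (x : Vec dx) (y : Vec dy) :
    Measurable fun ζ => hess₁₂ (P.gS k ζ) x y := by
  have h1 : Measurable fun ζ => fderiv ℝ (fun x' => grad₂ (P.gS k ζ) x' y) x :=
    measurable_clm_of_apply fun v => measurable_fderiv_apply
      (φ := fun ζ x => grad₂ (P.gS k ζ) x y) (fun x => (h.expect_grad₂_g k x y).1)
      (fun ζ => h.diff_g₁₂ k ζ y) x v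
  exact (adjointCLM dx dy).continuous.measurable.comp h1

lemma integrable_hess₁₂ (k : Fin K) (x : Vec dx) (y : Vec dy) :
    Integrable (fun ζ => hess₁₂ (P.gS k ζ) x y) (P.Dg k) :=
  (adjointCLM dx dy).integrable_comp (h.expect_jacobian k x y).1

lemma hess₂₂_gLoc (k : Fin K) (x : Vec dx) (y : Vec dy) :
    hess₂₂ (P.gLoc k) x y = ∫ ζ, hess₂₂ (P.gS k ζ) x y ∂(P.Dg k) :=
  (h.expect_hess₂₂ k x y).2.fderiv

lemma hess₁₂_gLoc (k : Fin K) (x : Vec dx) (y : Vec dy) :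
    hess₁₂ (P.gLoc k) x y = ∫ ζ, hess₁₂ (P.gS k ζ) x y ∂(P.Dg k) := by
  have h1 := (adjointCLM dx dy).integral_comp_comm (h.expect_jacobian k x y).1
  rw [← (h.expect_jacobian k x y).2.fderiv] at h1
  exact h1.symm

lemma lip_hess₂₂_gLoc (k : Fin K) : JointLip c.lgyy (hess₂₂ (P.gLoc k)) := by
  have := h.prob_g k
  rw [show hess₂₂ (P.gLoc k) = _ from funext₂ (h.hess₂₂_gLoc k)]
  exact JointLip.expectation (h.lip_g₂₂ k) fun x y => (h.expect_hess₂₂ k x y).1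

lemma hasFDerivAt_jacobian_gLoc (k : Fin K) (x : Vec dx) (y : Vec dy) :
    HasFDerivAt (fun x => grad₂ (P.gLoc k) x y) (fderiv ℝ (fun x => grad₂ (P.gLoc k) x y) x) x :=
  (h.expect_jacobian k x y).2.differentiableAt.hasFDerivAt

lemma hasFDerivAt_hess₂₂_gLoc (k : Fin K) (x : Vec dx) (y : Vec dy) :
    HasFDerivAt (fun y => grad₂ (P.gLoc k) x y) (hess₂₂ (P.gLoc k) x y) y :=
  (h.expect_hess₂₂ k x y).2.differentiableAt.hasFDerivAt

lemma lip_jacobian_gLoc (k : Fin K) :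
    JointLip c.lgxy fun x y => fderiv ℝ (fun x => grad₂ (P.gLoc k) x y) x := by
  have := h.prob_g k
  rw [show (fun x y => fderiv ℝ (fun x => grad₂ (P.gLoc k) x y) x) = _ from
    funext₂ fun x y => (h.expect_jacobian k x y).2.fderiv]
  exact JointLip.expectation (h.lip_jacobian k) fun x y => (h.expect_jacobian k x y).1

/-- The sample Hessians are bounded because the gradients are Lipschitz. -/
lemma norm_hess₂₂_le (k : Fin K) (ζ : Z) (x : Vec dx) (y : Vec dy) :
    ‖hess₂₂ (P.gS k ζ) x y‖ ≤ c.lgy :=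
  norm_fderiv_le_of_lip' ℝ c.lgy_pos.le
    (Filter.Eventually.of_forall fun y' => (h.lip_g₂ k ζ).right x y' y)

lemma hess₂₂_gLoc_coercive (k : Fin K) (x : Vec dx) (y v : Vec dy) :
    c.μ * ‖v‖ ^ 2 ≤ ⟪hess₂₂ (P.gLoc k) x y v, v⟫ := by
  have := h.prob_g k
  have hi := (h.expect_hess₂₂ k x y).1.apply_continuousLinearMap v
  rw [h.hess₂₂_gLoc, ContinuousLinearMap.integral_apply (h.expect_hess₂₂ k x y).1, real_inner_comm,
    ← integral_inner hi]
  calc c.μ * ‖v‖ ^ 2 = ∫ _, c.μ * ‖v‖ ^ 2 ∂(P.Dg k) := by simp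
    _ ≤ _ := integral_mono (integrable_const _) (hi.const_inner v) fun ζ => by
      rw [real_inner_comm]; exact h.hess_lower k ζ x y v

end Regular

/-! ### The stochastic oracles -/

variable (P)

/-- Sample oracle for `y`: the gradient `∇₂ g`. -/
def oracleG (k : Fin K) (m : Pt dx dy) (s : Ξ × Z) : Vec dy := grad₂ (P.gS k s.2) m.1 m.2.1

/-- Sample oracle for `z`: the residual `∇²₂₂ g z - ∇₂ f` of the linear system for the
Hessian-inverse-vector product. -/
def oracleH (k : Fin K) (m : Pt dx dy) (s : Ξ × Z) : Vec dy :=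
  hess₂₂ (P.gS k s.2) m.1 m.2.1 m.2.2 - grad₂ (P.fS k s.1) m.1 m.2.1

/-- Sample oracle for `x`: the hypergradient `∇₁ f - ∇²₁₂ g z`. -/
def oracleF (k : Fin K) (m : Pt dx dy) (s : Ξ × Z) : Vec dx :=
  grad₁ (P.fS k s.1) m.1 m.2.1 - hess₁₂ (P.gS k s.2) m.1 m.2.1 m.2.2

/-- The expectation of `oracleG`, as derivatives of the expected losses. -/
def meanG (k : Fin K) (m : Pt dx dy) : Vec dy := grad₂ (P.gLoc k) m.1 m.2.1

/-- The expectation of `oracleH`, as derivatives of the expected losses. -/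
def meanH (k : Fin K) (m : Pt dx dy) : Vec dy :=
  hess₂₂ (P.gLoc k) m.1 m.2.1 m.2.2 - grad₂ (P.fLoc k) m.1 m.2.1

/-- The expectation of `oracleF`, as derivatives of the expected losses. -/
def meanF (k : Fin K) (m : Pt dx dy) : Vec dx :=
  grad₁ (P.fLoc k) m.1 m.2.1 - hess₁₂ (P.gLoc k) m.1 m.2.1 m.2.2

end Problem

/-- Lipschitz constant of the sample oracles on the ball `‖z‖ ≤ c_{f_y} / μ`. -/
def Constants.lipOracle (c : Constants) : ℝ :=
  3 * (1 + c.lfx + c.lfy + c.lgy + c.cgxy + c.lgxy * (c.cfy / c.μ) + c.lgyy * (c.cfy / c.μ))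

/-- Standard deviation of the sample oracles. -/
def Constants.devOracle (c : Constants) : ℝ := 2 * (1 + c.cfy / c.μ) * c.σ

lemma Constants.radius_nonneg (c : Constants) : 0 ≤ c.cfy / c.μ := (div_pos c.cfy_pos c.μ_pos).le

section OracleEstimates

variable {dx dy n : ℕ}

lemma LipBall.mono {V : Type*} [NormedAddCommGroup V] {ρ L L' : ℝ} {h : Pt dx dy → V}
    (hh : LipBall ρ L h) (h0 : 0 ≤ L) (hL : L ≤ L') : LipBall ρ L' h := fun m m' hm hm' =>
  (hh m m' hm hm').trans (by have := sqDist_nonneg m m'; gcongr)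

lemma JointLip.lipBall {V : Type*} [NormedAddCommGroup V] {L : ℝ} (ρ : ℝ) {h : Vec dx → Vec dy → V}
    (hh : JointLip L h) : LipBall ρ L fun m => h m.1 m.2.1 := fun m m' _ _ => by
  refine (hh.sq_le m.1 m'.1 m.2.1 m'.2.1).trans (mul_le_mul_of_nonneg_left ?_ (sq_nonneg L))
  exact le_add_of_nonneg_right (sq_nonneg _)

/-- Oracles that are affine in `z`. -/
lemma lipBall_affine {A : Vec dx → Vec dy → Vec dy →L[ℝ] Vec n} {q : Vec dx → Vec dy → Vec n}
    {a b d ρ : ℝ} (hA : JointLip a A) (hb : ∀ x y, ‖A x y‖ ≤ b) (hq : JointLip d q) (ha0 : 0 ≤ a)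
    (hd0 : 0 ≤ d) (hρ : 0 ≤ ρ) :
    LipBall ρ (3 * (a * ρ + b + d)) fun m => A m.1 m.2.1 m.2.2 - q m.1 m.2.1 := by
  intro m m' hm hm'
  have hb0 : 0 ≤ b := (norm_nonneg _).trans (hb m.1 m.2.1)
  have e : (A m.1 m.2.1 m.2.2 - q m.1 m.2.1) - (A m'.1 m'.2.1 m'.2.2 - q m'.1 m'.2.1) =
      (A m.1 m.2.1 - A m'.1 m'.2.1) m.2.2 + A m'.1 m'.2.1 (m.2.2 - m'.2.2) +
        (q m'.1 m'.2.1 - q m.1 m.2.1) := by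
    rw [map_sub, sub_apply]; abel
  rw [e]
  set D := ‖m.1 - m'.1‖ ^ 2 + ‖m.2.1 - m'.2.1‖ ^ 2 with hD
  have hD0 : 0 ≤ D := by positivity
  have hS : sqDist m m' = D + ‖m.2.2 - m'.2.2‖ ^ 2 := rfl
  have h1 : ‖(A m.1 m.2.1 - A m'.1 m'.2.1) m.2.2‖ ^ 2 ≤ (a * ρ) ^ 2 * D := by
    calc _ ≤ (‖A m.1 m.2.1 - A m'.1 m'.2.1‖ * ρ) ^ 2 := by
          gcongr
          exact (ContinuousLinearMap.le_opNorm _ _).trans (by gcongr)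
      _ = ‖A m.1 m.2.1 - A m'.1 m'.2.1‖ ^ 2 * ρ ^ 2 := by ring
      _ ≤ (a ^ 2 * D) * ρ ^ 2 := by gcongr; exact hA.sq_le _ _ _ _
      _ = _ := by ring
  have h2 : ‖A m'.1 m'.2.1 (m.2.2 - m'.2.2)‖ ^ 2 ≤ b ^ 2 * ‖m.2.2 - m'.2.2‖ ^ 2 := by
    rw [← mul_pow]
    gcongr
    exact (ContinuousLinearMap.le_opNorm _ _).trans (by gcongr; exact hb _ _)
  have h3 : ‖q m'.1 m'.2.1 - q m.1 m.2.1‖ ^ 2 ≤ d ^ 2 * D := by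
    rw [norm_sub_rev]; exact hq.sq_le _ _ _ _
  refine (sq_norm_add₃_le _ _ _).trans ?_
  have haρ : 0 ≤ a * ρ := mul_nonneg ha0 hρ
  have e1 : (a * ρ) ^ 2 ≤ (a * ρ + b + d) ^ 2 := by gcongr; linarith
  have e2 : b ^ 2 ≤ (a * ρ + b + d) ^ 2 := by gcongr; linarith
  have e3 : d ^ 2 ≤ (a * ρ + b + d) ^ 2 := by gcongr; linarith
  have f1 := mul_le_mul_of_nonneg_right e1 hD0
  have f2 := mul_le_mul_of_nonneg_right e2 (sq_nonneg ‖m.2.2 - m'.2.2‖)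
  have f3 := mul_le_mul_of_nonneg_right e3 hD0
  have f4 : 0 ≤ (a * ρ + b + d) ^ 2 * ‖m.2.2 - m'.2.2‖ ^ 2 := by positivity
  have f5 : 0 ≤ (a * ρ + b + d) ^ 2 * D := by positivity
  rw [hS]
  nlinarith

/-- Noise of oracles that are affine in `z`. -/
lemma lintegral_noise_affine_le {Ω : Type*} [MeasurableSpace Ω] {Pr : Measure Ω}
    {A : Ω → Vec dy →L[ℝ] Vec n} {q : Ω → Vec n} {A₀ : Vec dy →L[ℝ] Vec n} {q₀ : Vec n} {σ ρ : ℝ}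
    (hA : Measurable A)
    (h1 : ∫⁻ ω, ‖A ω - A₀‖ₑ ^ 2 ∂Pr ≤ ENNReal.ofReal (σ ^ 2))
    (h2 : ∫⁻ ω, ‖q ω - q₀‖ₑ ^ 2 ∂Pr ≤ ENNReal.ofReal (σ ^ 2)) {z : Vec dy} (hz : ‖z‖ ≤ ρ) :
    ∫⁻ ω, ‖(A ω z - q ω) - (A₀ z - q₀)‖ₑ ^ 2 ∂Pr ≤ ENNReal.ofReal ((2 * (1 + ρ) * σ) ^ 2) := by
  have hρ : 0 ≤ ρ := (norm_nonneg _).trans hz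
  have hpt : ∀ ω, ‖(A ω z - q ω) - (A₀ z - q₀)‖ₑ ^ 2 ≤
      ENNReal.ofReal (2 * ρ ^ 2) * ‖A ω - A₀‖ₑ ^ 2 + ENNReal.ofReal 2 * ‖q ω - q₀‖ₑ ^ 2 := by
    intro ω
    simp only [← ofReal_norm]
    rw [← ENNReal.ofReal_pow (norm_nonneg _), ← ENNReal.ofReal_pow (norm_nonneg _),
      ← ENNReal.ofReal_pow (norm_nonneg _), ← ENNReal.ofReal_mul (by positivity),
      ← ENNReal.ofReal_mul (by positivity), ← ENNReal.ofReal_add (by positivity) (by positivity)]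
    refine ENNReal.ofReal_le_ofReal ?_
    have e : (A ω z - q ω) - (A₀ z - q₀) = (A ω - A₀) z - (q ω - q₀) := by
      rw [sub_apply]; abel
    have e1 := sq_norm_sub_le ((A ω - A₀) z) (q ω - q₀)
    have e2 : ‖(A ω - A₀) z‖ ^ 2 ≤ ρ ^ 2 * ‖A ω - A₀‖ ^ 2 := by
      calc _ ≤ (‖A ω - A₀‖ * ρ) ^ 2 := by
            gcongr
            exact (ContinuousLinearMap.le_opNorm _ _).trans (by gcongr)
        _ = _ := by ring
    rw [e]
    linarith
  refine (lintegral_mono hpt).trans ?_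
  have hm : Measurable fun ω => ‖A ω - A₀‖ₑ ^ 2 := ((hA.sub_const A₀).enorm).pow_const 2
  rw [lintegral_add_left (hm.const_mul _), lintegral_const_mul _ hm,
    lintegral_const_mul' _ _ ENNReal.ofReal_ne_top]
  calc _ ≤ ENNReal.ofReal (2 * ρ ^ 2) * ENNReal.ofReal (σ ^ 2) +
        ENNReal.ofReal 2 * ENNReal.ofReal (σ ^ 2) := by gcongr
    _ = ENNReal.ofReal (2 * ρ ^ 2 * σ ^ 2 + 2 * σ ^ 2) := by
        rw [← ENNReal.ofReal_mul (by positivity), ← ENNReal.ofReal_mul (by positivity),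
          ← ENNReal.ofReal_add (by positivity) (by positivity)]
    _ ≤ _ := by
        refine ENNReal.ofReal_le_ofReal ?_
        have : (2 * (1 + ρ) * σ) ^ 2 = 2 * ρ ^ 2 * σ ^ 2 + 2 * σ ^ 2 +
          (2 * ρ ^ 2 * σ ^ 2 + 8 * ρ * σ ^ 2 + 2 * σ ^ 2) := by ring
        rw [this]
        exact le_add_of_nonneg_right (by positivity)

lemma integral_comp_of_law {Ω S V : Type*} [MeasurableSpace Ω] [MeasurableSpace S]
    [NormedAddCommGroup V] [NormedSpace ℝ V] {Pr : Measure Ω} {D : Measure S} {X : Ω → S}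
    (hX : Measurable X) (hl : Pr.map X = D) {φ : S → V} (hφ : Integrable φ D) :
    Integrable (fun ω => φ (X ω)) Pr ∧ ∫ ω, φ (X ω) ∂Pr = ∫ s, φ s ∂D := by
  subst hl
  exact ⟨hφ.comp_measurable hX, (integral_map hX.aemeasurable hφ.1).symm⟩

lemma VarLe.comp_of_law {Ω S V : Type*} [MeasurableSpace Ω] [MeasurableSpace S]
    [NormedAddCommGroup V] [MeasurableSpace V] [BorelSpace V] [SecondCountableTopology V]
    {Pr : Measure Ω} {D : Measure S} {X : Ω → S}
    (hX : Measurable X) (hl : Pr.map X = D) {φ : S → V} {v : V} {σ : ℝ} (hφ : Measurable φ)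
    (hv : VarLe D φ v σ) :
    ∫⁻ ω, ‖φ (X ω) - v‖ₑ ^ 2 ∂Pr ≤ ENNReal.ofReal (σ ^ 2) := by
  subst hl
  unfold VarLe at hv
  rwa [lintegral_map ((hφ.sub_const v).enorm.pow_const 2) hX] at hv

end OracleEstimates

section Oracles

variable {K dx dy : ℕ} {Ξ Z Ω : Type*} [MeasurableSpace Ξ] [MeasurableSpace Z]
  [MeasurableSpace Ω] {P : Problem K dx dy Ξ Z} {c : Constants} {Pr : Measure Ω}
  {ξ : ℕ → Fin K → ℕ → Ω → Ξ} {ζ : ℕ → Fin K → ℕ → Ω → Z}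

/-- The pair of samples with index `(t, k, i)`. -/
def samplePair (ξ : ℕ → Fin K → ℕ → Ω → Ξ) (ζ : ℕ → Fin K → ℕ → Ω → Z) (i : ℕ × Fin K × ℕ)
    (ω : Ω) : Ξ × Z :=
  (ξ i.1 i.2.1 i.2.2 ω, ζ i.1 i.2.1 i.2.2 ω)

lemma IsSampling.measurable_samplePair (hs : IsSampling P Pr ξ ζ) (i : ℕ × Fin K × ℕ) :
    Measurable (samplePair ξ ζ i) :=
  (hs.meas_ξ _ _ _).prodMk (hs.meas_ζ _ _ _)

lemma Problem.Regular.sampleOracleG (h : P.Regular c) (hs : IsSampling P Pr ξ ζ) :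
    SampleOracle (c.cfy / c.μ) c.lipOracle c.devOracle Pr (samplePair ξ ζ) P.oracleG P.meanG := by
  have hρ := c.radius_nonneg
  have hp := c.lfx_pos; have hp1 := c.lfy_pos; have hp2 := c.lgy_pos; have hp3 := c.cgxy_pos
  have hp4 := c.lgxy_pos; have hp5 := c.lgyy_pos; have hσ := c.σ_pos
  refine ⟨fun k => ?_, fun k s => ?_, fun t k i m => ?_, fun t k i m => ?_, fun t k i m hm => ?_⟩
  · refine measurable_uncurry_of_continuous_of_measurable (u := fun m s => P.oracleG k m s)
      (fun s => ?_) fun m => ?_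
    · exact (h.lip_g₂ k s.2).continuous.comp
        (continuous_fst.prodMk (continuous_fst.comp continuous_snd))
    · exact (h.expect_grad₂_g k m.1 m.2.1).1.comp measurable_snd
  · refine ((h.lip_g₂ k s.2).lipBall (c.cfy / c.μ)).mono hp2.le ?_
    unfold Constants.lipOracle
    have : 0 ≤ c.lgxy * (c.cfy / c.μ) := by positivity
    have : 0 ≤ c.lgyy * (c.cfy / c.μ) := by positivity
    linarith
  · exact (integral_comp_of_law (hs.meas_ζ t k i) (hs.law_ζ t k i)
      (h.expect_grad₂_g k m.1 m.2.1).2.1).1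
  · refine (integral_comp_of_law (hs.meas_ζ t k i) (hs.law_ζ t k i)
      (h.expect_grad₂_g k m.1 m.2.1).2.1).2.trans ?_
    exact (h.grad₂_gLoc k m.1 m.2.1).symm
  · refine ((h.var_g₂ k m.1 m.2.1).comp_of_law (hs.meas_ζ t k i) (hs.law_ζ t k i)
      (h.expect_grad₂_g k m.1 m.2.1).1).trans (ENNReal.ofReal_le_ofReal ?_)
    gcongr
    unfold Constants.devOracle
    nlinarith [mul_nonneg hρ hσ.le]

lemma Problem.Regular.sampleOracleH (h : P.Regular c) (hs : IsSampling P Pr ξ ζ) :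
    SampleOracle (c.cfy / c.μ) c.lipOracle c.devOracle Pr (samplePair ξ ζ) P.oracleH P.meanH := by
  have hρ := c.radius_nonneg
  have hp := c.lfx_pos; have hp1 := c.lfy_pos; have hp2 := c.lgy_pos; have hp3 := c.cgxy_pos
  have hp4 := c.lgxy_pos; have hp5 := c.lgyy_pos; have hσ := c.σ_pos
  have i1 : ∀ k (m : Pt dx dy), Integrable (fun ζ => hess₂₂ (P.gS k ζ) m.1 m.2.1 m.2.2) (P.Dg k) :=
    fun k m => (h.expect_hess₂₂ k m.1 m.2.1).1.apply_continuousLinearMap m.2.2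
  refine ⟨fun k => ?_, fun k s => ?_, fun t k i m => ?_, fun t k i m => ?_, fun t k i m hm => ?_⟩
  · refine measurable_uncurry_of_continuous_of_measurable (u := fun m s => P.oracleH k m s)
      (fun s => ?_) fun m => ?_
    · have hc : Continuous fun m : Pt dx dy => (m.1, m.2.1) := by fun_prop
      exact (((h.lip_g₂₂ k s.2).continuous.comp hc).clm_apply (by fun_prop)).sub
        ((h.lip_f₂ k s.1).continuous.comp hc)
    · exact (((h.measurable_hess₂₂ k m.1 m.2.1).comp measurable_snd).apply_continuousLinearMap
        m.2.2).sub ((h.expect_grad₂_f k m.1 m.2.1).1.comp measurable_fst)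
  · refine (lipBall_affine (h.lip_g₂₂ k s.2) (h.norm_hess₂₂_le k s.2) (h.lip_f₂ k s.1) hp5.le hp1.le
      hρ).mono (by positivity) ?_
    unfold Constants.lipOracle
    have : 0 ≤ c.lgxy * (c.cfy / c.μ) := by positivity
    linarith
  · exact (integral_comp_of_law (hs.meas_ζ t k i) (hs.law_ζ t k i) (i1 k m)).1.sub
      (integral_comp_of_law (hs.meas_ξ t k i) (hs.law_ξ t k i)
        (h.expect_grad₂_f k m.1 m.2.1).2.1).1
  · have a1 := integral_comp_of_law (hs.meas_ζ t k i) (hs.law_ζ t k i) (i1 k m)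
    have a2 := integral_comp_of_law (hs.meas_ξ t k i) (hs.law_ξ t k i)
        (h.expect_grad₂_f k m.1 m.2.1).2.1
    refine (integral_sub a1.1 a2.1).trans ?_
    rw [a1.2, a2.2, ← h.grad₂_fLoc, ← ContinuousLinearMap.integral_apply
      (h.expect_hess₂₂ k m.1 m.2.1).1, ← h.hess₂₂_gLoc]
    rfl
  · have v1 := (h.var_g₂₂ k m.1 m.2.1).comp_of_law (hs.meas_ζ t k i) (hs.law_ζ t k i)
        (h.measurable_hess₂₂ k m.1 m.2.1)
    have v2 := (h.var_f₂ k m.1 m.2.1).comp_of_law (hs.meas_ξ t k i) (hs.law_ξ t k i)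
        (h.expect_grad₂_f k m.1 m.2.1).1
    have hA : Measurable fun ω => hess₂₂ (P.gS k (ζ t k i ω)) m.1 m.2.1 :=
      (h.measurable_hess₂₂ k m.1 m.2.1).comp (hs.meas_ζ t k i)
    have h1 := lintegral_noise_affine_le hA v1 v2 hm
    exact h1

lemma Problem.Regular.sampleOracleF (h : P.Regular c) (hs : IsSampling P Pr ξ ζ) :
    SampleOracle (c.cfy / c.μ) c.lipOracle c.devOracle Pr (samplePair ξ ζ) P.oracleF P.meanF := by
  have hρ := c.radius_nonneg
  have hp := c.lfx_pos; have hp1 := c.lfy_pos; have hp2 := c.lgy_pos; have hp3 := c.cgxy_pos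
  have hp4 := c.lgxy_pos; have hp5 := c.lgyy_pos; have hσ := c.σ_pos
  have i1 : ∀ k (m : Pt dx dy), Integrable (fun ζ => hess₁₂ (P.gS k ζ) m.1 m.2.1 m.2.2) (P.Dg k) :=
    fun k m => (h.integrable_hess₁₂ k m.1 m.2.1).apply_continuousLinearMap m.2.2
  refine ⟨fun k => ?_, fun k s => ?_, fun t k i m => ?_, fun t k i m => ?_, fun t k i m hm => ?_⟩
  · refine measurable_uncurry_of_continuous_of_measurable (u := fun m s => P.oracleF k m s)
      (fun s => ?_) fun m => ?_
    · have hc : Continuous fun m : Pt dx dy => (m.1, m.2.1) := by fun_prop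
      exact ((h.lip_f₁ k s.1).continuous.comp hc).sub
        (((h.lip_g₁₂ k s.2).continuous.comp hc).clm_apply (by fun_prop))
    · exact ((h.expect_grad₁_f k m.1 m.2.1).1.comp measurable_fst).sub
        (((h.measurable_hess₁₂ k m.1 m.2.1).comp measurable_snd).apply_continuousLinearMap m.2.2)
  · have h1 := (lipBall_affine (h.lip_g₁₂ k s.2) (h.bdd_g₁₂ k s.2) (h.lip_f₁ k s.1) hp4.le hp.le
      hρ).mono (L' := c.lipOracle) (by positivity) (by
        unfold Constants.lipOracle
        have : 0 ≤ c.lgyy * (c.cfy / c.μ) := by positivity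
        linarith)
    intro m m' hm hm'
    refine le_trans (le_of_eq ?_) (h1 m m' hm hm')
    rw [← norm_neg]
    unfold Problem.oracleF
    congr 2
    module
  · exact (integral_comp_of_law (hs.meas_ξ t k i) (hs.law_ξ t k i)
        (h.expect_grad₁_f k m.1 m.2.1).2.1).1.sub
      (integral_comp_of_law (hs.meas_ζ t k i) (hs.law_ζ t k i) (i1 k m)).1
  · have a1 := integral_comp_of_law (hs.meas_ζ t k i) (hs.law_ζ t k i) (i1 k m)
    have a2 := integral_comp_of_law (hs.meas_ξ t k i) (hs.law_ξ t k i)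
        (h.expect_grad₁_f k m.1 m.2.1).2.1
    refine (integral_sub a2.1 a1.1).trans ?_
    rw [a1.2, a2.2, ← h.grad₁_fLoc, ← ContinuousLinearMap.integral_apply
      (h.integrable_hess₁₂ k m.1 m.2.1), ← h.hess₁₂_gLoc]
    rfl
  · have v1 := (h.var_g₁₂ k m.1 m.2.1).comp_of_law (hs.meas_ζ t k i) (hs.law_ζ t k i)
        (h.measurable_hess₁₂ k m.1 m.2.1)
    have v2 := (h.var_f₁ k m.1 m.2.1).comp_of_law (hs.meas_ξ t k i) (hs.law_ξ t k i)
        (h.expect_grad₁_f k m.1 m.2.1).1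
    have hA : Measurable fun ω => hess₁₂ (P.gS k (ζ t k i ω)) m.1 m.2.1 :=
      (h.measurable_hess₁₂ k m.1 m.2.1).comp (hs.meas_ζ t k i)
    have h1 := lintegral_noise_affine_le hA v1 v2 hm
    refine le_trans (le_of_eq (lintegral_congr fun ω => ?_)) h1
    rw [← enorm_neg]
    congr 2
    simp only [Problem.oracleF, Problem.meanF, samplePair]
    module

end Oracles

/-! ### The bilevel problem as a landscape -/

section AverageDerivatives

variable {K n m : ℕ}

lemma hasGradientAt_average {φ : Fin K → Vec n → ℝ} {g : Fin K → Vec n} {x : Vec n}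
    (h : ∀ k, HasGradientAt (φ k) (g k) x) :
    HasGradientAt (fun x => (K : ℝ)⁻¹ * ∑ k, φ k x) (avg g) x := by
  have h1 : HasFDerivAt (fun x => (K : ℝ)⁻¹ * ∑ k, φ k x)
      ((K : ℝ)⁻¹ • ∑ k, InnerProductSpace.toDual ℝ (Vec n) (g k)) x :=
    (HasFDerivAt.fun_sum fun k _ => (h k).hasFDerivAt).const_mul _
  rw [hasGradientAt_iff_hasFDerivAt]
  have e : InnerProductSpace.toDual ℝ (Vec n) (avg g) =
      (K : ℝ)⁻¹ • ∑ k, InnerProductSpace.toDual ℝ (Vec n) (g k) := by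
    simp [avg, map_sum]
  rw [e]
  exact h1

lemma hasFDerivAt_average {g : Fin K → Vec n → Vec m} {A : Fin K → Vec n →L[ℝ] Vec m} {x : Vec n}
    (h : ∀ k, HasFDerivAt (g k) (A k) x) :
    HasFDerivAt (fun x => avg fun k => g k x) ((K : ℝ)⁻¹ • ∑ k, A k) x :=
  (HasFDerivAt.fun_sum (u := Finset.univ) fun k _ => h k).const_smul (K : ℝ)⁻¹

end AverageDerivatives

/-- Lipschitz constants of the solution maps of the lower-level problem and of the
Hessian-inverse-vector problem: both follow from strong monotonicity. -/
lemma lip_solution_maps {K dx dy : ℕ} (hK : 0 < K) {L μ ρ : ℝ} (hL : 1 ≤ L) (hμ : 0 < μ)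
    (hμ1 : μ ≤ 1) {G H : Fin K → Pt dx dy → Vec dy} {ys zs : Vec dx → Vec dy}
    (lipG : ∀ k, LipBall ρ L (G k)) (lipH : ∀ k, LipBall ρ L (H k))
    (monoG : ∀ x y y' z, μ * ‖y - y'‖ ^ 2 ≤
      ⟪avg (fun k => G k (x, y, z)) - avg (fun k => G k (x, y', z)), y - y'⟫)
    (monoH : ∀ x y z z', μ * ‖z - z'‖ ^ 2 ≤
      ⟪avg (fun k => H k (x, y, z)) - avg (fun k => H k (x, y, z')), z - z'⟫)
    (zeroG : ∀ x z, avg (fun k => G k (x, ys x, z)) = 0)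
    (zeroH : ∀ x, avg (fun k => H k (x, ys x, zs x)) = 0) (ball : ∀ x, ‖zs x‖ ≤ ρ)
    (x x' : Vec dx) :
    ‖ys x - ys x'‖ ^ 2 ≤ (L / μ) ^ 2 * ‖x - x'‖ ^ 2 ∧
      ‖zs x - zs x'‖ ^ 2 ≤ (2 * (L / μ) ^ 2) ^ 2 * ‖x - x'‖ ^ 2 := by
  -- strong monotonicity bounds the distance to a zero by the size of the residual
  have resid : ∀ {d a : Vec dy} {q : ℝ}, μ * ‖d‖ ^ 2 ≤ ⟪a, d⟫ → ‖a‖ ^ 2 ≤ L ^ 2 * q →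
      ‖d‖ ^ 2 ≤ (L / μ) ^ 2 * q := by
    intro d a q h1 h2
    have h3 : μ * ‖d‖ ^ 2 ≤ ‖a‖ * ‖d‖ := h1.trans (real_inner_le_norm _ _)
    have h4 : μ * ‖d‖ ≤ ‖a‖ := by
      rcases (norm_nonneg d).eq_or_lt with h | h
      · rw [← h]; simp
      · have : μ * ‖d‖ * ‖d‖ ≤ ‖a‖ * ‖d‖ := by linarith
        exact le_of_mul_le_mul_right this h
    have h5 : (μ * ‖d‖) ^ 2 ≤ L ^ 2 * q := (pow_le_pow_left₀ (by positivity) h4 2).trans h2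
    rw [div_pow, div_mul_eq_mul_div, le_div_iff₀ (by positivity)]
    linarith
  have lipAvg : ∀ {h : Fin K → Pt dx dy → Vec dy} (_ : ∀ k, LipBall ρ L (h k)) (m m' : Pt dx dy),
      ‖m.2.2‖ ≤ ρ → ‖m'.2.2‖ ≤ ρ →
      ‖avg (fun k => h k m) - avg (fun k => h k m')‖ ^ 2 ≤ L ^ 2 * sqDist m m' := by
    intro h hh m m' hm hm'
    rw [← avg_sub]
    refine (sq_norm_avg_le hK _).trans ?_
    unfold msq
    have hK' : (0 : ℝ) < K := by exact_mod_cast hK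
    calc _ ≤ (K : ℝ)⁻¹ * ∑ _k : Fin K, L ^ 2 * sqDist m m' := by
          gcongr with k _; exact hh k m m' hm hm'
      _ = _ := by
          rw [Finset.sum_const, Finset.card_univ, Fintype.card_fin, nsmul_eq_mul]; field_simp
  have hy : ‖ys x - ys x'‖ ^ 2 ≤ (L / μ) ^ 2 * ‖x - x'‖ ^ 2 := by
    have h1 := monoG x' (ys x) (ys x') (zs x)
    rw [zeroG x' (zs x)] at h1
    have h2 := lipAvg lipG (x', ys x, zs x) (x, ys x, zs x) (ball x) (ball x)
    rw [zeroG x (zs x)] at h2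
    refine resid h1 (h2.trans (le_of_eq ?_))
    simp [sqDist, norm_sub_rev]
  refine ⟨hy, ?_⟩
  have h1 := monoH x' (ys x') (zs x) (zs x')
  rw [zeroH x'] at h1
  have h2 := lipAvg lipH (x', ys x', zs x) (x, ys x, zs x) (ball x) (ball x)
  rw [zeroH x] at h2
  have h3 := resid h1 h2
  refine h3.trans ?_
  simp only [sqDist, sub_self, norm_zero, norm_sub_rev x' x, norm_sub_rev (ys x') (ys x)]
  have hLμ : 1 ≤ L / μ := by rw [le_div_iff₀ hμ]; linarith
  have h4 : 1 ≤ (L / μ) ^ 2 := one_le_pow₀ hLμ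
  have h5 : ‖x - x'‖ ^ 2 ≤ (L / μ) ^ 2 * ‖x - x'‖ ^ 2 := le_mul_of_one_le_left (sq_nonneg _) h4
  have h6 : 0 ≤ (L / μ) ^ 2 * ‖x - x'‖ ^ 2 := by positivity
  calc (L / μ) ^ 2 * (‖x - x'‖ ^ 2 + ‖ys x - ys x'‖ ^ 2 + 0 ^ 2)
      ≤ (L / μ) ^ 2 * (4 * ((L / μ) ^ 2 * ‖x - x'‖ ^ 2)) := by gcongr; linarith
    _ = _ := by ring

/-- Modulus of monotonicity, normalized to be at most `1`. -/
def Constants.mono (c : Constants) : ℝ := min c.μ 1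

/-- Lipschitz constant of the expected oracles and of the solution maps. -/
def Constants.lip (c : Constants) : ℝ := 2 * (c.lipOracle / c.mono) ^ 2

lemma Constants.mono_pos (c : Constants) : 0 < c.mono := lt_min c.μ_pos one_pos

lemma Constants.mono_le_one (c : Constants) : c.mono ≤ 1 := min_le_right _ _

lemma Constants.one_le_lipOracle (c : Constants) : 1 ≤ c.lipOracle := by
  have hρ := c.radius_nonneg
  have hp := c.lfx_pos; have hp1 := c.lfy_pos; have hp2 := c.lgy_pos; have hp3 := c.cgxy_pos
  have hp4 := mul_nonneg c.lgxy_pos.le hρ; have hp5 := mul_nonneg c.lgyy_pos.le hρ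
  unfold Constants.lipOracle
  linarith

lemma Constants.lip_bounds (c : Constants) :
    c.lipOracle ≤ c.lip ∧ c.lipOracle / c.mono ≤ c.lip := by
  have h1 := c.one_le_lipOracle
  have h2 := c.mono_pos
  have h3 : c.lipOracle ≤ c.lipOracle / c.mono := by
    rw [le_div_iff₀ h2]; exact mul_le_of_le_one_right (by linarith) c.mono_le_one
  have h4 : c.lipOracle / c.mono ≤ c.lip := by
    unfold Constants.lip; nlinarith
  exact ⟨h3.trans h4, h4⟩

lemma Constants.one_le_lip (c : Constants) : 1 ≤ c.lip :=
  c.one_le_lipOracle.trans c.lip_bounds.1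

namespace Problem.Regular

variable {K dx dy : ℕ} {Ξ Z : Type*} [MeasurableSpace Ξ] [MeasurableSpace Z]
  {P : Problem K dx dy Ξ Z} {c : Constants} (h : P.Regular c)
include h

lemma hasGradientAt_fAvg₁ (x : Vec dx) (y : Vec dy) :
    HasGradientAt (fun x => P.fAvg x y) (avg fun k => grad₁ (P.fLoc k) x y) x :=
  hasGradientAt_average fun k => by rw [h.grad₁_fLoc]; exact (h.expect_grad₁_f k x y).2.2

lemma hasGradientAt_fAvg₂ (x : Vec dx) (y : Vec dy) :
    HasGradientAt (fun y => P.fAvg x y) (avg fun k => grad₂ (P.fLoc k) x y) y :=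
  hasGradientAt_average fun k => by rw [h.grad₂_fLoc]; exact (h.expect_grad₂_f k x y).2.2

lemma hasGradientAt_gAvg₂ (x : Vec dx) (y : Vec dy) :
    HasGradientAt (fun y => P.gAvg x y) (avg fun k => grad₂ (P.gLoc k) x y) y :=
  hasGradientAt_average fun k => by rw [h.grad₂_gLoc]; exact (h.expect_grad₂_g k x y).2.2

lemma lip_grad₂_gLoc (k : Fin K) : JointLip c.lgy (grad₂ (P.gLoc k)) := by
  have := h.prob_g k
  rw [show grad₂ (P.gLoc k) = _ from funext₂ (h.grad₂_gLoc k)]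
  exact JointLip.expectation (h.lip_g₂ k) fun x y => (h.expect_grad₂_g k x y).2.1

/-- The Hessian of the averaged lower-level loss. -/
lemma hasFDerivAt_hessAvg (x : Vec dx) (y : Vec dy) :
    HasFDerivAt (fun y => avg fun k => grad₂ (P.gLoc k) x y)
      ((K : ℝ)⁻¹ • ∑ k, hess₂₂ (P.gLoc k) x y) y :=
  hasFDerivAt_average fun k => h.hasFDerivAt_hess₂₂_gLoc k x y

lemma hessAvg_coercive (hK : 0 < K) (x : Vec dx) (y v : Vec dy) :
    c.μ * ‖v‖ ^ 2 ≤ ⟪((K : ℝ)⁻¹ • ∑ k, hess₂₂ (P.gLoc k) x y) v, v⟫ := by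
  have hK' : (0 : ℝ) < K := by exact_mod_cast hK
  rw [smul_apply, sum_apply, real_inner_smul_left, sum_inner]
  calc c.μ * ‖v‖ ^ 2 = (K : ℝ)⁻¹ * ∑ _k : Fin K, c.μ * ‖v‖ ^ 2 := by
        rw [Finset.sum_const, Finset.card_univ, Fintype.card_fin, nsmul_eq_mul]; field_simp
    _ ≤ _ := by gcongr with k _; exact h.hess₂₂_gLoc_coercive k x y v

lemma grad_gAvg_mono (hK : 0 < K) (x : Vec dx) (y y' : Vec dy) : c.μ * ‖y - y'‖ ^ 2 ≤
    ⟪avg (fun k => grad₂ (P.gLoc k) x y) - avg (fun k => grad₂ (P.gLoc k) x y'), y - y'⟫ :=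
  strong_mono_of_fderiv (fun y => h.hasFDerivAt_hessAvg x y)
    (fun y v => h.hessAvg_coercive hK x y v)
    y y'

/-- The lower-level minimizer exists, so `yStar` is a critical point. -/
lemma grad_gAvg_yStar (hK : 0 < K) (x : Vec dx) :
    avg (fun k => grad₂ (P.gLoc k) x (P.yStar x)) = 0 := by
  obtain ⟨y₀, hy₀⟩ := exists_zero_of_strong_mono (g := fun y => avg fun k => grad₂ (P.gLoc k) x y)
    c.μ_pos (fun y y' => (JointLip.average hK h.lip_grad₂_gLoc).right x y y')
    (h.grad_gAvg_mono hK x)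
  have hmin : ∃ y, ∀ y', P.gAvg x y ≤ P.gAvg x y' :=
    ⟨y₀, le_of_gradient_eq_zero c.μ_pos.le (h.hasGradientAt_gAvg₂ x) (h.grad_gAvg_mono hK x) hy₀⟩
  have h1 : ∀ y', P.gAvg x (P.yStar x) ≤ P.gAvg x y' := Classical.epsilon_spec hmin
  have h2 : IsLocalMin (fun y => P.gAvg x y) (P.yStar x) := Filter.Eventually.of_forall h1
  have h3 := h2.hasFDerivAt_eq_zero (h.hasGradientAt_gAvg₂ x (P.yStar x)).hasFDerivAt
  exact (LinearIsometryEquiv.map_eq_zero_iff _).1 h3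

/-- The averaged bilevel problem satisfies the hypotheses of the analysis. -/
theorem exists_landscape (hK : 0 < K)
    (lipG : ∀ k, LipBall (c.cfy / c.μ) c.lipOracle (P.meanG k))
    (lipH : ∀ k, LipBall (c.cfy / c.μ) c.lipOracle (P.meanH k))
    (lipF : ∀ k, LipBall (c.cfy / c.μ) c.lipOracle (P.meanF k)) : ∃ zs : Vec dx → Vec dy,
    Landscape c.lip c.mono (c.cfy / c.μ) P.meanG P.meanH P.meanF P.F P.yStar zs := by
  have hK' : (0 : ℝ) < K := by exact_mod_cast hK
  have hμ := c.μ_pos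
  have hL0 : 0 ≤ c.lipOracle := zero_le_one.trans c.one_le_lipOracle
  set B : Vec dx → Vec dy → Vec dy →L[ℝ] Vec dy :=
    fun x y => (K : ℝ)⁻¹ • ∑ k, hess₂₂ (P.gLoc k) x y with hB
  set A : Vec dx → Vec dy → Vec dx →L[ℝ] Vec dy :=
    fun x y => (K : ℝ)⁻¹ • ∑ k, fderiv ℝ (fun x => grad₂ (P.gLoc k) x y) x with hA
  have hBc : ∀ x y v, c.μ * ‖v‖ ^ 2 ≤ ⟪B x y v, v⟫ := h.hessAvg_coercive hK
  choose zs hzs using fun x => exists_apply_eq_of_coercive hμ (hBc x (P.yStar x))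
    (avg fun k => grad₂ (P.fLoc k) x (P.yStar x))
  have hmeanH : ∀ x y z, avg (fun k => P.meanH k (x, y, z)) =
      B x y z - avg fun k => grad₂ (P.fLoc k) x y := by
    intro x y z
    simp only [meanH]
    rw [avg_sub, hB, smul_apply, sum_apply]
    rfl
  have hmeanF : ∀ x y z, avg (fun k => P.meanF k (x, y, z)) =
      (avg fun k => grad₁ (P.fLoc k) x y) - ContinuousLinearMap.adjoint (A x y) z := by
    intro x y z
    simp only [meanF]
    rw [avg_sub, hA]
    simp only [← adjointCLM_apply, map_smul, map_sum]
    rw [smul_apply, sum_apply]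
    rfl
  have ball : ∀ x, ‖zs x‖ ≤ c.cfy / c.μ := by
    intro x
    have h1 := hBc x (P.yStar x) (zs x)
    rw [hzs] at h1
    have h2 : ‖avg fun k => grad₂ (P.fLoc k) x (P.yStar x)‖ ≤ c.cfy := by
      unfold avg
      rw [norm_smul, norm_inv, Real.norm_of_nonneg hK'.le]
      calc _ ≤ (K : ℝ)⁻¹ * ∑ _k : Fin K, c.cfy := by
            gcongr
            exact (norm_sum_le _ _).trans (Finset.sum_le_sum fun k _ => h.norm_grad₂_fLoc_le k _ _)
        _ = _ := by
            rw [Finset.sum_const, Finset.card_univ, Fintype.card_fin, nsmul_eq_mul]; field_simp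
    have h3 : c.μ * ‖zs x‖ ^ 2 ≤ c.cfy * ‖zs x‖ :=
      h1.trans ((real_inner_le_norm _ _).trans (by gcongr))
    rw [le_div_iff₀ hμ]
    rcases (norm_nonneg (zs x)).eq_or_lt with h0 | h0
    · rw [← h0, zero_mul]; exact c.cfy_pos.le
    · have : ‖zs x‖ * c.μ * ‖zs x‖ ≤ c.cfy * ‖zs x‖ := by linarith
      exact le_of_mul_le_mul_right this h0
  have monoG : ∀ x y y' z, c.mono * ‖y - y'‖ ^ 2 ≤
      ⟪avg (fun k => P.meanG k (x, y, z)) - avg (fun k => P.meanG k (x, y', z)), y - y'⟫ := by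
    intro x y y' z
    exact (mul_le_mul_of_nonneg_right (min_le_left _ _) (sq_nonneg _)).trans
      (h.grad_gAvg_mono hK x y y')
  have monoH : ∀ x y z z', c.mono * ‖z - z'‖ ^ 2 ≤
      ⟪avg (fun k => P.meanH k (x, y, z)) - avg (fun k => P.meanH k (x, y, z')), z - z'⟫ := by
    intro x y z z'
    rw [hmeanH, hmeanH, sub_sub_sub_cancel_right, ← map_sub]
    exact (mul_le_mul_of_nonneg_right (min_le_left _ _) (sq_nonneg _)).trans (hBc x y (z - z'))
  have zeroG : ∀ x (z : Vec dy), avg (fun k => P.meanG k (x, P.yStar x, z)) = 0 :=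
    fun x z => h.grad_gAvg_yStar hK x
  have zeroH : ∀ x, avg (fun k => P.meanH k (x, P.yStar x, zs x)) = 0 := fun x => by
    rw [hmeanH, hzs, sub_self]
  have lips := lip_solution_maps hK c.one_le_lipOracle c.mono_pos c.mono_le_one lipG lipH monoG
    monoH zeroG zeroH ball
  have hq : 0 ≤ c.lipOracle / c.mono := div_nonneg hL0 c.mono_pos.le
  have lipY : ∀ x x', ‖P.yStar x - P.yStar x'‖ ≤ c.lipOracle / c.mono * ‖x - x'‖ := fun x x' =>
    abs_le_of_sq_le_sq' (by rw [mul_pow]; exact (lips x x').1) (by positivity) |>.2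
  refine ⟨zs, fun k => (lipG k).mono hL0 c.lip_bounds.1, fun k => (lipH k).mono hL0 c.lip_bounds.1,
    fun k => (lipF k).mono hL0 c.lip_bounds.1, monoG, monoH, zeroG, zeroH, ball, fun x x' => ?_,
    fun x x' => (lips x x').2, fun x => ?_⟩
  · refine (lips x x').1.trans ?_
    gcongr
    exact c.lip_bounds.2
  · rw [hmeanF]
    exact hasGradientAt_hyper (f := P.fAvg) (G := fun x y => avg fun k => grad₂ (P.gLoc k) x y)
      (f₁ := fun x y => avg fun k => grad₁ (P.fLoc k) x y)
      (f₂ := fun x y => avg fun k => grad₂ (P.fLoc k) x y) (A := A) (B := B)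
      h.hasGradientAt_fAvg₁ h.hasGradientAt_fAvg₂
      (JointLip.average hK h.lip_grad₁_fLoc).continuous
      (JointLip.average hK h.lip_grad₂_fLoc).continuous
      (fun x y => hasFDerivAt_average fun k => h.hasFDerivAt_jacobian_gLoc k x y)
      h.hasFDerivAt_hessAvg (JointLip.average hK h.lip_jacobian_gLoc).continuous
      (JointLip.average hK h.lip_hess₂₂_gLoc).continuous
      (fun x y u v => inner_hessian_symm (h.hasGradientAt_gAvg₂ x) (h.hasFDerivAt_hessAvg x y) u v)
      (h.grad_gAvg_yStar hK) lipY (hzs x)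

end Problem.Regular

/-! ### The stochastic trajectory of the algorithm -/

/-- The random sequences of the algorithm: for every outcome the recursions hold, and the three
estimators are variance-reduced with momentum parameter `θ`, first batch size `B₀` and batch size
`B`. -/
structure StormRun {K dx dy : ℕ} {Ω S : Type*} (E : Matrix (Fin K) (Fin K) ℝ)
    (ρ η β₁ β₂ β₃ θ : ℝ) (B₀ B : ℕ) (x₀ : Vec dx) (y₀ z₀ : Vec dy) (s : ℕ × Fin K × ℕ → Ω → S)
    (G H : Fin K → Pt dx dy → S → Vec dy) (R : Fin K → Pt dx dy → S → Vec dx)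
    (m : ℕ → Fin K → Ω → Pt dx dy) (p u : ℕ → Fin K → Ω → Vec dx)
    (q v r w : ℕ → Fin K → Ω → Vec dy) : Prop where
  traj : ∀ ω, Trajectory E ρ η β₁ β₂ β₃ x₀ y₀ z₀ (fun t k => (m t k ω).1) (fun t k => p t k ω)
    (fun t k => u t k ω) (fun t k => (m t k ω).2.1) (fun t k => q t k ω) (fun t k => v t k ω)
    (fun t k => (m t k ω).2.2) (fun t k => r t k ω) (fun t k => w t k ω)
  initU : ∀ k ω, u 0 k ω = batchMean B₀ fun i => R k (m 0 k ω) (s (0, k, i) ω)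
  initV : ∀ k ω, v 0 k ω = batchMean B₀ fun i => G k (m 0 k ω) (s (0, k, i) ω)
  initW : ∀ k ω, w 0 k ω = batchMean B₀ fun i => H k (m 0 k ω) (s (0, k, i) ω)
  stepU : ∀ t k ω, u (t + 1) k ω =
    (1 - θ) • (u t k ω - batchMean B fun i => R k (m t k ω) (s (t + 1, k, i) ω)) +
      batchMean B fun i => R k (m (t + 1) k ω) (s (t + 1, k, i) ω)
  stepV : ∀ t k ω, v (t + 1) k ω =
    (1 - θ) • (v t k ω - batchMean B fun i => G k (m t k ω) (s (t + 1, k, i) ω)) +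
      batchMean B fun i => G k (m (t + 1) k ω) (s (t + 1, k, i) ω)
  stepW : ∀ t k ω, w (t + 1) k ω =
    (1 - θ) • (w t k ω - batchMean B fun i => H k (m t k ω) (s (t + 1, k, i) ω)) +
      batchMean B fun i => H k (m (t + 1) k ω) (s (t + 1, k, i) ω)

section Measurability

variable {K dx dy n : ℕ} {Ω S : Type*} {mΩ : MeasurableSpace Ω} [MeasurableSpace S]

lemma measurable_mixV (E : Matrix (Fin K) (Fin K) ℝ) {f : Fin K → Ω → Vec n}
    (hf : ∀ k, Measurable (f k)) (k : Fin K) : Measurable fun ω => mixV E (fun j => f j ω) k :=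
  Finset.measurable_sum _ fun j _ => measurable_smul_vec (hf j) (E j k)

lemma measurable_projBall {ρ : ℝ} (hρ : 0 ≤ ρ) : Measurable (projBall ρ : Vec n → Vec n) := by
  refine (LipschitzWith.of_dist_le_mul (K := 1) fun a b => ?_).continuous.measurable
  rw [dist_eq_norm, dist_eq_norm, NNReal.coe_one, one_mul]
  exact norm_projBall_sub_le hρ a b

lemma measurable_batchMean_oracle {h : Pt dx dy → S → Vec n}
    (hh : Measurable fun p : Pt dx dy × S => h p.1 p.2) {m : Ω → Pt dx dy} (hm : Measurable m)
    {s : ℕ → Ω → S} (hs : ∀ i, Measurable (s i)) (B : ℕ) :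
    Measurable fun ω => batchMean B fun i => h (m ω) (s i ω) :=
  measurable_smul_vec (Finset.measurable_sum _ fun i _ => hh.comp (hm.prodMk (hs i))) _

/-- One step of the variance-reduced estimator, as a measurable function. -/
lemma measurable_storm_step {h : Pt dx dy → S → Vec n}
    (hh : Measurable fun p : Pt dx dy × S => h p.1 p.2) {m m' : Ω → Pt dx dy} (hm : Measurable m)
    (hm' : Measurable m') {u : Ω → Vec n} (hu : Measurable u)
    {s : ℕ → Ω → S} (hs : ∀ i, Measurable (s i)) (B : ℕ) (θ : ℝ) :
    Measurable fun ω => (1 - θ) • (u ω - batchMean B fun i => h (m ω) (s i ω)) +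
      batchMean B fun i => h (m' ω) (s i ω) :=
  (measurable_smul_vec (hu.sub (measurable_batchMean_oracle hh hm hs B)) _).add
    (measurable_batchMean_oracle hh hm' hs B)

lemma measurable_point_step {E : Matrix (Fin K) (Fin K) ℝ} {f g : Fin K → Ω → Vec n}
    (hf : ∀ k, Measurable (f k)) (hg : ∀ k, Measurable (g k)) (η β : ℝ) (k : Fin K) :
    Measurable fun ω => f k ω + η • (mixV E (fun j => f j ω) k - β • g k ω - f k ω) :=
  (hf k).add (measurable_smul_vec (((measurable_mixV E hf k).sub
    (measurable_smul_vec (hg k) β)).sub (hf k)) η)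

lemma measurable_tracker_step {E : Matrix (Fin K) (Fin K) ℝ} {p u u' : Fin K → Ω → Vec n}
    (hp : ∀ k, Measurable (p k)) (hu : ∀ k, Measurable (u k)) (hu' : ∀ k, Measurable (u' k))
    (k : Fin K) : Measurable fun ω => mixV E (fun j => p j ω) k + (u' k ω - u k ω) :=
  (measurable_mixV E hp k).add ((hu' k).sub (hu k))

end Measurability

section MemLp

variable {K dx dy n : ℕ} {Ω : Type*} {mΩ : MeasurableSpace Ω} {Pr : Measure Ω}

lemma memLp_mixV (E : Matrix (Fin K) (Fin K) ℝ) {f : Fin K → Ω → Vec n}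
    (hf : ∀ k, MemLp (f k) 2 Pr) (k : Fin K) : MemLp (fun ω => mixV E (fun j => f j ω) k) 2 Pr :=
  memLp_finsetSum _ fun j _ => memLp_smul (hf j) (E j k)

lemma integrable_sqDist {m m' : Ω → Pt dx dy} (h₁ : MemLp (fun ω => (m ω).1 - (m' ω).1) 2 Pr)
    (h₂ : MemLp (fun ω => (m ω).2.1 - (m' ω).2.1) 2 Pr)
    (h₃ : MemLp (fun ω => (m ω).2.2 - (m' ω).2.2) 2 Pr) :
    Integrable (fun ω => sqDist (m ω) (m' ω)) Pr :=
  ((integrable_sq_of_memLp h₁).add (integrable_sq_of_memLp h₂)).add (integrable_sq_of_memLp h₃)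

/-- A Lipschitz image of square integrable points is square integrable. -/
lemma memLp_lipBall [IsProbabilityMeasure Pr] {ρ L : ℝ} {h : Pt dx dy → Vec n} (hm : Measurable h)
    (hl : LipBall ρ L h) {m : Ω → Pt dx dy} (hmm : Measurable m) (hball : ∀ ω, ‖(m ω).2.2‖ ≤ ρ)
    {m₀ : Pt dx dy} (h₀ : ‖m₀.2.2‖ ≤ ρ) (hi : Integrable (fun ω => sqDist (m ω) m₀) Pr) :
    MemLp (fun ω => h (m ω)) 2 Pr := by
  have h1 : MemLp (fun ω => h (m ω) - h m₀) 2 Pr := by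
    have hmeas : Measurable fun ω => h (m ω) - h m₀ := (hm.comp hmm).sub_const _
    refine (memLp_two_iff_integrable_sq_norm hmeas.aestronglyMeasurable).2 ?_
    refine (hi.const_mul (L ^ 2)).mono' (hmeas.norm.pow_const 2).aestronglyMeasurable
      (Filter.Eventually.of_forall fun ω => ?_)
    rw [Real.norm_of_nonneg (sq_nonneg _)]
    exact hl _ _ (hball ω) h₀
  have h2 := memLp_add h1 (memLp_const (h m₀))
  simpa using h2

end MemLp

section Run

variable {K dx dy : ℕ} {Ω S : Type*} {mΩ : MeasurableSpace Ω} [MeasurableSpace S]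
  {E : Matrix (Fin K) (Fin K) ℝ} {ρ η β₁ β₂ β₃ θ L σ : ℝ} {B₀ B : ℕ} {x₀ : Vec dx}
  {y₀ z₀ : Vec dy} {s : ℕ × Fin K × ℕ → Ω → S} {G H : Fin K → Pt dx dy → S → Vec dy}
  {R : Fin K → Pt dx dy → S → Vec dx} {m : ℕ → Fin K → Ω → Pt dx dy} {p u : ℕ → Fin K → Ω → Vec dx}
  {q v r w : ℕ → Fin K → Ω → Vec dy}
  (a : StormRun E ρ η β₁ β₂ β₃ θ B₀ B x₀ y₀ z₀ s G H R m p u q v r w)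
include a

omit mΩ [MeasurableSpace S] in
lemma StormRun.init (k : Fin K) (ω : Ω) : m 0 k ω = (x₀, y₀, z₀) :=
  Prod.ext ((a.traj ω).initX k) (Prod.ext ((a.traj ω).initY k) ((a.traj ω).initZ k))

omit mΩ in
/-- The points of iteration `t` depend on the samples before iteration `t`, the estimators and
trackers of iteration `t` also on those of iteration `t`. -/
lemma StormRun.adapted (hρ : 0 ≤ ρ)
    (hG : ∀ k, Measurable fun p : Pt dx dy × S => G k p.1 p.2)
    (hH : ∀ k, Measurable fun p : Pt dx dy × S => H k p.1 p.2)
    (hR : ∀ k, Measurable fun p : Pt dx dy × S => R k p.1 p.2) (t : ℕ) :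
    (∀ k, Measurable[pastσ s t] (m t k)) ∧
    (∀ k, Measurable[pastσ s (t + 1)] (u t k) ∧ Measurable[pastσ s (t + 1)] (p t k)) ∧
    (∀ k, Measurable[pastσ s (t + 1)] (v t k) ∧ Measurable[pastσ s (t + 1)] (q t k)) ∧
    (∀ k, Measurable[pastσ s (t + 1)] (w t k) ∧ Measurable[pastσ s (t + 1)] (r t k)) := by
  have hs : ∀ t k i, Measurable[pastσ s (t + 1)] (s (t, k, i)) := fun t k i =>
    measurable_sample_past s t.lt_succ_self
  induction t with
  | zero =>
    have h0 : ∀ {M : MeasurableSpace Ω} k, Measurable[M] (m 0 k) := fun k => by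
      rw [show m 0 k = fun _ => (x₀, y₀, z₀) from funext fun ω => a.init k ω]
      exact measurable_const
    have hp : p 0 = u 0 := funext₂ fun k ω => (a.traj ω).initP k
    have hq : q 0 = v 0 := funext₂ fun k ω => (a.traj ω).initQ k
    have hr : r 0 = w 0 := funext₂ fun k ω => (a.traj ω).initR k
    have hu : ∀ k, Measurable[pastσ s (0 + 1)] (u 0 k) := fun k => by
      rw [show u 0 k = _ from funext (a.initU k)]
      exact measurable_batchMean_oracle (hR k) (h0 k) (hs 0 k) B₀
    have hv : ∀ k, Measurable[pastσ s (0 + 1)] (v 0 k) := fun k => by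
      rw [show v 0 k = _ from funext (a.initV k)]
      exact measurable_batchMean_oracle (hG k) (h0 k) (hs 0 k) B₀
    have hw : ∀ k, Measurable[pastσ s (0 + 1)] (w 0 k) := fun k => by
      rw [show w 0 k = _ from funext (a.initW k)]
      exact measurable_batchMean_oracle (hH k) (h0 k) (hs 0 k) B₀
    rw [hp, hq, hr]
    exact ⟨h0, fun k => ⟨hu k, hu k⟩, fun k => ⟨hv k, hv k⟩, fun k => ⟨hw k, hw k⟩⟩
  | succ t ih =>
    obtain ⟨im, iu, iv, iw⟩ := ih
    have m1 : ∀ k, Measurable[pastσ s (t + 1)] (m t k) := fun k =>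
      (im k).mono (pastσ_mono s t.le_succ) le_rfl
    have hX : ∀ k, Measurable[pastσ s (t + 1)] (fun ω => (m (t + 1) k ω).1) := fun k => by
      simp only [(a.traj _).stepX]
      exact measurable_point_step (fun k => measurable_fst.comp (m1 k)) (fun k => (iu k).2) η β₁ k
    have hY : ∀ k, Measurable[pastσ s (t + 1)] (fun ω => (m (t + 1) k ω).2.1) := fun k => by
      simp only [(a.traj _).stepY]
      exact measurable_point_step (fun k => measurable_fst.comp (measurable_snd.comp (m1 k)))
        (fun k => (iv k).2) η β₂ k
    have hZ : ∀ k, Measurable[pastσ s (t + 1)] (fun ω => (m (t + 1) k ω).2.2) := fun k => by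
      simp only [(a.traj _).stepZ]
      have hz : ∀ k, Measurable[pastσ s (t + 1)] (fun ω => (m t k ω).2.2) := fun k =>
        measurable_snd.comp (measurable_snd.comp (m1 k))
      exact (hz k).add (measurable_smul_vec (((measurable_projBall hρ).comp
        ((measurable_mixV E hz k).sub (measurable_smul_vec (iw k).2 β₃))).sub (hz k)) η)
    have hm : ∀ k, Measurable[pastσ s (t + 1)] (m (t + 1) k) := fun k =>
      (hX k).prodMk ((hY k).prodMk (hZ k))
    have up : ∀ {k : ℕ} {f : Ω → Vec k}, Measurable[pastσ s (t + 1)] f →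
        Measurable[pastσ s (t + 1 + 1)] f := fun hf =>
      hf.mono (pastσ_mono s (t + 1).le_succ) le_rfl
    have m2 : ∀ k, Measurable[pastσ s (t + 1 + 1)] (m t k) := fun k =>
      (m1 k).mono (pastσ_mono s (t + 1).le_succ) le_rfl
    have m3 : ∀ k, Measurable[pastσ s (t + 1 + 1)] (m (t + 1) k) := fun k =>
      (hm k).mono (pastσ_mono s (t + 1).le_succ) le_rfl
    have hu : ∀ k, Measurable[pastσ s (t + 1 + 1)] (u (t + 1) k) := fun k => by
      rw [show u (t + 1) k = _ from funext (a.stepU t k)]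
      exact measurable_storm_step (hR k) (m2 k) (m3 k) (up (iu k).1) (hs (t + 1) k) B θ
    have hv : ∀ k, Measurable[pastσ s (t + 1 + 1)] (v (t + 1) k) := fun k => by
      rw [show v (t + 1) k = _ from funext (a.stepV t k)]
      exact measurable_storm_step (hG k) (m2 k) (m3 k) (up (iv k).1) (hs (t + 1) k) B θ
    have hw : ∀ k, Measurable[pastσ s (t + 1 + 1)] (w (t + 1) k) := fun k => by
      rw [show w (t + 1) k = _ from funext (a.stepW t k)]
      exact measurable_storm_step (hH k) (m2 k) (m3 k) (up (iw k).1) (hs (t + 1) k) B θ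
    refine ⟨hm, fun k => ⟨hu k, ?_⟩, fun k => ⟨hv k, ?_⟩, fun k => ⟨hw k, ?_⟩⟩
    · rw [show p (t + 1) k = _ from funext fun ω => (a.traj ω).trackP t k]
      exact measurable_tracker_step (fun k => up (iu k).2) (fun k => up (iu k).1) hu k
    · rw [show q (t + 1) k = _ from funext fun ω => (a.traj ω).trackQ t k]
      exact measurable_tracker_step (fun k => up (iv k).2) (fun k => up (iv k).1) hv k
    · rw [show r (t + 1) k = _ from funext fun ω => (a.traj ω).trackR t k]
      exact measurable_tracker_step (fun k => up (iw k).2) (fun k => up (iw k).1) hw k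

variable {Pr : Measure Ω} [IsProbabilityMeasure Pr] {Gb Hb : Fin K → Pt dx dy → Vec dy}
  {Rb : Fin K → Pt dx dy → Vec dx} (oG : SampleOracle ρ L σ Pr s G Gb)
  (oH : SampleOracle ρ L σ Pr s H Hb) (oR : SampleOracle ρ L σ Pr s R Rb)
  (h0 : 0 ≤ η) (h1 : η ≤ 1) (hz : ‖z₀‖ ≤ ρ)
include oG oH oR h0 h1 hz

omit [IsProbabilityMeasure Pr] in
/-- The three estimators as variance-reduced processes. -/
lemma StormRun.processes : StormProcess ρ θ B₀ B s R m u ∧ StormProcess ρ θ B₀ B s G m v ∧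
    StormProcess ρ θ B₀ B s H m w := by
  have ad := a.adapted ((norm_nonneg _).trans hz) oG.meas oH.meas oR.meas
  have hb : ∀ t k ω, ‖(m t k ω).2.2‖ ≤ ρ := fun t k ω => (a.traj ω).ball h0 h1 hz t k
  exact ⟨⟨a.initU, a.stepU, fun t => (ad t).1, fun t k => ((ad t).2.1 k).1, hb⟩,
    ⟨a.initV, a.stepV, fun t => (ad t).1, fun t k => ((ad t).2.2.1 k).1, hb⟩,
    ⟨a.initW, a.stepW, fun t => (ad t).1, fun t k => ((ad t).2.2.2 k).1, hb⟩⟩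

variable (hs : ∀ i, Measurable (s i)) (hind : iIndepFun s Pr) (hB₀ : 1 ≤ B₀) (hB : 1 ≤ B)
include hs hind hB₀ hB

/-- All sequences of the algorithm are square integrable. -/
lemma StormRun.memLp (t : ℕ) :
    (∀ k, MemLp (fun ω => (m t k ω).1) 2 Pr ∧ MemLp (fun ω => (m t k ω).2.1) 2 Pr ∧
      MemLp (fun ω => (m t k ω).2.2) 2 Pr) ∧
    (∀ k, MemLp (u t k) 2 Pr ∧ MemLp (v t k) 2 Pr ∧ MemLp (w t k) 2 Pr) ∧
    (∀ k, MemLp (p t k) 2 Pr ∧ MemLp (q t k) 2 Pr ∧ MemLp (r t k) 2 Pr) := by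
  obtain ⟨pu, pv, pw⟩ := a.processes oG oH oR h0 h1 hz
  have hρ : 0 ≤ ρ := (norm_nonneg _).trans hz
  have hmm : ∀ t k, Measurable (m t k) := fun t k => (pu.adapted_m t k).mono (pastσ_le hs t) le_rfl
  have hzt : ∀ t k, MemLp (fun ω => (m t k ω).2.2) 2 Pr := fun t k =>
    MemLp.of_bound (measurable_snd.comp (measurable_snd.comp (hmm t k))).aestronglyMeasurable ρ
      (Filter.Eventually.of_forall fun ω => pu.ball t k ω)
  -- the estimators are square integrable as soon as the points are
  have est : ∀ t, (∀ k, MemLp (fun ω => (m t k ω).1) 2 Pr ∧ MemLp (fun ω => (m t k ω).2.1) 2 Pr) →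
      ∀ k, MemLp (u t k) 2 Pr ∧ MemLp (v t k) 2 Pr ∧ MemLp (w t k) 2 Pr := by
    intro t ht k
    have hi : Integrable (fun ω => sqDist (m t k ω) (x₀, y₀, z₀)) Pr :=
      integrable_sqDist (m' := fun _ => (x₀, y₀, z₀)) (memLp_sub (ht k).1 (memLp_const x₀))
        (memLp_sub (ht k).2 (memLp_const y₀)) (memLp_sub (hzt t k) (memLp_const z₀))
    have aux : ∀ {n : ℕ} {h : Fin K → Pt dx dy → S → Vec n} {hb : Fin K → Pt dx dy → Vec n}
        {e : ℕ → Fin K → Ω → Vec n}, SampleOracle ρ L σ Pr s h hb →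
        StormProcess ρ θ B₀ B s h m e → MemLp (e t k) 2 Pr := by
      intro n h hb e o pe
      have e1 := memLp_add (err_memLp o hs hind pe hB₀ hB t k)
        (memLp_lipBall (o.meas_bar hs k) (o.lip_bar k) (hmm t k) (pu.ball t k) (m₀ := (x₀, y₀, z₀))
          hz hi)
      simpa using e1
    exact ⟨aux oR pu, aux oG pv, aux oH pw⟩
  induction t with
  | zero =>
    have hx : ∀ k, MemLp (fun ω => (m 0 k ω).1) 2 Pr ∧ MemLp (fun ω => (m 0 k ω).2.1) 2 Pr :=
      fun k => by simp only [a.init]; exact ⟨memLp_const x₀, memLp_const y₀⟩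
    have hp : p 0 = u 0 := funext₂ fun k ω => (a.traj ω).initP k
    have hq : q 0 = v 0 := funext₂ fun k ω => (a.traj ω).initQ k
    have hr : r 0 = w 0 := funext₂ fun k ω => (a.traj ω).initR k
    rw [hp, hq, hr]
    exact ⟨fun k => ⟨(hx k).1, (hx k).2, hzt 0 k⟩, est 0 hx, est 0 hx⟩
  | succ t ih =>
    obtain ⟨im, iu, ip⟩ := ih
    have step : ∀ {n : ℕ} {f g : Fin K → Ω → Vec n} (β : ℝ), (∀ k, MemLp (f k) 2 Pr) →
        (∀ k, MemLp (g k) 2 Pr) → ∀ k, MemLp (fun ω =>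
          f k ω + η • (mixV E (fun j => f j ω) k - β • g k ω - f k ω)) 2 Pr :=
      fun β hf hg k => memLp_add (hf k) (memLp_smul (memLp_sub (memLp_sub (memLp_mixV E hf k)
        (memLp_smul (hg k) β)) (hf k)) η)
    have track : ∀ {n : ℕ} {f g g' : Fin K → Ω → Vec n}, (∀ k, MemLp (f k) 2 Pr) →
        (∀ k, MemLp (g k) 2 Pr) → (∀ k, MemLp (g' k) 2 Pr) → ∀ k, MemLp (fun ω =>
          mixV E (fun j => f j ω) k + (g' k ω - g k ω)) 2 Pr :=
      fun hf hg hg' k => memLp_add (memLp_mixV E hf k) (memLp_sub (hg' k) (hg k))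
    have hx : ∀ k, MemLp (fun ω => (m (t + 1) k ω).1) 2 Pr ∧
        MemLp (fun ω => (m (t + 1) k ω).2.1) 2 Pr := fun k => by
      simp only [(a.traj _).stepX, (a.traj _).stepY]
      exact ⟨step β₁ (fun k => (im k).1) (fun k => (ip k).1) k,
        step β₂ (fun k => (im k).2.1) (fun k => (ip k).2.1) k⟩
    have hu := est (t + 1) hx
    refine ⟨fun k => ⟨(hx k).1, (hx k).2, hzt (t + 1) k⟩, hu, fun k => ⟨?_, ?_, ?_⟩⟩
    · rw [show p (t + 1) k = _ from funext fun ω => (a.traj ω).trackP t k]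
      exact track (fun k => (ip k).1) (fun k => (iu k).1) (fun k => (hu k).1) k
    · rw [show q (t + 1) k = _ from funext fun ω => (a.traj ω).trackQ t k]
      exact track (fun k => (ip k).2.1) (fun k => (iu k).2.1) (fun k => (hu k).2.1) k
    · rw [show r (t + 1) k = _ from funext fun ω => (a.traj ω).trackR t k]
      exact track (fun k => (ip k).2.2) (fun k => (iu k).2.2) (fun k => (hu k).2.2) k

lemma StormRun.integrable_move (t : ℕ) (k : Fin K) :
    Integrable (fun ω => sqDist (m (t + 1) k ω) (m t k ω)) Pr := by
  have l0 := (a.memLp oG oH oR h0 h1 hz hs hind hB₀ hB t).1 k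
  have l1 := (a.memLp oG oH oR h0 h1 hz hs hind hB₀ hB (t + 1)).1 k
  exact integrable_sqDist (memLp_sub l1.1 l0.1) (memLp_sub l1.2.1 l0.2.1)
    (memLp_sub l1.2.2 l0.2.2)

end Run

section Algorithm

variable {K dx dy : ℕ} {Ξ Z : Type*} [MeasurableSpace Ξ] [MeasurableSpace Z]
  (P : Problem K dx dy Ξ Z) (E : Matrix (Fin K) (Fin K) ℝ) (ρ : ℝ) (a : Params)
  (x₀ : Vec dx) (y₀ z₀ : Vec dy)

/-- The recursions of the algorithm, for fixed samples. -/
lemma run_trajectory (ξ : ℕ → Fin K → ℕ → Ξ) (ζ : ℕ → Fin K → ℕ → Z) :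
    Trajectory E ρ a.η a.β₁ a.β₂ a.β₃ x₀ y₀ z₀
      (fun t k => (run P E ρ a x₀ y₀ z₀ ξ ζ t k).x)
      (fun t k => (run P E ρ a x₀ y₀ z₀ ξ ζ (t + 1) k).p)
      (fun t k => (run P E ρ a x₀ y₀ z₀ ξ ζ (t + 1) k).u)
      (fun t k => (run P E ρ a x₀ y₀ z₀ ξ ζ t k).y)
      (fun t k => (run P E ρ a x₀ y₀ z₀ ξ ζ (t + 1) k).q)
      (fun t k => (run P E ρ a x₀ y₀ z₀ ξ ζ (t + 1) k).v)
      (fun t k => (run P E ρ a x₀ y₀ z₀ ξ ζ t k).z)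
      (fun t k => (run P E ρ a x₀ y₀ z₀ ξ ζ (t + 1) k).r)
      (fun t k => (run P E ρ a x₀ y₀ z₀ ξ ζ (t + 1) k).w) := by
  have m1 : ∀ (s : Fin K → Worker dx dy) k, (mix E (fun j => (s j).msg) k).1 =
      mixV E (fun j => (s j).x) k := fun s k => by simp [mix, mixV, Prod.fst_sum, Worker.msg]
  have m2 : ∀ (s : Fin K → Worker dx dy) k, (mix E (fun j => (s j).msg) k).2.1 =
      mixV E (fun j => (s j).p) k := fun s k => by
    simp [mix, mixV, Prod.fst_sum, Prod.snd_sum, Worker.msg]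
  have m3 : ∀ (s : Fin K → Worker dx dy) k, (mix E (fun j => (s j).msg) k).2.2.1 =
      mixV E (fun j => (s j).y) k := fun s k => by
    simp [mix, mixV, Prod.fst_sum, Prod.snd_sum, Worker.msg]
  have m4 : ∀ (s : Fin K → Worker dx dy) k, (mix E (fun j => (s j).msg) k).2.2.2.1 =
      mixV E (fun j => (s j).q) k := fun s k => by
    simp [mix, mixV, Prod.fst_sum, Prod.snd_sum, Worker.msg]
  have m5 : ∀ (s : Fin K → Worker dx dy) k, (mix E (fun j => (s j).msg) k).2.2.2.2.1 =
      mixV E (fun j => (s j).z) k := fun s k => by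
    simp [mix, mixV, Prod.fst_sum, Prod.snd_sum, Worker.msg]
  have m6 : ∀ (s : Fin K → Worker dx dy) k, (mix E (fun j => (s j).msg) k).2.2.2.2.2 =
      mixV E (fun j => (s j).r) k := fun s k => by
    simp [mix, mixV, Prod.snd_sum, Worker.msg]
  have z0 : ∀ {n : ℕ} (k : Fin K), mixV E (fun _ => (0 : Vec n)) k = 0 := fun k => by simp [mixV]
  refine ⟨fun t k => ?_, fun t k => ?_, fun t k => ?_, fun t k => ?_, fun t k => ?_, fun t k => ?_,
    fun k => rfl, fun k => rfl, fun k => rfl, fun k => ?_, fun k => ?_, fun k => ?_⟩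
  · rw [← m1]; rfl
  · rw [← m3]; rfl
  · rw [← m5]; rfl
  · rw [← m2, ← add_sub_assoc]; rfl
  · rw [← m4, ← add_sub_assoc]; rfl
  · rw [← m6, ← add_sub_assoc]; rfl
  · change (mix E (fun j => (Worker.init x₀ y₀ z₀).msg) k).2.1 +
      (run P E ρ a x₀ y₀ z₀ ξ ζ (0 + 1) k).u - 0 = _
    rw [m2 (fun _ => Worker.init x₀ y₀ z₀) k, sub_zero]
    exact (congrArg (· + _) (z0 k)).trans (zero_add _)
  · change (mix E (fun j => (Worker.init x₀ y₀ z₀).msg) k).2.2.2.1 +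
      (run P E ρ a x₀ y₀ z₀ ξ ζ (0 + 1) k).v - 0 = _
    rw [m4 (fun _ => Worker.init x₀ y₀ z₀) k, sub_zero]
    exact (congrArg (· + _) (z0 k)).trans (zero_add _)
  · change (mix E (fun j => (Worker.init x₀ y₀ z₀).msg) k).2.2.2.2.2 +
      (run P E ρ a x₀ y₀ z₀ ξ ζ (0 + 1) k).w - 0 = _
    rw [m6 (fun _ => Worker.init x₀ y₀ z₀) k, sub_zero]
    exact (congrArg (· + _) (z0 k)).trans (zero_add _)

/-- The algorithm as a stochastic process. -/
lemma run_stormRun {Ω : Type*} (ξ : ℕ → Fin K → ℕ → Ω → Ξ) (ζ : ℕ → Fin K → ℕ → Ω → Z) {θ : ℝ}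
    (h₁ : a.α₁ * a.η ^ 2 = θ) (h₂ : a.α₂ * a.η ^ 2 = θ) (h₃ : a.α₃ * a.η ^ 2 = θ)
    {W : ℕ → Fin K → Ω → Worker dx dy}
    (hW : W = fun t k ω =>
      run P E ρ a x₀ y₀ z₀ (fun t k i => ξ t k i ω) (fun t k i => ζ t k i ω) t k) :
    StormRun E ρ a.η a.β₁ a.β₂ a.β₃ θ a.B₀ a.B x₀ y₀ z₀ (samplePair ξ ζ) P.oracleG P.oracleH
      P.oracleF (fun t k ω => ((W t k ω).x, (W t k ω).y, (W t k ω).z))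
      (fun t k ω => (W (t + 1) k ω).p) (fun t k ω => (W (t + 1) k ω).u)
      (fun t k ω => (W (t + 1) k ω).q) (fun t k ω => (W (t + 1) k ω).v)
      (fun t k ω => (W (t + 1) k ω).r) (fun t k ω => (W (t + 1) k ω).w) := by
  subst hW
  refine ⟨fun ω => run_trajectory P E ρ a x₀ y₀ z₀ _ _, fun k ω => rfl, fun k ω => rfl,
    fun k ω => rfl, fun t k ω => ?_, fun t k ω => ?_, fun t k ω => ?_⟩
  · rw [← h₁]; rfl
  · rw [← h₂]; rfl
  · rw [← h₃]; rfl

end Algorithm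

/-! ### Expected bounds -/

/-- Initial consensus error plus total variation of the estimators of all workers; this controls
the consensus errors of the corresponding trackers. -/
def variation {K n : ℕ} {Ω : Type*} (u : ℕ → Fin K → Ω → Vec n) (T : ℕ) (ω : Ω) : ℝ :=
  msq (dev fun k => u 0 k ω) + ∑ t ∈ Finset.range T, msq fun k => u (t + 1) k ω - u t k ω

/-- The weighted consensus error of a tracker. -/
lemma weighted_dev_tracker_le {K n : ℕ} {Ω : Type*} {E : Matrix (Fin K) (Fin K) ℝ} (hE : IsMixing E)
    (hK : 0 < K) {p u : ℕ → Fin K → Ω → Vec n} {ω : Ω}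
    (h : ∀ t k, p (t + 1) k ω = mixV E (fun j => p t j ω) k + (u (t + 1) k ω - u t k ω))
    (h0 : ∀ k, p 0 k ω = u 0 k ω) {c : ℝ} (hc : c ≤ (1 - lam E) ^ 4) (T : ℕ) :
    c / (1 - lam E) ^ 2 * ∑ t ∈ Finset.range T, msq (dev fun k => p t k ω) ≤ variation u T ω := by
  have hs : 0 < 1 - lam E := by linarith [hE.gap]
  have h1 := sum_dev_tracker_le hE hK (P := fun t k => p t k ω) (U := fun t k => u t k ω) h T
  simp only [h0] at h1
  refine le_trans (mul_le_mul_of_nonneg_right ?_ (Finset.sum_nonneg fun t _ => msq_nonneg _)) h1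
  rw [div_le_iff₀ (by positivity)]
  calc c ≤ (1 - lam E) ^ 4 := hc
    _ = _ := by ring

section Estimator

variable {K dx dy n : ℕ} {Ω S : Type*} [MeasurableSpace Ω] [MeasurableSpace S] {ρ L σ θ : ℝ}
  {Pr : Measure Ω} [IsProbabilityMeasure Pr] {s : ℕ × Fin K × ℕ → Ω → S}
  {h : Fin K → Pt dx dy → S → Vec n} {hb : Fin K → Pt dx dy → Vec n} {B₀ B : ℕ}
  {m : ℕ → Fin K → Ω → Pt dx dy} {u : ℕ → Fin K → Ω → Vec n}
  (o : SampleOracle ρ L σ Pr s h hb) (hs : ∀ i, Measurable (s i)) (hind : iIndepFun s Pr)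
  (p : StormProcess ρ θ B₀ B s h m u)
  (hmove : ∀ t k, Integrable (fun ω => sqDist (m (t + 1) k ω) (m t k ω)) Pr)
  (hK : 0 < K) (hB₀ : 1 ≤ B₀) (hB : 1 ≤ B) (hθ : 0 < θ) (hθ1 : θ ≤ 1)
include o hs hind p hmove hK hB₀ hB hθ hθ1

/-- Expected variation of an estimator that starts at a deterministic point `m₀`. -/
lemma integral_variation_le {m₀ : Pt dx dy} (hm₀ : ∀ k ω, m 0 k ω = m₀) (T : ℕ) :
    Integrable (variation u T) Pr ∧ ∫ ω, variation u T ω ∂Pr ≤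
      5 * σ ^ 2 + 2 * msq (dev fun k => hb k m₀) + 9 * (T * θ ^ 2 * σ ^ 2) + 27 * L ^ 2 *
        ∑ t ∈ Finset.range T, ∫ ω, move (fun k => m t k ω) (fun k => m (t + 1) k ω) ∂Pr := by
  have hΔ := fun t => (integral_msq_estimator_sub_le o hs hind p hmove hB₀ hB hK t).1
  have he := err_memLp o hs hind p hB₀ hB 0
  have hei : Integrable (fun ω => msq fun k => u 0 k ω - hb k (m 0 k ω)) Pr :=
    (integrable_finsetSum _ fun k _ => integrable_sq_of_memLp (he k)).const_mul _
  have hum : ∀ k, Measurable (u 0 k) := fun k => (p.adapted_u 0 k).mono (pastσ_le hs _) le_rfl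
  have hpt : ∀ ω, msq (dev fun k => u 0 k ω) ≤
      2 * msq (fun k => u 0 k ω - hb k (m 0 k ω)) + 2 * msq (dev fun k => hb k m₀) := by
    intro ω
    have e : (dev fun k => u 0 k ω) = fun k =>
        dev (fun k => u 0 k ω - hb k (m 0 k ω)) k + dev (fun k => hb k m₀) k := by
      rw [← dev_add]
      simp only [hm₀, sub_add_cancel]
    rw [e]
    refine (msq_add_le _ _).trans ?_
    linarith [msq_dev_le hK fun k => u 0 k ω - hb k (m 0 k ω)]
  have hdm : Measurable fun ω => msq (dev fun k => u 0 k ω) := by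
    unfold msq dev
    exact (Finset.measurable_sum _ fun k _ =>
      ((hum k).sub (measurable_avg hum)).norm.pow_const 2).const_mul _
  have hd : Integrable (fun ω => msq (dev fun k => u 0 k ω)) Pr := by
    refine ((hei.const_mul 2).add (integrable_const (2 * msq (dev fun k => hb k m₀)))).mono'
      hdm.aestronglyMeasurable
      (Filter.Eventually.of_forall fun ω => ?_)
    rw [Real.norm_of_nonneg (msq_nonneg _)]
    exact hpt ω
  have hsum : Integrable (fun ω => ∑ t ∈ Finset.range T, msq fun k => u (t + 1) k ω - u t k ω) Pr :=
    integrable_finsetSum _ fun t _ => hΔ t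
  refine ⟨hd.add hsum, ?_⟩
  unfold variation
  rw [integral_add hd hsum, integral_finsetSum _ fun t _ => hΔ t]
  have h1 := sum_integral_msq_estimator_sub_le o hs hind p hmove hK hB₀ hB hθ hθ1 T
  have h2 := integral_mono hd ((hei.const_mul 2).add (integrable_const _)) hpt
  simp only [Pi.add_apply] at h2
  rw [integral_add (hei.const_mul 2) (integrable_const _), integral_const_mul, integral_const,
    probReal_univ, one_smul] at h2
  have h3 := integral_msq_err_zero_le o hs hind p hK hB₀
  linarith

/-- Expected estimation error for the momentum parameter `θ = η² / K`. -/
lemma integral_err_le {η : ℝ} (hη : 0 < η) (hKθ : K * θ = η ^ 2) (T : ℕ) :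
    Integrable (fun ω => ∑ t ∈ Finset.range T, ‖avg (fun k => u t k ω) -
      avg fun k => hb k (m t k ω)‖ ^ 2) Pr ∧
    ∫ ω, ∑ t ∈ Finset.range T, ‖avg (fun k => u t k ω) - avg fun k => hb k (m t k ω)‖ ^ 2 ∂Pr ≤
      σ ^ 2 / (η ^ 2 * B₀) + 2 * (T * η ^ 2 * σ ^ 2 / K ^ 2) + 8 * L ^ 2 *
        ((∑ t ∈ Finset.range T, ∫ ω, move (fun k => m t k ω) (fun k => m (t + 1) k ω) ∂Pr) /
          η ^ 2) := by
  have hi : ∀ t, Integrable (fun ω => ‖avg (fun k => u t k ω - hb k (m t k ω))‖ ^ 2) Pr := fun t =>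
    integrable_sq_of_memLp (memLp_avg fun k => err_memLp o hs hind p hB₀ hB t k)
  simp only [← avg_sub]
  refine ⟨integrable_finsetSum _ fun t _ => hi t, ?_⟩
  rw [integral_finsetSum _ fun t _ => hi t]
  have h1 := sum_integral_sq_avg_err_le o hs hind p hmove hK hB₀ hB hθ hθ1 T
  set D := ∑ t ∈ Finset.range T, ∫ ω, move (fun k => m t k ω) (fun k => m (t + 1) k ω) ∂Pr
  have hK' : (0 : ℝ) < K := by exact_mod_cast hK
  have hB' : (0 : ℝ) < B₀ := by exact_mod_cast hB₀
  have hθe : θ = η ^ 2 / K := by rw [← hKθ]; field_simp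
  refine le_of_mul_le_mul_left (h1.trans (le_of_eq ?_)) hθ
  rw [hθe]
  field_simp
  ring

end Estimator

lemma integral_add₃ {Ω : Type*} [MeasurableSpace Ω] {Pr : Measure Ω} {f g h : Ω → ℝ}
    (hf : Integrable f Pr) (hg : Integrable g Pr) (hh : Integrable h Pr) :
    Integrable (fun ω => f ω + g ω + h ω) Pr ∧
      ∫ ω, (f ω + g ω + h ω) ∂Pr = ∫ ω, f ω ∂Pr + ∫ ω, g ω ∂Pr + ∫ ω, h ω ∂Pr := by
  have h1 : Integrable (fun ω => f ω + g ω) Pr := hf.add hg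
  exact ⟨h1.add hh, by rw [integral_add h1 hh, integral_add hf hg]⟩

/-- Taking expectations in a pointwise bound. -/
lemma integral_le_of_pointwise {Ω : Type*} [MeasurableSpace Ω] {Pr : Measure Ω}
    [IsProbabilityMeasure Pr] {A Er N : Ω → ℝ} (hA : Integrable A Pr) (hE : Integrable Er Pr)
    (hN : Integrable N Pr) {c I d : ℝ} (h : ∀ ω, A ω ≤ c * (I + Er ω) + d * N ω) :
    ∫ ω, A ω ∂Pr ≤ c * (I + ∫ ω, Er ω ∂Pr) + d * ∫ ω, N ω ∂Pr := by
  have h1 : Integrable (fun ω => c * (I + Er ω)) Pr := ((integrable_const I).add hE).const_mul c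
  have h2 := integral_mono hA (h1.add (hN.const_mul d)) h
  simp only [Pi.add_apply] at h2
  rw [integral_add h1 (hN.const_mul d), integral_const_mul, integral_const_mul,
    integral_add (integrable_const I) hE, integral_const, probReal_univ, one_smul] at h2
  exact h2

/-- The movement `D`, the estimation error `Er` and the variation `N` bound each other; for small
step sizes the loop closes. -/
lemma small_gain_total {Λ L b η S D I Er N e₀ n₀ : ℝ} (hΛ : 1 ≤ Λ) (hb : 0 ≤ b)
    (hb1 : b ≤ 1) (hη : η ≤ 1) (hη0 : 0 ≤ η) (hI : 0 ≤ I) (he : 0 ≤ e₀) (hn : 0 ≤ n₀) (hD0 : 0 ≤ D)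
    (hg : 24 * Λ ^ 4 * (L ^ 2 * (162 * η ^ 2 + 24 * b ^ 2)) ≤ 1 / 2)
    (hS : S ≤ 4 * Λ ^ 3 * (I + Er + N))
    (hD : D ≤ 24 * Λ ^ 4 * (N + b ^ 2 * (I + Er + N)))
    (hE : Er ≤ e₀ + 24 * L ^ 2 * D) (hN : N ≤ n₀ + 81 * L ^ 2 * η ^ 2 * D) :
    S ≤ 4 * Λ ^ 3 * (1 + 10080 * L ^ 2 * Λ ^ 4) * (I + e₀ + n₀) := by
  have hb2 : b ^ 2 ≤ 1 := pow_le_one₀ hb hb1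
  have hη2 : η ^ 2 ≤ 1 := pow_le_one₀ hη0 hη
  set Q := L ^ 2 * D with hQ
  have hQ0 : 0 ≤ Q := by positivity
  have hE' : Er ≤ e₀ + 24 * Q := by rw [hQ]; linarith
  have hN' : N ≤ n₀ + 81 * (η ^ 2 * Q) := by rw [hQ]; linarith
  have t0 : 0 ≤ η ^ 2 * Q := by positivity
  have t1 : N + b ^ 2 * (I + Er + N) ≤ 2 * n₀ + I + e₀ + (162 * η ^ 2 + 24 * b ^ 2) * Q := by
    have a1 : b ^ 2 * (I + Er + N) ≤
        b ^ 2 * (I + (e₀ + 24 * Q) + (n₀ + 81 * (η ^ 2 * Q))) := by gcongr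
    have a2 : b ^ 2 * (I + e₀ + n₀ + 81 * (η ^ 2 * Q)) ≤ I + e₀ + n₀ + 81 * (η ^ 2 * Q) :=
      mul_le_of_le_one_left (by positivity) hb2
    linarith
  have t2 : D ≤ 24 * Λ ^ 4 * (2 * n₀ + I + e₀) + 1 / 2 * D := by
    calc D ≤ 24 * Λ ^ 4 * (2 * n₀ + I + e₀ + (162 * η ^ 2 + 24 * b ^ 2) * Q) :=
          hD.trans (by gcongr)
      _ = 24 * Λ ^ 4 * (2 * n₀ + I + e₀) +
          24 * Λ ^ 4 * (L ^ 2 * (162 * η ^ 2 + 24 * b ^ 2)) * D := by rw [hQ]; ring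
      _ ≤ _ := by gcongr
  have t3 : D ≤ 96 * Λ ^ 4 * (I + e₀ + n₀) := by
    have : 0 ≤ Λ ^ 4 * (I + e₀) := by positivity
    linarith
  have t4 : η ^ 2 * Q ≤ Q := mul_le_of_le_one_left hQ0 hη2
  calc S ≤ 4 * Λ ^ 3 * (I + Er + N) := hS
    _ ≤ 4 * Λ ^ 3 * (I + e₀ + n₀ + 105 * Q) :=
        mul_le_mul_of_nonneg_left (by linarith) (by positivity)
    _ ≤ 4 * Λ ^ 3 * (I + e₀ + n₀ + 105 * (L ^ 2 * (96 * Λ ^ 4 * (I + e₀ + n₀)))) := by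
        rw [hQ]; gcongr
    _ = _ := by ring

section Run

variable {K dx dy : ℕ} {Ω S : Type*} [MeasurableSpace Ω] [MeasurableSpace S]
  {E : Matrix (Fin K) (Fin K) ℝ} {ρ η β₁ β₂ β₃ θ L μ σ : ℝ} {B₀ B : ℕ} {x₀ : Vec dx}
  {y₀ z₀ : Vec dy} {s : ℕ × Fin K × ℕ → Ω → S} {G H : Fin K → Pt dx dy → S → Vec dy}
  {R : Fin K → Pt dx dy → S → Vec dx} {m : ℕ → Fin K → Ω → Pt dx dy} {p u : ℕ → Fin K → Ω → Vec dx}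
  {q v r w : ℕ → Fin K → Ω → Vec dy} {Pr : Measure Ω} [IsProbabilityMeasure Pr]
  {Gb Hb : Fin K → Pt dx dy → Vec dy} {Rb : Fin K → Pt dx dy → Vec dx} {F : Vec dx → ℝ}
  {ys zs : Vec dx → Vec dy}
  (a : StormRun E ρ η β₁ β₂ β₃ θ B₀ B x₀ y₀ z₀ s G H R m p u q v r w)
  (l : Landscape L μ ρ Gb Hb Rb F ys zs)
  (oG : SampleOracle ρ L σ Pr s G Gb) (oH : SampleOracle ρ L σ Pr s H Hb)
  (oR : SampleOracle ρ L σ Pr s R Rb) (hs : ∀ i, Measurable (s i)) (hind : iIndepFun s Pr)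
  (hB₀ : 1 ≤ B₀) (hB : 1 ≤ B) (hz : ‖z₀‖ ≤ ρ) (hL : 1 ≤ L) (hK : 0 < K)
include a l oG oH oR hs hind hB₀ hB hz hL hK

/-- The squared gradient at the averaged iterate is integrable. -/
lemma StormRun.integrable_sq_gradient (h0 : 0 ≤ η) (h1 : η ≤ 1) (t : ℕ) :
    Integrable (fun ω => ‖avg fun k => Rb k (avg (fun k => (m t k ω).1),
      ys (avg fun k => (m t k ω).1), zs (avg fun k => (m t k ω).1))‖ ^ 2) Pr := by
  have hX := memLp_avg fun k => ((a.memLp oG oH oR h0 h1 hz hs hind hB₀ hB t).1 k).1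
  set X : Ω → Vec dx := fun ω => avg fun k => (m t k ω).1 with hXdef
  have hm : ∀ k, Measurable fun ω => (m t k ω).1 := fun k => measurable_fst.comp
    (((a.processes oG oH oR h0 h1 hz).1.adapted_m t k).mono (pastσ_le hs t) le_rfl)
  have hXm : Measurable X := measurable_avg hm
  set g : Vec dx → Vec dx := fun x => avg fun k => Rb k (x, ys x, zs x) with hg
  have hlip : ∀ x x', ‖g x - g x'‖ ≤ 2 * L ^ 2 * ‖x - x'‖ := l.lip_grad hK hL
  have hgc : Continuous g := by
    refine (LipschitzWith.of_dist_le_mul (K := (2 * L ^ 2).toNNReal) fun x x' => ?_).continuous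
    rw [dist_eq_norm, dist_eq_norm, Real.coe_toNNReal _ (by positivity)]
    exact hlip x x'
  have hgm : Measurable fun ω => g (X ω) := hgc.measurable.comp hXm
  have h2 := ((integrable_sq_of_memLp hX).const_mul (2 * (2 * L ^ 2) ^ 2)).add
    (integrable_const (μ := Pr) (2 * ‖g 0‖ ^ 2))
  refine h2.mono' (hgm.norm.pow_const 2).aestronglyMeasurable
    (Filter.Eventually.of_forall fun ω => ?_)
  change ‖‖g (X ω)‖ ^ 2‖ ≤ 2 * (2 * L ^ 2) ^ 2 * ‖X ω‖ ^ 2 + 2 * ‖g 0‖ ^ 2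
  rw [Real.norm_of_nonneg (sq_nonneg _)]
  have h3 := sq_norm_add_le (g (X ω) - g 0) (g 0)
  rw [sub_add_cancel] at h3
  have h4 : ‖g (X ω) - g 0‖ ^ 2 ≤ (2 * L ^ 2) ^ 2 * ‖X ω‖ ^ 2 := by
    rw [← mul_pow]
    have := hlip (X ω) 0
    rw [sub_zero] at this
    gcongr
  linarith

/-- The expected sum of squared gradients in terms of initial quantities and of the variance. -/
theorem StormRun.sum_integral_sq_gradient_le (hE : IsMixing E) (hμ : 0 < μ) (hμ1 : μ ≤ 1)
    (h0 : 0 < η) (h1 : η ≤ 1) {b r' : ℝ} (hβ₁ : 0 < β₁) (hβ₂ : 0 < β₂) (hβ₃ : 0 < β₃)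
    (hb₂ : β₂ ≤ b) (hb₃ : β₃ ≤ b) (hr₂ : β₁ ≤ r' * β₂) (hr₃ : β₁ ≤ r' * β₃) (hr1 : r' ≤ 1)
    (hb1 : b ≤ 1) (hb : 8 * L ^ 2 * b ≤ μ) (hr : 16 * (300 * L ^ 2 / μ ^ 2) ^ 3 * r' ^ 2 ≤ 1)
    (hs₁ : β₁ ^ 2 ≤ (1 - lam E) ^ 4) (hs₂ : β₂ ^ 2 ≤ (1 - lam E) ^ 4) (hs₃ : β₃ ≤ (1 - lam E) ^ 4)
    (hθ : 0 < θ) (hθ1 : θ ≤ 1) (hKθ : K * θ = η ^ 2)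
    (hg : 24 * (300 * L ^ 2 / μ ^ 2) ^ 4 * (L ^ 2 * (162 * η ^ 2 + 24 * b ^ 2)) ≤ 1 / 2)
    {ΔF J : ℝ} (hF : ∀ x, F x₀ - F x ≤ ΔF)
    (hJ : msq (dev fun k => Rb k (x₀, y₀, z₀)) + msq (dev fun k => Gb k (x₀, y₀, z₀)) +
      msq (dev fun k => Hb k (x₀, y₀, z₀)) ≤ J) (T : ℕ) :
    ∑ t ∈ Finset.range T, ∫ ω, ‖avg fun k => Rb k (avg (fun k => (m t k ω).1),
      ys (avg fun k => (m t k ω).1), zs (avg fun k => (m t k ω).1))‖ ^ 2 ∂Pr ≤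
      4 * (300 * L ^ 2 / μ ^ 2) ^ 3 * (1 + 10080 * L ^ 2 * (300 * L ^ 2 / μ ^ 2) ^ 4) *
        ((2 * ΔF / (η * β₁) + 2 / (η * β₂ * μ) * ‖y₀ - ys x₀‖ ^ 2 +
            4 / (η * β₃ * μ) * ‖z₀ - zs x₀‖ ^ 2) +
          (3 * (σ ^ 2 / (η ^ 2 * B₀)) + 6 * (T * η ^ 2 * σ ^ 2 / K ^ 2)) +
          (15 * σ ^ 2 + 2 * J + 27 * (T * θ ^ 2 * σ ^ 2))) := by
  obtain ⟨pu, pv, pw⟩ := a.processes oG oH oR h0.le h1 hz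
  have hmove := a.integrable_move oG oH oR h0.le h1 hz hs hind hB₀ hB
  have hK' : (0 : ℝ) < K := by exact_mod_cast hK
  set Λ := 300 * L ^ 2 / μ ^ 2 with hΛdef
  have hΛ : 1 ≤ Λ := by
    rw [hΛdef, le_div_iff₀ (by positivity)]
    nlinarith [one_le_pow₀ hL (n := 2), pow_le_one₀ hμ.le hμ1 (n := 2)]
  set D := ∑ t ∈ Finset.range T, ∫ ω, move (fun k => m t k ω) (fun k => m (t + 1) k ω) ∂Pr with hD
  have hD0 : 0 ≤ D := Finset.sum_nonneg fun t _ => integral_nonneg fun ω => by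
    unfold move
    exact mul_nonneg (by positivity) (Finset.sum_nonneg fun k _ => sqDist_nonneg _ _)
  set I := 2 * ΔF / (η * β₁) + 2 / (η * β₂ * μ) * ‖y₀ - ys x₀‖ ^ 2 +
            4 / (η * β₃ * μ) * ‖z₀ - zs x₀‖ ^ 2 with hI
  have hΔF : 0 ≤ ΔF := by simpa using hF x₀
  have hI0 : 0 ≤ I := by positivity
  have hm0 : ∀ k ω, m 0 k ω = (x₀, y₀, z₀) := a.init
  obtain ⟨vu, vu'⟩ := integral_variation_le oR hs hind pu hmove hK hB₀ hB hθ hθ1 hm0 T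
  obtain ⟨vv, vv'⟩ := integral_variation_le oG hs hind pv hmove hK hB₀ hB hθ hθ1 hm0 T
  obtain ⟨vw, vw'⟩ := integral_variation_le oH hs hind pw hmove hK hB₀ hB hθ hθ1 hm0 T
  obtain ⟨eu, eu'⟩ := integral_err_le oR hs hind pu hmove hK hB₀ hB hθ hθ1 h0 hKθ T
  obtain ⟨ev, ev'⟩ := integral_err_le oG hs hind pv hmove hK hB₀ hB hθ hθ1 h0 hKθ T
  obtain ⟨ew, ew'⟩ := integral_err_le oH hs hind pw hmove hK hB₀ hB hθ hθ1 h0 hKθ T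
  set N : Ω → ℝ := fun ω => variation u T ω + variation v T ω + variation w T ω with hNdef
  obtain ⟨hN, hNint⟩ : Integrable N Pr ∧ _ := integral_add₃ vu vv vw
  set Er : Ω → ℝ := fun ω => ∑ t ∈ Finset.range T,
    estErr Gb Hb Rb (fun k => m t k ω) (fun k => u t k ω) (fun k => v t k ω) (fun k => w t k ω)
    with hErdef
  have hErω : ∀ ω, Er ω =
      ∑ t ∈ Finset.range T, ‖avg (fun k => u t k ω) - avg fun k => Rb k (m t k ω)‖ ^ 2 +
      ∑ t ∈ Finset.range T, ‖avg (fun k => v t k ω) - avg fun k => Gb k (m t k ω)‖ ^ 2 +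
      ∑ t ∈ Finset.range T, ‖avg (fun k => w t k ω) - avg fun k => Hb k (m t k ω)‖ ^ 2 := by
    intro ω
    simp only [hErdef, estErr, Finset.sum_add_distrib]
  obtain ⟨hEr, hErint⟩ := integral_add₃ eu ev ew
  simp only [← hErω] at hEr hErint
  -- the deterministic analysis, for every outcome
  have det := fun ω => trajectory_bounds l (a.traj ω) hE hK hL hμ hμ1 h0 h1 hz hβ₁ hβ₂ hβ₃ hb₂ hb₃
    hr₂ hr₃ hr1 hb hr hF T (Er := Er ω) rfl rfl hI
  have hMN : ∀ ω, β₁ ^ 2 / (1 - lam E) ^ 2 * ∑ t ∈ Finset.range T, msq (dev fun k => p t k ω) +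
      β₂ ^ 2 / (1 - lam E) ^ 2 * ∑ t ∈ Finset.range T, msq (dev fun k => q t k ω) +
      β₃ / (1 - lam E) ^ 2 * ∑ t ∈ Finset.range T, msq (dev fun k => r t k ω) ≤ N ω := by
    intro ω
    exact add_le_add (add_le_add
      (weighted_dev_tracker_le hE hK (a.traj ω).trackP (a.traj ω).initP hs₁ T)
      (weighted_dev_tracker_le hE hK (a.traj ω).trackQ (a.traj ω).initQ hs₂ T))
      (weighted_dev_tracker_le hE hK (a.traj ω).trackR (a.traj ω).initR hs₃ T)
  have hgi := a.integrable_sq_gradient l oG oH oR hs hind hB₀ hB hz hL hK h0.le h1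
  have hmi : ∀ t, Integrable (fun ω => move (fun k => m t k ω) (fun k => m (t + 1) k ω)) Pr :=
    fun t => (integrable_finsetSum _ fun k _ => hmove t k).const_mul _
  have b1 := integral_le_of_pointwise (c := 4 * Λ ^ 3) (I := I) (d := 4 * Λ ^ 3)
    (integrable_finsetSum (Finset.range T) fun t _ => hgi t) hEr hN fun ω => by
      refine (det ω).1.trans ?_
      rw [mul_add]
      gcongr
      exact hMN ω
  have b2 := integral_le_of_pointwise (c := η ^ 2 * (24 * Λ ^ 4) * b ^ 2) (I := I)
    (d := η ^ 2 * (24 * Λ ^ 4) * (1 + b ^ 2))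
    (integrable_finsetSum (Finset.range T) fun t _ => hmi t) hEr hN fun ω => by
      refine (det ω).2.trans ?_
      calc _ ≤ η ^ 2 * (24 * Λ ^ 4 * (N ω + b ^ 2 * (I + Er ω + N ω))) := by
            gcongr
            · exact hMN ω
            · exact hMN ω
        _ = _ := by ring
  rw [integral_finsetSum _ fun t _ => hgi t] at b1
  rw [integral_finsetSum _ fun t _ => hmi t, ← hD] at b2
  have hη2 : 0 < η ^ 2 := by positivity
  refine small_gain_total (D := D / η ^ 2) (Er := ∫ ω, Er ω ∂Pr) (N := ∫ ω, N ω ∂Pr) hΛ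
    (hβ₂.le.trans hb₂) hb1 h1 h0.le hI0 (by positivity) ?_ (by positivity) hg (by linarith) ?_ ?_ ?_
  · have : 0 ≤ J := le_trans (add_nonneg (add_nonneg (msq_nonneg _) (msq_nonneg _))
      (msq_nonneg _)) hJ
    positivity
  · rw [div_le_iff₀ hη2]
    linarith
  · rw [hErint]
    linarith
  · rw [hNint]
    have : η ^ 2 * (D / η ^ 2) = D := by field_simp
    rw [mul_assoc _ (η ^ 2), this]
    linarith

end Run

/-! ### Choice of the constants -/

lemma SampleOracle.mono {K dx dy n : ℕ} {Ω S : Type*} [MeasurableSpace Ω] [MeasurableSpace S]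
    {ρ L L' σ : ℝ} {Pr : Measure Ω} {s : ℕ × Fin K × ℕ → Ω → S}
    {h : Fin K → Pt dx dy → S → Vec n} {hb : Fin K → Pt dx dy → Vec n}
    (o : SampleOracle ρ L σ Pr s h hb) (h0 : 0 ≤ L) (hL : L ≤ L') :
    SampleOracle ρ L' σ Pr s h hb :=
  { o with lip := fun k x => (o.lip k x).mono h0 hL }

/-- The initial consensus errors are controlled by the heterogeneity at the starting point. -/
lemma Problem.Regular.initial_dev_le {K dx dy : ℕ} {Ξ Z : Type*} [MeasurableSpace Ξ]
    [MeasurableSpace Z] {P : Problem K dx dy Ξ Z} {c : Constants} (h : P.Regular c) (hK : 0 < K)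
    (x₀ : Vec dx) (y₀ z₀ : Vec dy) (hz : ‖z₀‖ ≤ c.cfy / c.μ) :
    msq (dev fun k => P.meanF k (x₀, y₀, z₀)) + msq (dev fun k => P.meanG k (x₀, y₀, z₀)) +
      msq (dev fun k => P.meanH k (x₀, y₀, z₀)) ≤
      3 * P.hetAt x₀ y₀ + (2 * (c.cgxy * (c.cfy / c.μ)) ^ 2 + 2 * (c.lgy * (c.cfy / c.μ)) ^ 2 +
        2 * c.cfy ^ 2) := by
  have hρ := c.radius_nonneg
  have hK' : (0 : ℝ) < K := by exact_mod_cast hK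
  have hcg := c.cgxy_pos.le
  have hlg := c.lgy_pos.le
  have msq_le : ∀ {n : ℕ} {a : Fin K → Vec n} {q : ℝ}, (∀ k, ‖a k‖ ≤ q) → msq a ≤ q ^ 2 := by
    intro n a q ha
    unfold msq
    calc _ ≤ (K : ℝ)⁻¹ * ∑ _k : Fin K, q ^ 2 := by gcongr with k _; exact ha k
      _ = _ := by
        rw [Finset.sum_const, Finset.card_univ, Fintype.card_fin, nsmul_eq_mul]
        field_simp
  have hhet : P.hetAt x₀ y₀ = msq (dev fun k => grad₁ (P.fLoc k) x₀ y₀) +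
      msq (dev fun k => grad₂ (P.gLoc k) x₀ y₀) := by
    have e1 : grad₁ P.fAvg x₀ y₀ = avg fun k => grad₁ (P.fLoc k) x₀ y₀ :=
      (h.hasGradientAt_fAvg₁ x₀ y₀).gradient
    have e2 : grad₂ P.gAvg x₀ y₀ = avg fun k => grad₂ (P.gLoc k) x₀ y₀ :=
      (h.hasGradientAt_gAvg₂ x₀ y₀).gradient
    unfold Problem.hetAt msq dev
    rw [e1, e2, Finset.sum_add_distrib, mul_add]
  have n12 : ∀ k, ‖hess₁₂ (P.gLoc k) x₀ y₀ z₀‖ ≤ c.cgxy * (c.cfy / c.μ) := by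
    intro k
    have := h.prob_g k
    have h1 := norm_integral_le_of_norm_le_const (μ := P.Dg k)
      (f := fun ζ => hess₁₂ (P.gS k ζ) x₀ y₀)
      (Filter.Eventually.of_forall fun ζ => h.bdd_g₁₂ k ζ x₀ y₀)
    rw [probReal_univ, mul_one, ← h.hess₁₂_gLoc] at h1
    exact (ContinuousLinearMap.le_opNorm _ _).trans (by gcongr)
  have n22 : ∀ k, ‖hess₂₂ (P.gLoc k) x₀ y₀ z₀‖ ≤ c.lgy * (c.cfy / c.μ) := by
    intro k
    have h1 : ‖hess₂₂ (P.gLoc k) x₀ y₀‖ ≤ c.lgy := norm_fderiv_le_of_lip' ℝ hlg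
      (Filter.Eventually.of_forall fun y' => (h.lip_grad₂_gLoc k).right x₀ y' y₀)
    exact (ContinuousLinearMap.le_opNorm _ _).trans (by gcongr)
  have bF : msq (dev fun k => P.meanF k (x₀, y₀, z₀)) ≤
      2 * msq (dev fun k => grad₁ (P.fLoc k) x₀ y₀) + 2 * (c.cgxy * (c.cfy / c.μ)) ^ 2 := by
    have e : (dev fun k => P.meanF k (x₀, y₀, z₀)) = fun k =>
        dev (fun k => grad₁ (P.fLoc k) x₀ y₀) k - dev (fun k => hess₁₂ (P.gLoc k) x₀ y₀ z₀) k := by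
      rw [← dev_sub]; rfl
    rw [e]
    refine (msq_sub_le _ _).trans ?_
    linarith [(msq_dev_le hK fun k => hess₁₂ (P.gLoc k) x₀ y₀ z₀).trans (msq_le n12)]
  have bH : msq (dev fun k => P.meanH k (x₀, y₀, z₀)) ≤
      2 * (c.lgy * (c.cfy / c.μ)) ^ 2 + 2 * c.cfy ^ 2 := by
    refine (msq_dev_le hK _).trans ((msq_sub_le _ _).trans ?_)
    linarith [msq_le n22, msq_le fun k => h.norm_grad₂_fLoc_le k x₀ y₀]
  have bG : msq (dev fun k => P.meanG k (x₀, y₀, z₀)) = msq (dev fun k => grad₂ (P.gLoc k) x₀ y₀) :=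
    rfl
  have p1 : 0 ≤ msq (dev fun k => grad₁ (P.fLoc k) x₀ y₀) := msq_nonneg _
  have p2 : 0 ≤ msq (dev fun k => grad₂ (P.gLoc k) x₀ y₀) := msq_nonneg _
  rw [hhet, bG]
  linarith

/-- Step-size constants: `b` for `β₂` and `β₃`, and the ratio `r` of `β₁` to them. -/
lemma exists_step_constants {L μ : ℝ} (hL : 1 ≤ L) (hμ : 0 < μ) (hμ1 : μ ≤ 1) :
    ∃ b r : ℝ, 0 < b ∧ 0 < r ∧ b ≤ 1 ∧ r ≤ 1 ∧ 8 * L ^ 2 * b ≤ μ ∧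
      16 * (300 * L ^ 2 / μ ^ 2) ^ 3 * r ^ 2 ≤ 1 ∧
      24 * (300 * L ^ 2 / μ ^ 2) ^ 4 * (L ^ 2 * (24 * b ^ 2)) ≤ 1 / 4 := by
  have hL2 : 1 ≤ L ^ 2 := one_le_pow₀ hL
  have hμ2 : μ ^ 2 ≤ μ := by nlinarith
  set Λ := 300 * L ^ 2 / μ ^ 2 with hΛdef
  have hΛL : L ^ 2 ≤ Λ * μ := by
    rw [hΛdef, div_mul_eq_mul_div, le_div_iff₀ (by positivity)]
    nlinarith [mul_le_mul_of_nonneg_left hμ2 (by positivity : 0 ≤ L ^ 2)]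
  have hΛL' : L ^ 2 ≤ Λ := by
    have hΛ0 : 0 ≤ Λ := by positivity
    exact hΛL.trans (mul_le_of_le_one_right hΛ0 hμ1)
  have hΛ : 1 ≤ Λ := hL2.trans hΛL'
  have hΛ2 : 1 ≤ Λ ^ 2 := one_le_pow₀ hΛ
  have hΛ3 : 1 ≤ Λ ^ 3 := one_le_pow₀ hΛ
  refine ⟨1 / (48 * Λ ^ 3), 1 / (4 * Λ ^ 2), by positivity, by positivity, ?_, ?_, ?_, ?_, ?_⟩
  · rw [div_le_one (by positivity)]; linarith
  · rw [div_le_one (by positivity)]; linarith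
  · rw [mul_one_div, div_le_iff₀ (by positivity)]
    have : Λ * μ ≤ Λ ^ 3 * μ := by
      gcongr
      calc Λ = Λ ^ 1 := (pow_one _).symm
        _ ≤ Λ ^ 3 := pow_le_pow_right₀ hΛ (by norm_num)
    linarith
  · have e : 16 * Λ ^ 3 * (1 / (4 * Λ ^ 2)) ^ 2 = 1 / Λ := by field_simp; norm_num
    rw [e, div_le_one (by positivity)]
    exact hΛ
  · have e : 24 * Λ ^ 4 * (L ^ 2 * (24 * (1 / (48 * Λ ^ 3)) ^ 2)) = L ^ 2 / Λ ^ 2 * (1 / 4) := by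
      field_simp; norm_num
    have h1 : L ^ 2 / Λ ^ 2 ≤ 1 := by
      rw [div_le_one (by positivity)]
      nlinarith
    rw [e]
    linarith

/-- A small factor `e` for the step size `η`. -/
lemma exists_eta_constant {A σ : ℝ} (hA : 1 ≤ A) (hσ : 0 ≤ σ) :
    ∃ e : ℝ, 0 < e ∧ e ≤ 1 / 8 ∧ A * (6 * σ ^ 2 * e ^ 2) ≤ 1 / 8 := by
  refine ⟨1 / (8 * A * (1 + σ)), by positivity, ?_, ?_⟩
  · rw [div_le_div_iff₀ (by positivity) (by norm_num)]
    nlinarith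
  · have e : A * (6 * σ ^ 2 * (1 / (8 * A * (1 + σ))) ^ 2) =
        6 * σ ^ 2 / (64 * A * (1 + σ) ^ 2) := by
      field_simp; norm_num
    rw [e, div_le_iff₀ (by positivity)]
    have h1 : (1 + σ) ^ 2 ≤ A * (1 + σ) ^ 2 := le_mul_of_one_le_left (by positivity) hA
    nlinarith

/-- The bound on the sum of squared gradients is at most `T ε`, where `ε = q²`: the terms from the
initial point are paid by the number of iterations, the stationary variance by the small step
size `η = e K q`. -/
lemma budget_le {A σ e C I I₀ J K q T h η θ B₀ : ℝ} (hA : 0 ≤ A) (he : 0 < e) (he8 : e ≤ 1 / 8)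
    (hσe : A * (6 * σ ^ 2 * e ^ 2) ≤ 1 / 8) (hK : 1 ≤ K) (hq : 0 < q) (hKq : K * q ≤ 1)
    (hη : η = e * K * q) (hθ : θ = 1 / K * η ^ 2) (hB₀ : 1 / q ≤ B₀) (hT0 : 0 ≤ T)
    (hh : 1 / (K * q) ≤ h) (hT : C * h ≤ T * q ^ 2) (hI : I ≤ I₀ / e * h)
    (hC : 4 * (A * (3 * σ ^ 2 / e ^ 2 + I₀ / e + 1)) = C)
    (hJ : (15 * σ ^ 2 + 2 * J) * (K * q) ≤ 1) :
    A * (I + (3 * (σ ^ 2 / (η ^ 2 * B₀)) + 6 * (T * η ^ 2 * σ ^ 2 / K ^ 2)) +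
      (15 * σ ^ 2 + 2 * J + 27 * (T * θ ^ 2 * σ ^ 2))) ≤ T * q ^ 2 := by
  have hK0 : 0 < K := by linarith
  have hKq0 : 0 < K * q := by positivity
  set W := T * q ^ 2 with hW
  have hW0 : 0 ≤ W := by positivity
  have t1 : σ ^ 2 / (η ^ 2 * B₀) ≤ σ ^ 2 / e ^ 2 * h := by
    have h1 : e ^ 2 * (K * q) ≤ η ^ 2 * B₀ := by
      have h2 : η ^ 2 * (1 / q) ≤ η ^ 2 * B₀ := by gcongr
      have h3 : η ^ 2 * (1 / q) = e ^ 2 * (K * q) * K := by rw [hη]; field_simp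
      have h4 : e ^ 2 * (K * q) ≤ e ^ 2 * (K * q) * K := le_mul_of_one_le_right (by positivity) hK
      linarith
    calc σ ^ 2 / (η ^ 2 * B₀) ≤ σ ^ 2 / (e ^ 2 * (K * q)) := by gcongr
      _ = σ ^ 2 / e ^ 2 * (1 / (K * q)) := by field_simp
      _ ≤ _ := by gcongr
  have t2 : T * η ^ 2 * σ ^ 2 / K ^ 2 = e ^ 2 * σ ^ 2 * W := by rw [hη, hW]; field_simp
  have t3 : T * θ ^ 2 * σ ^ 2 ≤ e ^ 4 * σ ^ 2 * W := by
    have e1 : T * θ ^ 2 * σ ^ 2 = e ^ 4 * σ ^ 2 * W * (K * q) ^ 2 := by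
      rw [hθ, hη, hW]; field_simp
    rw [e1]
    exact mul_le_of_le_one_right (by positivity) (pow_le_one₀ hKq0.le hKq)
  have t4 : 15 * σ ^ 2 + 2 * J ≤ h := by
    refine le_trans ?_ hh
    rwa [le_div_iff₀ hKq0]
  have t5 : A * (27 * (e ^ 4 * σ ^ 2 * W)) ≤ 1 / 8 * W := by
    have h1 : 27 * e ^ 2 ≤ 6 := by nlinarith
    calc A * (27 * (e ^ 4 * σ ^ 2 * W)) = A * (27 * e ^ 2 * (σ ^ 2 * e ^ 2)) * W := by ring
      _ ≤ A * (6 * (σ ^ 2 * e ^ 2)) * W := by gcongr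
      _ = A * (6 * σ ^ 2 * e ^ 2) * W := by ring
      _ ≤ _ := by gcongr
  have t6 : A * (6 * (e ^ 2 * σ ^ 2 * W)) ≤ 1 / 8 * W := by
    calc A * (6 * (e ^ 2 * σ ^ 2 * W)) = A * (6 * σ ^ 2 * e ^ 2) * W := by ring
      _ ≤ _ := by gcongr
  have t7 : A * (I₀ / e * h + 3 * (σ ^ 2 / e ^ 2 * h) + h) ≤ 1 / 4 * W := by
    calc A * (I₀ / e * h + 3 * (σ ^ 2 / e ^ 2 * h) + h) =
        1 / 4 * ((4 * (A * (3 * σ ^ 2 / e ^ 2 + I₀ / e + 1))) * h) := by ring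
      _ ≤ _ := by rw [hC]; gcongr
  calc _ ≤ A * (I₀ / e * h + (3 * (σ ^ 2 / e ^ 2 * h) + 6 * (e ^ 2 * σ ^ 2 * W)) +
        (h + 27 * (e ^ 4 * σ ^ 2 * W))) := by
        rw [t2]; gcongr
    _ = A * (I₀ / e * h + 3 * (σ ^ 2 / e ^ 2 * h) + h) + A * (6 * (e ^ 2 * σ ^ 2 * W)) +
        A * (27 * (e ^ 4 * σ ^ 2 * W)) := by ring
    _ ≤ W := by linarith

/-- The contribution of the starting point. -/
lemma initial_terms_le {ΔF ΔF' Δy Δy' Δz ρ e K q s b b₁ μ η β₁ β₂ β₃ : ℝ} (he : 0 < e) (hK : 0 < K)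
    (hq : 0 < q) (hs : 0 < s) (hs1 : s ≤ 1) (hb : 0 < b) (hb₁ : 0 < b₁) (hμ : 0 < μ)
    (hη : η = e * K * q) (hβ₁ : β₁ = b₁ * s ^ 4) (hβ₂ : β₂ = b * s ^ 2) (hβ₃ : β₃ = b * s ^ 4)
    (hF : ΔF ≤ ΔF') (hy : Δy ≤ Δy') (hy0 : 0 ≤ Δy') (hz : Δz ≤ 4 * ρ ^ 2) :
    2 * ΔF / (η * β₁) + 2 / (η * β₂ * μ) * Δy + 4 / (η * β₃ * μ) * Δz ≤
      (2 * ΔF' / b₁ + 2 * Δy' / (b * μ) + 16 * ρ ^ 2 / (b * μ)) / e * (1 / (K * s ^ 4 * q)) := by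
  subst hη hβ₁ hβ₂ hβ₃
  have hs4 : s ^ 4 ≤ s ^ 2 := pow_le_pow_of_le_one hs.le hs1 (by norm_num)
  calc _ ≤ 2 * ΔF' / (e * K * q * (b₁ * s ^ 4)) + 2 / (e * K * q * (b * s ^ 4) * μ) * Δy' +
        4 / (e * K * q * (b * s ^ 4) * μ) * (4 * ρ ^ 2) := by
        have h1 : 2 / (e * K * q * (b * s ^ 2) * μ) * Δy ≤
            2 / (e * K * q * (b * s ^ 4) * μ) * Δy' := by
          calc _ ≤ 2 / (e * K * q * (b * s ^ 2) * μ) * Δy' := by gcongr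
            _ ≤ _ := by gcongr
        gcongr
    _ = _ := by field_simp; ring

/-- Condition number: the factor that links the errors of the solution maps to the squared
gradients. -/
def Constants.cond (c : Constants) : ℝ := 300 * c.lip ^ 2 / c.mono ^ 2

/-- Factor of the final estimate of the squared gradients. -/
def Constants.amp (c : Constants) : ℝ :=
  4 * c.cond ^ 3 * (1 + 10080 * c.lip ^ 2 * c.cond ^ 4)

/-- Bound on the initial consensus errors of the three expected oracles, for heterogeneity at
most `H` at the starting point. -/
def Constants.initialSpread (c : Constants) (H : ℝ) : ℝ :=
  3 * H + (2 * (c.cgxy * (c.cfy / c.μ)) ^ 2 + 2 * (c.lgy * (c.cfy / c.μ)) ^ 2 + 2 * c.cfy ^ 2)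

lemma Constants.one_le_cond (c : Constants) : 1 ≤ c.cond := by
  have hμ := c.mono_pos
  have h1 : 1 ≤ c.lip ^ 2 := one_le_pow₀ c.one_le_lip
  have h2 : c.mono ^ 2 ≤ 1 := pow_le_one₀ hμ.le c.mono_le_one
  rw [Constants.cond, le_div_iff₀ (by positivity)]
  linarith

lemma Constants.one_le_amp (c : Constants) : 1 ≤ c.amp := by
  have h1 : 1 ≤ c.cond ^ 3 := one_le_pow₀ c.one_le_cond
  have h0 := c.one_le_cond
  have h2 : 0 ≤ 10080 * c.lip ^ 2 * c.cond ^ 4 := by positivity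
  have h3 : 1 ≤ c.cond ^ 3 * (1 + 10080 * c.lip ^ 2 * c.cond ^ 4) :=
    one_le_mul_of_one_le_of_one_le h1 (by linarith)
  unfold Constants.amp
  linarith

/-- Convergence of the algorithm for general admissible step sizes. -/
theorem Problem.Regular.sum_integral_sq_gradient_le {K dx dy : ℕ} {Ξ Z Ω : Type*}
    [MeasurableSpace Ξ] [MeasurableSpace Z] [MeasurableSpace Ω] {P : Problem K dx dy Ξ Z}
    {c : Constants} (h : P.Regular c) {E : Matrix (Fin K) (Fin K) ℝ} {x₀ : Vec dx} {y₀ z₀ : Vec dy}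
    {Pr : Measure Ω} [IsProbabilityMeasure Pr] {ξ : ℕ → Fin K → ℕ → Ω → Ξ}
    {ζ : ℕ → Fin K → ℕ → Ω → Z} (hK : 0 < K) (hE : IsMixing E) (hsamp : IsSampling P Pr ξ ζ)
    (hz : ‖z₀‖ ≤ c.cfy / c.μ) {a : Params} {θ : ℝ} (h₁ : a.α₁ * a.η ^ 2 = θ)
    (h₂ : a.α₂ * a.η ^ 2 = θ) (h₃ : a.α₃ * a.η ^ 2 = θ) (hB₀ : 1 ≤ a.B₀) (hB : 1 ≤ a.B)
    (h0 : 0 < a.η) (h1 : a.η ≤ 1) {b r : ℝ} (hβ₁ : 0 < a.β₁) (hβ₂ : 0 < a.β₂) (hβ₃ : 0 < a.β₃)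
    (hb₂ : a.β₂ ≤ b) (hb₃ : a.β₃ ≤ b) (hr₂ : a.β₁ ≤ r * a.β₂) (hr₃ : a.β₁ ≤ r * a.β₃) (hr1 : r ≤ 1)
    (hb1 : b ≤ 1) (hb : 8 * c.lip ^ 2 * b ≤ c.mono) (hr : 16 * c.cond ^ 3 * r ^ 2 ≤ 1)
    (hs₁ : a.β₁ ^ 2 ≤ (1 - lam E) ^ 4) (hs₂ : a.β₂ ^ 2 ≤ (1 - lam E) ^ 4)
    (hs₃ : a.β₃ ≤ (1 - lam E) ^ 4) (hθ : 0 < θ) (hθ1 : θ ≤ 1) (hKθ : K * θ = a.η ^ 2)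
    (hg : 24 * c.cond ^ 4 * (c.lip ^ 2 * (162 * a.η ^ 2 + 24 * b ^ 2)) ≤ 1 / 2)
    {ΔF H : ℝ} (hF : ∀ x, P.F x₀ - P.F x ≤ ΔF) (hH : P.hetAt x₀ y₀ ≤ H) {x : ℕ → Ω → Vec dx}
    (hx : x = fun t ω => xBar P E (c.cfy / c.μ) a x₀ y₀ z₀ (fun t k i => ξ t k i ω)
      (fun t k i => ζ t k i ω) t) :
    Differentiable ℝ P.F ∧ (∀ t, Integrable (fun ω => ‖gradient P.F (x t ω)‖ ^ 2) Pr) ∧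
    ∃ Δz ≤ 4 * (c.cfy / c.μ) ^ 2, ∀ T : ℕ,
      ∑ t ∈ Finset.range T, ∫ ω, ‖gradient P.F (x t ω)‖ ^ 2 ∂Pr ≤
        c.amp * ((2 * ΔF / (a.η * a.β₁) + 2 / (a.η * a.β₂ * c.mono) * ‖y₀ - P.yStar x₀‖ ^ 2 +
            4 / (a.η * a.β₃ * c.mono) * Δz) +
          (3 * (c.devOracle ^ 2 / (a.η ^ 2 * a.B₀)) +
            6 * (T * a.η ^ 2 * c.devOracle ^ 2 / K ^ 2)) +
          (15 * c.devOracle ^ 2 + 2 * c.initialSpread H +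
            27 * (T * θ ^ 2 * c.devOracle ^ 2))) := by
  subst hx
  have hL0 : 0 ≤ c.lipOracle := zero_le_one.trans c.one_le_lipOracle
  have hsm := fun i => hsamp.measurable_samplePair i
  have oG := h.sampleOracleG hsamp
  have oH := h.sampleOracleH hsamp
  have oF := h.sampleOracleF hsamp
  obtain ⟨zs, l⟩ := h.exists_landscape hK oG.lip_bar oH.lip_bar oF.lip_bar
  replace oG := oG.mono hL0 c.lip_bounds.1
  replace oH := oH.mono hL0 c.lip_bounds.1
  replace oF := oF.mono hL0 c.lip_bounds.1
  have sr := run_stormRun P E (c.cfy / c.μ) a x₀ y₀ z₀ ξ ζ h₁ h₂ h₃ rfl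
  have hgrad : ∀ x, gradient P.F x = avg fun k => P.meanF k (x, P.yStar x, zs x) :=
    fun x => (l.grad x).gradient
  have hJ := h.initial_dev_le hK x₀ y₀ z₀ hz
  refine ⟨fun x => (l.grad x).differentiableAt, fun t => ?_, ‖z₀ - zs x₀‖ ^ 2, ?_, fun T => ?_⟩
  · simp only [hgrad]
    exact sr.integrable_sq_gradient l oG oH oF hsm hsamp.indep hB₀ hB hz c.one_le_lip hK h0.le h1 t
  · have h4 : ‖z₀ - zs x₀‖ ≤ 2 * (c.cfy / c.μ) := by
      linarith [norm_sub_le z₀ (zs x₀), l.ball x₀]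
    calc ‖z₀ - zs x₀‖ ^ 2 ≤ (2 * (c.cfy / c.μ)) ^ 2 := by gcongr
      _ = _ := by ring
  · simp only [hgrad]
    exact sr.sum_integral_sq_gradient_le l oG oH oF hsm hsamp.indep hB₀ hB hz c.one_le_lip hK hE
      c.mono_pos c.mono_le_one h0 h1 hβ₁ hβ₂ hβ₃ hb₂ hb₃ hr₂ hr₃ hr1 hb1 hb hr hs₁ hs₂ hs₃ hθ hθ1
      hKθ hg hF (J := c.initialSpread H) (hJ.trans (by unfold Constants.initialSpread; linarith)) T

end DBO

end

theorem corollary1 (c : DBO.Constants) (ΔF Δy : ℝ) :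
    ∃ o : DBO.OConst, ∀ H : ℝ, ∃ ε₀ : ℝ, 0 < ε₀ ∧
      ∀ (K dx dy : ℕ) (Ξ : Type*) (Z : Type*) (Ω : Type*)
        [MeasurableSpace Ξ] [MeasurableSpace Z] [MeasurableSpace Ω]
        (P : DBO.Problem K dx dy Ξ Z) (E : Matrix (Fin K) (Fin K) ℝ)
        (x₀ : DBO.Vec dx) (y₀ z₀ : DBO.Vec dy)
        (Pr : MeasureTheory.Measure Ω) [MeasureTheory.IsProbabilityMeasure Pr]
        (ξ : ℕ → Fin K → ℕ → Ω → Ξ) (ζ : ℕ → Fin K → ℕ → Ω → Z) (ε : ℝ) (B : ℕ),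
        1 ≤ K → P.Regular c → DBO.IsMixing E → DBO.IsSampling P Pr ξ ζ →
        -- initialization
        ‖z₀‖ ≤ c.cfy / c.μ →
        (∀ x, P.F x₀ - P.F x ≤ ΔF) →
        ‖y₀ - P.yStar x₀‖ ^ 2 ≤ Δy →
        P.hetAt x₀ y₀ ≤ H →
        -- accuracy and batch size
        0 < ε → (K : ℝ) ^ 2 * ε ≤ ε₀ → 1 ≤ B →
        let a : DBO.Params := o.params K (DBO.lam E) ε B
        let T : ℕ := o.iters K (DBO.lam E) ε
        let x : ℕ → Ω → DBO.Vec dx := fun t ω =>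
          DBO.xBar P E (c.cfy / c.μ) a x₀ y₀ z₀ (fun t k i => ξ t k i ω) (fun t k i => ζ t k i ω) t
        -- the parameters are admissible
        (a.η ≤ 1 ∧ a.α₁ * a.η ^ 2 < 1 ∧ a.α₂ * a.η ^ 2 < 1 ∧ a.α₃ * a.η ^ 2 < 1) ∧
        -- convergence
        Differentiable ℝ P.F ∧
        (∀ t, MeasureTheory.Integrable (fun ω => ‖gradient P.F (x t ω)‖ ^ 2) Pr) ∧
        (1 / (T : ℝ)) * ∑ t ∈ Finset.range T, ∫ ω, ‖gradient P.F (x t ω)‖ ^ 2 ∂Pr ≤ ε ∧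
        -- communication cost of a round
        DBO.msgCost dx dy ≤ 4 * (dx + dy) := by
  have hL := c.one_le_lip
  have hμ := c.mono_pos
  have hρ := c.radius_nonneg
  have hσ : 0 ≤ c.devOracle := mul_nonneg (by linarith) c.σ_pos.le
  have hΛ := c.one_le_cond
  have hA := c.one_le_amp
  obtain ⟨b, r, hb, hr, hb1, hr1, hbμ, hrΛ, hbΛ⟩ :=
    DBO.exists_step_constants hL hμ c.mono_le_one
  change 16 * c.cond ^ 3 * r ^ 2 ≤ 1 at hrΛ
  change 24 * c.cond ^ 4 * (c.lip ^ 2 * (24 * b ^ 2)) ≤ 1 / 4 at hbΛ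
  obtain ⟨e, he, he8, hσe⟩ := DBO.exists_eta_constant hA hσ
  obtain ⟨I₀, hI₀⟩ : ∃ I₀, I₀ = 2 * |ΔF| / (r * b) + 2 * |Δy| / (b * c.mono) +
    16 * (c.cfy / c.μ) ^ 2 / (b * c.mono) := ⟨_, rfl⟩
  have hI₀' : 0 ≤ I₀ := by rw [hI₀]; positivity
  obtain ⟨C, hC⟩ : ∃ C, 4 * (c.amp * (3 * c.devOracle ^ 2 / e ^ 2 + I₀ / e + 1)) = C := ⟨_, rfl⟩
  have hC0 : 0 < C := by rw [← hC]; positivity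
  -- `αᵢ η² = η² / K` is the common momentum parameter of the three estimators
  refine ⟨⟨1, 1, 1, r * b, b, b, e, 1, C, one_pos, one_pos, one_pos, mul_pos hr hb, hb, hb, he,
    one_pos, hC0⟩, fun H => ?_⟩
  obtain ⟨X, hX⟩ : ∃ X, 15 * c.devOracle ^ 2 + 2 * c.initialSpread |H| = X := ⟨_, rfl⟩
  have hX0 : 0 ≤ X := by rw [← hX, DBO.Constants.initialSpread]; positivity
  -- the first bound makes `η` small compared with the condition number, the second one gives
  -- `K √ε (1 + X) ≤ 1`, so that `T` iterations pay for the heterogeneity and the first batch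
  refine ⟨min (1 / (15552 * c.cond ^ 4 * c.lip ^ 2)) (1 / (1 + X) ^ 2), by positivity, ?_⟩
  intro K dx dy Ξ Z Ω _ _ _ P E x₀ y₀ z₀ Pr _ ξ ζ ε B hK1 hP hE hsamp hz hF hy hH hε hKε hB a T x
  have hK : 0 < K := hK1
  have hK' : (1 : ℝ) ≤ K := by exact_mod_cast hK1
  have hK0 : (0 : ℝ) < K := by linarith
  obtain ⟨q, hqdef⟩ : ∃ q, q = ε ^ (1 / 2 : ℝ) := ⟨_, rfl⟩
  have hq : 0 < q := hqdef ▸ Real.rpow_pos_of_pos hε _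
  have hq2 : q ^ 2 = ε := by
    rw [hqdef, ← Real.sqrt_eq_rpow, Real.sq_sqrt hε.le]
  have hq3 : ε ^ (3 / 2 : ℝ) = q ^ 3 := by
    rw [hqdef, ← Real.rpow_natCast, ← Real.rpow_mul hε.le]; norm_num
  have hKq2 : (K * q) ^ 2 ≤ min (1 / (15552 * c.cond ^ 4 * c.lip ^ 2)) (1 / (1 + X) ^ 2) := by
    rw [mul_pow, hq2]; exact hKε
  have hKq0 : 0 < K * q := mul_pos hK0 hq
  have hKqX : K * q ≤ 1 / (1 + X) := by
    refine abs_le_of_sq_le_sq' ?_ (by positivity) |>.2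
    rw [div_pow, one_pow]
    exact hKq2.trans (min_le_right _ _)
  have hKq1 : K * q ≤ 1 := hKqX.trans ((div_le_one (by positivity)).2 (by linarith))
  have hXKq : X * (K * q) ≤ 1 := by
    rw [le_div_iff₀ (by positivity), mul_add] at hKqX
    linarith
  obtain ⟨s, hs⟩ : ∃ s, s = 1 - DBO.lam E := ⟨_, rfl⟩
  have hs0 : 0 < s := by linarith [hE.gap]
  have hs1 : s ≤ 1 := by linarith [DBO.lam_nonneg E]
  have hs4 : s ^ 4 ≤ 1 := pow_le_one₀ hs0.le hs1
  have hs2 : s ^ 2 ≤ 1 := pow_le_one₀ hs0.le hs1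
  have hs42 : s ^ 4 ≤ s ^ 2 := pow_le_pow_of_le_one hs0.le hs1 (by norm_num)
  have hη : a.η = e * K * q := hqdef ▸ rfl
  have hβ₁ : a.β₁ = r * b * s ^ 4 := hs ▸ rfl
  have hβ₂ : a.β₂ = b * s ^ 2 := hs ▸ rfl
  have hβ₃ : a.β₃ = b * s ^ 4 := hs ▸ rfl
  have hη0 : 0 < a.η := by rw [hη]; positivity
  have hηKq : a.η ≤ K * q := by
    rw [hη, mul_assoc]; exact mul_le_of_le_one_left hKq0.le (by linarith)
  have hηe : a.η ≤ e := by
    rw [hη, mul_assoc]; exact mul_le_of_le_one_right he.le hKq1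
  have hη1 : a.η ≤ 1 := by linarith
  have hη2 : a.η ^ 2 < 1 := pow_lt_one₀ hη0.le (by linarith) two_ne_zero
  have hθ1 : 1 / (K : ℝ) * a.η ^ 2 < 1 :=
    lt_of_le_of_lt (mul_le_of_le_one_left (sq_nonneg _) ((div_le_one hK0).2 hK')) hη2
  have hB₀ : a.B₀ = ⌈1 / q⌉₊ := hqdef ▸ rfl
  have hB₀1 : 1 ≤ a.B₀ := by
    rw [hB₀]; exact Nat.one_le_iff_ne_zero.2 (Nat.ceil_pos.2 (by positivity)).ne'
  have hT : T = ⌈C / (K * s ^ 4 * q ^ 3)⌉₊ := by rw [hs, ← hq3]; rfl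
  have hT1 : 0 < T := by rw [hT]; exact Nat.ceil_pos.2 (by positivity)
  have hTC : C * (1 / (K * s ^ 4 * q)) ≤ T * q ^ 2 := by
    have h1 : C / (K * s ^ 4 * q ^ 3) ≤ T := by rw [hT]; exact Nat.le_ceil _
    calc C * (1 / (K * s ^ 4 * q)) = C / (K * s ^ 4 * q ^ 3) * q ^ 2 := by field_simp
      _ ≤ _ := by gcongr
  have hg : 24 * c.cond ^ 4 * (c.lip ^ 2 * (162 * a.η ^ 2 + 24 * b ^ 2)) ≤ 1 / 2 := by
    have h1 : a.η ^ 2 ≤ 1 / (15552 * c.cond ^ 4 * c.lip ^ 2) :=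
      (pow_le_pow_left₀ hη0.le hηKq 2).trans (hKq2.trans (min_le_left _ _))
    rw [le_div_iff₀ (by positivity)] at h1
    calc _ = a.η ^ 2 * (15552 * c.cond ^ 4 * c.lip ^ 2) / 4 +
          24 * c.cond ^ 4 * (c.lip ^ 2 * (24 * b ^ 2)) := by ring
      _ ≤ _ := by linarith
  have hsq : ∀ β : ℝ, 0 ≤ β → β ≤ s ^ 2 → β ^ 2 ≤ (1 - DBO.lam E) ^ 4 := fun β h0 h1 => by
    rw [← hs]
    calc β ^ 2 ≤ (s ^ 2) ^ 2 := pow_le_pow_left₀ h0 h1 2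
      _ = s ^ 4 := by ring
  have hrb : r * b ≤ 1 := mul_le_one₀ hr1 hb.le hb1
  obtain ⟨hdiff, hint, Δz, hΔz, hsum⟩ := hP.sum_integral_sq_gradient_le hK hE hsamp hz (a := a)
    (θ := 1 / (K : ℝ) * a.η ^ 2) (b := b) (r := r) rfl rfl rfl hB₀1 hB hη0 hη1
    (by rw [hβ₁]; positivity) (by rw [hβ₂]; positivity) (by rw [hβ₃]; positivity)
    (by rw [hβ₂]; exact mul_le_of_le_one_right hb.le hs2)
    (by rw [hβ₃]; exact mul_le_of_le_one_right hb.le hs4)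
    (by rw [hβ₁, hβ₂, mul_assoc]; gcongr) (by rw [hβ₁, hβ₃, mul_assoc]) hr1 hb1 hbμ hrΛ
    (by
      rw [hβ₁]
      exact hsq _ (by positivity) ((mul_le_of_le_one_left (by positivity) hrb).trans hs42))
    (by rw [hβ₂]; exact hsq _ (by positivity) (mul_le_of_le_one_left (by positivity) hb1))
    (by rw [hβ₃, ← hs]; exact mul_le_of_le_one_left (by positivity) hb1)
    (by positivity) hθ1.le (by field_simp) hg hF (hH.trans (le_abs_self H)) rfl
  -- `hsum T` splits into the terms of the starting point (`initial_terms_le`) and the variance,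
  -- and `budget_le` compares both with `T ε`
  refine ⟨⟨hη1, hθ1, hθ1, hθ1⟩, hdiff, hint, ?_, ?_⟩
  · have hinit := DBO.initial_terms_le he hK0 hq hs0 hs1 hb (mul_pos hr hb) hμ hη hβ₁ hβ₂ hβ₃
      (le_abs_self ΔF) (hy.trans (le_abs_self Δy)) (abs_nonneg Δy) hΔz
    rw [← hI₀] at hinit
    have hh : 1 / (K * q) ≤ 1 / (K * s ^ 4 * q) := by
      gcongr
      exact mul_le_of_le_one_right hK0.le hs4
    have hfin := DBO.budget_le (B₀ := a.B₀) (by linarith) he he8 hσe hK' hq hKq1 hη rfl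
      (by rw [hB₀]; exact Nat.le_ceil _) (Nat.cast_nonneg T) hh hTC hinit hC (hX ▸ hXKq)
    have hT0 : (0 : ℝ) < T := by exact_mod_cast hT1
    rw [one_div, inv_mul_le_iff₀ hT0, ← hq2]
    exact (hsum T).trans hfin
  · simp only [DBO.msgCost, DBO.Msg, Module.finrank_prod, finrank_euclideanSpace_fin]
    omega
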